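/- Let $k$ be a field and let $B$ be a Hopf algebra over $k$ with invertible antipode $S$. Coalgebras are coassociative but need not be counital. A left $B$-module coalgebra is a coalgebra $C$ that is a left $B$-module with $\Delta(bc)=b_{(1)}c_{(1)}\otimes b_{(2)}c_{(2)}$. Let $X$ be an anti-Yetter--Drinfeld module, i.e. a left $B$-module and (coassociative, counital) left $B$-comodule with $$(bx)_{(-1)}\otimes (bx)_{(0)}=b_{(1)}x_{(-1)}S^{-1}(b_{(3)})\otimes b_{(2)}x_{(0)}\qquad(b\in B,\ x\in X).$$ For a $B$-module coalgebra $C$ and a $B$-equivariant $C$-bicomodule $M$ (a left $B$-module that is a $C$-bicomodule whose two coactions are $B$-linear for the diagonal actions) let $\mathrm{CH}^{\rm tw}_n(C,M;X)=X\otimes M\otimes C^{\otimes n}$ for $n\ge 0$, with $d_n=\sum_{j=0}^{n+1}(-1)^j\partial_j$, from degree $n$ to degree $n+1$, where $$\partial_j(x\otimes m\otimes c^1\otimes\cdots\otimes c^n)=\begin{cases}x\otimes m_{(0)}\otimes m_{(1)}\otimes c^1\otimes\cdots\otimes c^n& j=0,\\ x\otimes m\otimes c^1\otimes\cdots\otimes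 c^j_{(1)}\otimes c^j_{(2)}\otimes\cdots\otimes c^n&1\le j\le n,\\ x_{(0)}\otimes m_{(0)}\otimes c^1\otimes\cdots\otimes c^n\otimes x_{(-1)}m_{(-1)}&j=n+1,\end{cases}$$ and with the $B$-action $b(x\otimes m\otimes c^1\otimes\cdots\otimes c^n)=b_{(n+2)}x\otimes b_{(1)}m\otimes b_{(2)}c^1\otimes\cdots\otimes b_{(n+1)}c^n$. The maps $d_n$ induce differentials on $k\otimes_B\mathrm{CH}^{\rm tw}_n(C,M;X)$, where $B$ acts on $k$ through the counit $\varepsilon$, so that $k\otimes_B\mathrm{CH}^{\rm tw}_*(C,M;X)$ is a complex of $k$-vector spaces. Write $\mathrm{CH}^{\rm tw}_*(C;X)=\mathrm{CH}^{\rm tw}_*(C,C;X)$. A coalgebra $C$ is called H-counital if the bar complex $\mathrm{CB}_*(C)$, with $\mathrm{CB}_n(C)=C^{\otimes n+1}$ for $n\ge0$ and $d_n(c^0\otimes\cdots\otimes c^n)=\sum_{j=0}^{n}(-1)^j c^0\otimes\cdots\otimes c^j_{(1)}\otimes c^j_{(2)}\otimes\cdots\otimes c^n$, is acyclic. **Theorem.**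 Let $0\to K\to C\xrightarrow{\pi} C/K\to 0$ be a short exact sequence of $B$-module coalgebras. Assume that $C$ and $C/K$ are projective $B$-modules, that $X$ has finite projective dimension as a $B$-module, and that $C/K$ is H-counital. Regard $C/K$ as a $C$-bicomodule through $\pi(c)\mapsto c_{(1)}\otimes\pi(c_{(2)})$ and $\pi(c)\mapsto\pi(c_{(1)})\otimes c_{(2)}$. Then the map $$k\otimes_B\mathrm{CH}^{\rm tw}_*(C,C/K;X)\longrightarrow k\otimes_B\mathrm{CH}^{\rm tw}_*(C/K;X)$$ induced by $\mathrm{id}_X\otimes\mathrm{id}_{C/K}\otimes\pi^{\otimes n}$ is a quasi-isomorphism of complexes of $k$-vector spaces. -/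

import Mathlib

open TensorProduct CategoryTheory

universe u

namespace HopfHochschild

noncomputable section

section Algebraic

variable (k B : Type u) [Field k] [Ring B] [HopfAlgebra k B]

/-- The action map of a left `B`-module `V`, sending `b` to the `k`-linear endomorphism `L_b`. -/
def actionMap (V : Type u) [AddCommGroup V] [Module k V] [Module B V] [IsScalarTower k B V] :
    B →ₗ[k] V →ₗ[k] V :=
  (Algebra.lsmul k k V : B →ₐ[k] Module.End k V).toLinearMap

variable {k B} in
/-- The diagonal action on `V ⊗ W`, namely `b (v ⊗ w) = b₍₁₎ v ⊗ b₍₂₎ w`, built from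
action maps `α` on `V` and `β` on `W`. -/
def diagAction {V W : Type u} [AddCommGroup V] [Module k V] [AddCommGroup W] [Module k W]
    (α : B →ₗ[k] V →ₗ[k] V) (β : B →ₗ[k] W →ₗ[k] W) :
    B →ₗ[k] V ⊗[k] W →ₗ[k] V ⊗[k] W :=
  TensorProduct.homTensorHomMap (.id k) V W V W ∘ₗ TensorProduct.map α β ∘ₗ Coalgebra.comul

/-- A left `B`-module coalgebra. The coalgebra `C` is coassociative and need not be counital. -/
class ModuleCoalgebra (C : Type u) [AddCommGroup C] [Module k C] [Module B C]
    [IsScalarTower k B C] where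
  /-- The comultiplication. -/
  comul : C →ₗ[k] C ⊗[k] C
  /-- Coassociativity. -/
  coassoc : (TensorProduct.assoc k C C C).toLinearMap ∘ₗ comul.rTensor C ∘ₗ comul =
    comul.lTensor C ∘ₗ comul
  /-- `Δ (b c) = b₍₁₎ c₍₁₎ ⊗ b₍₂₎ c₍₂₎`. -/
  comul_smul : ∀ (b : B) (c : C),
    comul (b • c) = diagAction (actionMap k B C) (actionMap k B C) b (comul c)

/-- A morphism of `B`-module coalgebras. -/
structure ModuleCoalgebraHom (C D : Type u)
    [AddCommGroup C] [Module k C] [Module B C] [IsScalarTower k B C] [ModuleCoalgebra k B C]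
    [AddCommGroup D] [Module k D] [Module B D] [IsScalarTower k B D] [ModuleCoalgebra k B D]
    where
  /-- The underlying `B`-linear map. -/
  toFun : C →ₗ[B] D
  /-- Compatibility with the comultiplications. -/
  map_comul : TensorProduct.map (toFun.restrictScalars k) (toFun.restrictScalars k) ∘ₗ
      ModuleCoalgebra.comul B (C := C) =
    ModuleCoalgebra.comul B (C := D) ∘ₗ toFun.restrictScalars k

/-- A `B`-equivariant `C`-bicomodule structure on the left `B`-module `M`. The coactions are
coassociative; no counit axiom is imposed, since `C` need not have a counit. -/
structure EquivBicomodule (C M : Type u)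
    [AddCommGroup C] [Module k C] [Module B C] [IsScalarTower k B C] [ModuleCoalgebra k B C]
    [AddCommGroup M] [Module k M] [Module B M] [IsScalarTower k B M] where
  /-- The left coaction `m ↦ m₍₋₁₎ ⊗ m₍₀₎`. -/
  left : M →ₗ[k] C ⊗[k] M
  /-- The right coaction `m ↦ m₍₀₎ ⊗ m₍₁₎`. -/
  right : M →ₗ[k] M ⊗[k] C
  left_coassoc : (TensorProduct.assoc k C C M).toLinearMap ∘ₗ
      (ModuleCoalgebra.comul B (C := C)).rTensor M ∘ₗ left = left.lTensor C ∘ₗ left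
  right_coassoc : (TensorProduct.assoc k M C C).toLinearMap ∘ₗ right.rTensor C ∘ₗ right =
    (ModuleCoalgebra.comul B (C := C)).lTensor M ∘ₗ right
  left_right : (TensorProduct.assoc k C M C).toLinearMap ∘ₗ left.rTensor C ∘ₗ right =
    right.lTensor C ∘ₗ left
  left_smul : ∀ (b : B) (m : M),
    left (b • m) = diagAction (actionMap k B C) (actionMap k B M) b (left m)
  right_smul : ∀ (b : B) (m : M),
    right (b • m) = diagAction (actionMap k B M) (actionMap k B C) b (right m)

/-- A left `B`-comodule. -/
class LeftComodule (X : Type u) [AddCommGroup X] [Module k X] where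
  /-- The coaction `x ↦ x₍₋₁₎ ⊗ x₍₀₎`. -/
  coact : X →ₗ[k] B ⊗[k] X
  coassoc : (TensorProduct.assoc k B B X).toLinearMap ∘ₗ
      (Coalgebra.comul (R := k) (A := B)).rTensor X ∘ₗ coact = coact.lTensor B ∘ₗ coact
  counit_coact : (TensorProduct.lid k X).toLinearMap ∘ₗ
      (Coalgebra.counit (R := k) (A := B)).rTensor X ∘ₗ coact = LinearMap.id

/-- The antipode of `B` is invertible. -/
class BijectiveAntipode : Prop where
  bijective : Function.Bijective (HopfAlgebra.antipode k (A := B))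

/-- The inverse `S⁻¹` of the antipode. -/
def antipodeInv [BijectiveAntipode k B] : B →ₗ[k] B :=
  (LinearEquiv.ofBijective (HopfAlgebra.antipode k (A := B))
    BijectiveAntipode.bijective).symm.toLinearMap

/-- The linear map `b ⊗ (b' ⊗ b'') ↦ (u ⊗ y ↦ b u S⁻¹(b'') ⊗ b' y)`. -/
def aydTwist [BijectiveAntipode k B] (X : Type u) [AddCommGroup X] [Module k X] [Module B X]
    [IsScalarTower k B X] : B ⊗[k] (B ⊗[k] B) →ₗ[k] B ⊗[k] X →ₗ[k] B ⊗[k] X :=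
  TensorProduct.homTensorHomMap (.id k) B X B X ∘ₗ
    TensorProduct.map
      (TensorProduct.lift ((LinearMap.llcomp k B B B ∘ₗ LinearMap.mul k B).compl₂
        ((LinearMap.mul k B).flip ∘ₗ antipodeInv k B)))
      (actionMap k B X) ∘ₗ
    (TensorProduct.assoc k B B B).symm.toLinearMap ∘ₗ
    (TensorProduct.comm k B B).toLinearMap.lTensor B

@[simp] lemma aydTwist_tmul [BijectiveAntipode k B] (X : Type u) [AddCommGroup X] [Module k X]
    [Module B X] [IsScalarTower k B X] (b b' b'' u : B) (y : X) :
    aydTwist k B X (b ⊗ₜ (b' ⊗ₜ b'')) (u ⊗ₜ y) =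
      (b * (u * antipodeInv k B b'')) ⊗ₜ (b' • y) := by
  rfl

/-- An anti-Yetter-Drinfeld module: a left `B`-module and left `B`-comodule `X` with
`ρ (b x) = b₍₁₎ x₍₋₁₎ S⁻¹(b₍₃₎) ⊗ b₍₂₎ x₍₀₎`. -/
class AYDModule [BijectiveAntipode k B] (X : Type u) [AddCommGroup X] [Module k X] [Module B X]
    [IsScalarTower k B X] extends LeftComodule k B X where
  coact_smul : ∀ (b : B) (x : X),
    coact (b • x) = aydTwist k B X
      ((Coalgebra.comul (R := k) (A := B)).lTensor B (Coalgebra.comul b)) (coact x)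

variable {k B}

@[simp] lemma actionMap_apply (V : Type u) [AddCommGroup V] [Module k V] [Module B V]
    [IsScalarTower k B V] (b : B) (v : V) : actionMap k B V b v = b • v := rfl

section Tensors

variable (C M : Type u)
  [AddCommGroup C] [Module k C] [Module B C] [IsScalarTower k B C] [ModuleCoalgebra k B C]
  [AddCommGroup M] [Module k M] [Module B M] [IsScalarTower k B M]

variable (k) in
/-- The iterated tensor product `M ⊗ C ⊗ ⋯ ⊗ C` with `n` factors `C`. -/
def tpow (C M : Type u) [AddCommGroup C] [Module k C] [AddCommGroup M] [Module k M] :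
    ℕ → ModuleCat.{u} k
  | 0 => ModuleCat.of k M
  | n + 1 => ModuleCat.of k (tpow C M n ⊗[k] C)

variable (k B) in
/-- The diagonal action
`b (m ⊗ c¹ ⊗ ⋯ ⊗ cⁿ) = b₍₁₎ m ⊗ b₍₂₎ c¹ ⊗ ⋯ ⊗ b₍ₙ₊₁₎ cⁿ`. -/
def tpowAction : ∀ n : ℕ, B →ₗ[k] tpow k C M n →ₗ[k] tpow k C M n
  | 0 => actionMap k B M
  | n + 1 => diagAction (tpowAction n) (actionMap k B C)

variable (k B) in
/-- Comultiplication of the last factor, `v ⊗ c ↦ v ⊗ c₍₁₎ ⊗ c₍₂₎`. -/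
def splitLast (V : Type u) [AddCommGroup V] [Module k V] : V ⊗[k] C →ₗ[k] (V ⊗[k] C) ⊗[k] C :=
  (TensorProduct.assoc k V C C).symm.toLinearMap ∘ₗ
    (ModuleCoalgebra.comul B (C := C)).lTensor V

variable {C M}

variable (B) in
/-- `splitLast` as a map `M ⊗ C^{⊗ n+1} → M ⊗ C^{⊗ n+2}`. -/
def splitLastT (n : ℕ) : tpow k C M (n + 1) →ₗ[k] tpow k C M (n + 2) :=
  splitLast k B C (tpow k C M n)

/-- `f ⊗ id_C` as a map `M ⊗ C^{⊗ n+1} → M ⊗ C^{⊗ n+2}`. -/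
def rTensorT {n : ℕ} (f : tpow k C M n →ₗ[k] tpow k C M (n + 1)) :
    tpow k C M (n + 1) →ₗ[k] tpow k C M (n + 2) :=
  f.rTensor C

/-- The maps `∂_j` for `0 ≤ j ≤ n` on `m ⊗ c¹ ⊗ ⋯ ⊗ cⁿ`: `∂_0` applies the right coaction to `m`
and `∂_j` comultiplies `cʲ` for `1 ≤ j ≤ n`. -/
def face (N : EquivBicomodule k B C M) :
    ∀ n : ℕ, Fin (n + 1) → (tpow k C M n →ₗ[k] tpow k C M (n + 1))
  | 0 => fun _ => N.right
  | n + 1 => Fin.lastCases (splitLastT B n) (fun j => rTensorT (face N n j))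

/-- The alternating sum `∑_{j=0}^{n} (-1)^j ∂_j` on `M ⊗ C^{⊗ n}`. -/
def barD (N : EquivBicomodule k B C M) (n : ℕ) : tpow k C M n →ₗ[k] tpow k C M (n + 1) :=
  ∑ j : Fin (n + 1), (-1 : k) ^ (j : ℕ) • face N n j

variable (C) in
lemma tpow_hom_ext {n : ℕ} {W : Type u} [AddCommGroup W] [Module k W]
    {f g : tpow k C M (n + 1) →ₗ[k] W}
    (h : ∀ (t : tpow k C M n) (c : C), f (t ⊗ₜ[k] c : tpow k C M n ⊗[k] C) =
      g (t ⊗ₜ[k] c : tpow k C M n ⊗[k] C)) : f = g :=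
  TensorProduct.ext' (M := tpow k C M n) (N := C) h

lemma rTensorT_sum {n m : ℕ} (a : Fin m → k)
    (f : Fin m → (tpow k C M n →ₗ[k] tpow k C M (n + 1))) :
    rTensorT (∑ i, a i • f i) = ∑ i, a i • rTensorT (f i) := by
  have : ∀ g, rTensorT g = LinearMap.rTensorHom (R := k) (N := tpow k C M n)
    (P := tpow k C M (n + 1)) C g := fun _ => rfl
  simp only [this, map_sum, map_smul]
  rfl

lemma face_last (N : EquivBicomodule k B C M) (n : ℕ) :
    face N (n + 1) (Fin.last (n + 1)) = splitLastT B n := by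
  unfold face; rw [Fin.lastCases_last]

lemma face_castSucc (N : EquivBicomodule k B C M) (n : ℕ) (j : Fin (n + 1)) :
    face N (n + 1) j.castSucc = rTensorT (face N n j) := by
  exact Fin.lastCases_castSucc (motive := fun _ => tpow k C M (n + 1) →ₗ[k] tpow k C M (n + 2)) j

lemma barD_zero (N : EquivBicomodule k B C M) : barD N 0 = N.right := by
  unfold barD
  rw [Fin.sum_univ_one, Fin.val_zero, pow_zero, one_smul]
  rfl

lemma barD_succ (N : EquivBicomodule k B C M) (n : ℕ) : barD N (n + 1) =
    rTensorT (barD N n) + (-1 : k) ^ (n + 1) • splitLastT B n := by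
  unfold barD
  rw [Fin.sum_univ_castSucc]
  simp only [face_last, face_castSucc, Fin.val_castSucc, Fin.val_last]
  refine congrArg₂ (· + ·) ?_ rfl
  rw [rTensorT_sum]

variable (B) in
lemma splitLast_natural {V W : Type u} [AddCommGroup V] [Module k V] [AddCommGroup W] [Module k W]
    (f : V →ₗ[k] W) :
    splitLast k B C W ∘ₗ f.rTensor C = (f.rTensor C).rTensor C ∘ₗ splitLast k B C V := by
  refine TensorProduct.ext' fun v c => ?_
  simp only [splitLast, LinearMap.comp_apply, LinearMap.rTensor_tmul, LinearMap.lTensor_tmul,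
    LinearEquiv.coe_coe]
  induction ModuleCoalgebra.comul (k := k) B c using TensorProduct.induction_on with
  | zero => simp
  | tmul a b => simp
  | add x y hx hy => simp only [TensorProduct.tmul_add, map_add, hx, hy]

variable (B) in
lemma splitLast_comp_splitLast (V : Type u) [AddCommGroup V] [Module k V] :
    (splitLast k B C V).rTensor C ∘ₗ splitLast k B C V =
      splitLast k B C (V ⊗[k] C) ∘ₗ splitLast k B C V := by
  refine TensorProduct.ext' fun v c => ?_
  have key := LinearMap.congr_fun (ModuleCoalgebra.coassoc (k := k) (B := B) (C := C)) c
  have h1 : ∀ z : C ⊗[k] C, (splitLast k B C V).rTensor C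
      ((TensorProduct.assoc k V C C).symm (v ⊗ₜ z)) =
      ((TensorProduct.assoc k V C C).symm.toLinearMap.rTensor C)
        ((TensorProduct.assoc k V (C ⊗[k] C) C).symm
          (v ⊗ₜ ((ModuleCoalgebra.comul B (C := C)).rTensor C z))) := by
    intro z
    induction z using TensorProduct.induction_on with
    | zero => simp
    | tmul a b => simp [splitLast]
    | add x y hx hy => simp only [TensorProduct.tmul_add, map_add, hx, hy]
  have h2 : ∀ z : C ⊗[k] C, splitLast k B C (V ⊗[k] C)
      ((TensorProduct.assoc k V C C).symm (v ⊗ₜ z)) =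
      (TensorProduct.assoc k (V ⊗[k] C) C C).symm ((TensorProduct.assoc k V C (C ⊗[k] C)).symm
          (v ⊗ₜ ((ModuleCoalgebra.comul B (C := C)).lTensor C z))) := by
    intro z
    induction z using TensorProduct.induction_on with
    | zero => simp
    | tmul a b => simp [splitLast]
    | add x y hx hy => simp only [TensorProduct.tmul_add, map_add, hx, hy]
  have h3 : ∀ w : (C ⊗[k] C) ⊗[k] C, ((TensorProduct.assoc k V C C).symm.toLinearMap.rTensor C)
        ((TensorProduct.assoc k V (C ⊗[k] C) C).symm (v ⊗ₜ w)) =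
      (TensorProduct.assoc k (V ⊗[k] C) C C).symm ((TensorProduct.assoc k V C (C ⊗[k] C)).symm
          (v ⊗ₜ (TensorProduct.assoc k C C C w))) := by
    intro w
    induction w using TensorProduct.induction_on with
    | zero => simp
    | tmul a b =>
      induction a using TensorProduct.induction_on with
      | zero => simp
      | tmul a b => simp
      | add x y hx hy => simp only [TensorProduct.tmul_add, TensorProduct.add_tmul, map_add, hx, hy]
    | add x y hx hy => simp only [TensorProduct.tmul_add, map_add, hx, hy]
  simp only [LinearMap.comp_apply, LinearEquiv.coe_coe] at key
  have h4 : splitLast k B C V (v ⊗ₜ c) =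
    (TensorProduct.assoc k V C C).symm (v ⊗ₜ ModuleCoalgebra.comul (k := k) B c) := rfl
  rw [LinearMap.comp_apply, LinearMap.comp_apply, h4, h1, h2, h3, key]

lemma bar_step {V : Type u} [AddCommGroup V] [Module k V] (e : V →ₗ[k] V ⊗[k] C) (s : k)
    (h : (e.rTensor C + s • splitLast k B C V) ∘ₗ e = 0) :
    ((e.rTensor C + s • splitLast k B C V).rTensor C + (-s) • splitLast k B C (V ⊗[k] C)) ∘ₗ
      (e.rTensor C + s • splitLast k B C V) = 0 := by
  set e' := e.rTensor C + s • splitLast k B C V with he'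
  have h1 : e'.rTensor C ∘ₗ e.rTensor C = 0 := by
    rw [← LinearMap.rTensor_comp, h, LinearMap.rTensor_zero]
  have h2 : e'.rTensor C ∘ₗ splitLast k B C V = splitLast k B C (V ⊗[k] C) ∘ₗ e' := by
    rw [he', LinearMap.rTensor_add, LinearMap.rTensor_smul, LinearMap.add_comp, LinearMap.smul_comp,
      LinearMap.comp_add, LinearMap.comp_smul, splitLast_natural, splitLast_comp_splitLast]
  rw [LinearMap.add_comp, LinearMap.smul_comp, ← h2]
  nth_rewrite 2 [he']
  rw [LinearMap.comp_add, LinearMap.comp_smul, h1, zero_add]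
  module

lemma barD_comp_barD (N : EquivBicomodule k B C M) (n : ℕ) :
    barD N (n + 1) ∘ₗ barD N n = 0 := by
  induction n with
  | zero =>
    rw [barD_succ, barD_zero]
    have h := N.right_coassoc
    have : (N.right.rTensor C + (-1 : k) ^ (0 + 1) • splitLast k B C M) ∘ₗ N.right = 0 := by
      rw [splitLast, LinearMap.add_comp, LinearMap.smul_comp, LinearMap.comp_assoc, ← h,
        ← LinearMap.comp_assoc, LinearEquiv.symm_comp, LinearMap.id_comp]
      module
    exact this
  | succ n ih =>
    rw [barD_succ] at ih
    have := bar_step (k := k) (B := B) (C := C) (V := tpow k C M n) (barD N n) ((-1) ^ (n + 1)) ih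
    rw [barD_succ N (n + 1), barD_succ N n]
    rw [pow_succ (-1 : k) (n + 1), mul_neg_one]
    exact this


end Tensors

section Equivariance

variable {U V W V' W' : Type u} [AddCommGroup V] [Module k V] [AddCommGroup W] [Module k W]
  [AddCommGroup U] [Module k U] [AddCommGroup V'] [Module k V'] [AddCommGroup W'] [Module k W']

/-- `f` commutes with the actions `α` and `β`. -/
def IsEquivariant (α : B →ₗ[k] V →ₗ[k] V) (β : B →ₗ[k] W →ₗ[k] W) (f : V →ₗ[k] W) : Prop :=
  ∀ b v, f (α b v) = β b (f v)

lemma diagAction_apply (α : B →ₗ[k] V →ₗ[k] V) (β : B →ₗ[k] W →ₗ[k] W) (b : B) :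
    diagAction α β b = TensorProduct.homTensorHomMap (.id k) V W V W
      (TensorProduct.map α β (Coalgebra.comul b)) := rfl

lemma IsEquivariant.map {α : B →ₗ[k] V →ₗ[k] V} {β : B →ₗ[k] W →ₗ[k] W}
    {α' : B →ₗ[k] V' →ₗ[k] V'} {β' : B →ₗ[k] W' →ₗ[k] W'} {f : V →ₗ[k] V'} {g : W →ₗ[k] W'}
    (hf : IsEquivariant α α' f) (hg : IsEquivariant β β' g) :
    IsEquivariant (diagAction α β) (diagAction α' β') (TensorProduct.map f g) := by
  intro b z
  rw [diagAction_apply, diagAction_apply]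
  induction (Coalgebra.comul b : B ⊗[k] B) using TensorProduct.induction_on with
  | zero => simp
  | add x y hx hy => simp only [map_add, LinearMap.add_apply, hx, hy]
  | tmul p q =>
    induction z using TensorProduct.induction_on with
    | zero => simp
    | add x y hx hy => simp only [map_add, hx, hy]
    | tmul v w => simp [hf p v, hg q w]

lemma IsEquivariant.id (α : B →ₗ[k] V →ₗ[k] V) : IsEquivariant α α LinearMap.id :=
  fun _ _ => rfl

lemma IsEquivariant.comp {α : B →ₗ[k] V →ₗ[k] V} {β : B →ₗ[k] W →ₗ[k] W}
    {γ : B →ₗ[k] U →ₗ[k] U} {f : V →ₗ[k] W} {g : W →ₗ[k] U}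
    (hg : IsEquivariant β γ g) (hf : IsEquivariant α β f) : IsEquivariant α γ (g ∘ₗ f) := by
  intro b v
  rw [LinearMap.comp_apply, hf, hg, LinearMap.comp_apply]

lemma IsEquivariant.assoc (α : B →ₗ[k] U →ₗ[k] U) (β : B →ₗ[k] V →ₗ[k] V)
    (γ : B →ₗ[k] W →ₗ[k] W) :
    IsEquivariant (diagAction (diagAction α β) γ) (diagAction α (diagAction β γ))
      (TensorProduct.assoc k U V W).toLinearMap := by
  intro b z
  let T : B ⊗[k] (B ⊗[k] B) →ₗ[k] U ⊗[k] (V ⊗[k] W) →ₗ[k] U ⊗[k] (V ⊗[k] W) :=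
    TensorProduct.homTensorHomMap (.id k) U (V ⊗[k] W) U (V ⊗[k] W) ∘ₗ
      TensorProduct.map α (TensorProduct.homTensorHomMap (.id k) V W V W ∘ₗ TensorProduct.map β γ)
  have h1 : ∀ p : B ⊗[k] B, TensorProduct.homTensorHomMap (.id k) U (V ⊗[k] W) U (V ⊗[k] W)
      (TensorProduct.map α (diagAction β γ) p) =
      T ((Coalgebra.comul (R := k) (A := B)).lTensor B p) := by
    intro p
    induction p using TensorProduct.induction_on with
    | zero => simp
    | add x y hx hy => simp only [map_add, hx, hy]
    | tmul p q => rfl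
  have h2 : ∀ p : B ⊗[k] B, (TensorProduct.assoc k U V W).toLinearMap
      (TensorProduct.homTensorHomMap (.id k) (U ⊗[k] V) W (U ⊗[k] V) W
      (TensorProduct.map (diagAction α β) γ p) z) =
      T (TensorProduct.assoc k B B B ((Coalgebra.comul (R := k) (A := B)).rTensor B p))
        (TensorProduct.assoc k U V W z) := by
    intro p
    induction z using TensorProduct.induction_on with
    | zero => simp
    | add x y hx hy => simp only [map_add, hx, hy]
    | tmul z w =>
      induction z using TensorProduct.induction_on with
      | zero => simp
      | add x y hx hy => simp only [map_add, TensorProduct.add_tmul, hx, hy]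
      | tmul u v =>
        induction p using TensorProduct.induction_on with
        | zero => simp
        | add x y hx hy => simp only [map_add, LinearMap.add_apply, hx, hy]
        | tmul p q =>
          simp only [TensorProduct.map_tmul, LinearMap.rTensor_tmul,
            TensorProduct.homTensorHomMap_apply, diagAction_apply]
          induction (Coalgebra.comul p : B ⊗[k] B) using TensorProduct.induction_on with
          | zero => simp
          | add x y hx hy => simp only [map_add, LinearMap.add_apply, TensorProduct.add_tmul, hx, hy]
          | tmul p r => simp [T]
  rw [diagAction_apply, diagAction_apply, h1, h2, Coalgebra.coassoc_apply]
  rfl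

lemma IsEquivariant.symm {α : B →ₗ[k] V →ₗ[k] V} {β : B →ₗ[k] W →ₗ[k] W}
    {e : V ≃ₗ[k] W} (h : IsEquivariant α β e.toLinearMap) :
    IsEquivariant β α e.symm.toLinearMap := by
  intro b w
  apply e.injective
  have := h b (e.symm w)
  simp only [LinearEquiv.coe_coe] at this ⊢
  rw [this]; simp

end Equivariance

section Cyclic

variable (k B) in
/-- `S⁻¹(b₍₂₎) b₍₁₎ = ε(b)`. -/
lemma antipodeInv_mul [BijectiveAntipode k B] (b : B) :
    TensorProduct.lift ((LinearMap.mul k B).flip.compl₂ (antipodeInv k B)) (Coalgebra.comul b) =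
      Coalgebra.counit (R := k) b • (1 : B) := by
  have hS : ∀ c, HopfAlgebra.antipode k (antipodeInv k B c) = c := fun c =>
    LinearEquiv.apply_symm_apply (LinearEquiv.ofBijective (HopfAlgebra.antipode k (A := B)) _) c
  apply (BijectiveAntipode.bijective (k := k) (B := B)).1
  rw [map_smul, HopfAlgebra.antipode_one, ← Algebra.algebraMap_eq_smul_one,
    ← HopfAlgebra.mul_antipode_rTensor_comul_apply]
  induction (Coalgebra.comul b : B ⊗[k] B) using TensorProduct.induction_on with
  | zero => simp
  | add x y hx hy => simp only [map_add, hx, hy]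
  | tmul p q => simp [HopfAlgebra.antipode_mul_antidistrib, hS]

variable (C X V : Type u)
  [AddCommGroup C] [Module k C] [Module B C] [IsScalarTower k B C]
  [AddCommGroup X] [Module k X]
  [AddCommGroup V] [Module k V]

variable (k B) in
/-- The linear map `(b ⊗ x) ⊗ (c ⊗ v) ↦ x ⊗ (v ⊗ b c)`. -/
def cyclicMove : (B ⊗[k] X) ⊗[k] (C ⊗[k] V) →ₗ[k] X ⊗[k] (V ⊗[k] C) :=
  (TensorProduct.assoc k X V C).toLinearMap ∘ₗ
    (TensorProduct.comm k C (X ⊗[k] V)).toLinearMap ∘ₗ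
    (TensorProduct.lift (actionMap k B C)).rTensor (X ⊗[k] V) ∘ₗ
    (TensorProduct.tensorTensorTensorComm k B X C V).toLinearMap

@[simp] lemma cyclicMove_tmul (b : B) (x : X) (c : C) (v : V) :
    cyclicMove k B C X V ((b ⊗ₜ x) ⊗ₜ (c ⊗ₜ v)) = x ⊗ₜ (v ⊗ₜ (b • c)) := by
  simp [cyclicMove]

variable {C V} in
variable (B) in
/-- The map `x ⊗ v ↦ x₍₀₎ ⊗ v₍₀₎ ⊗ x₍₋₁₎ v₍₋₁₎`, where `v ↦ v₍₋₁₎ ⊗ v₍₀₎` is `l`. -/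
def cyclicMap [LeftComodule k B X] (l : V →ₗ[k] C ⊗[k] V) :
    X ⊗[k] V →ₗ[k] X ⊗[k] (V ⊗[k] C) :=
  cyclicMove k B C X V ∘ₗ TensorProduct.map LeftComodule.coact l

variable {C X V} in
/-- The action `b (x ⊗ v) = b₍₂₎ x ⊗ b₍₁₎ v` on `X ⊗ V`. -/
def twistedAction (β : B →ₗ[k] X →ₗ[k] X) (α : B →ₗ[k] V →ₗ[k] V) :
    B →ₗ[k] X ⊗[k] V →ₗ[k] X ⊗[k] V :=
  (LinearEquiv.conj (TensorProduct.comm k V X)).toLinearMap ∘ₗ diagAction α β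

/-- For an action of `B` on `W`, the kernel of `W → k ⊗_B W`: the span of the elements
`b w - ε(b) w`. -/
def coinvKer {W : Type u} [AddCommGroup W] [Module k W] (α : B →ₗ[k] W →ₗ[k] W) :
    Submodule k W :=
  Submodule.span k (Set.range fun p : B × W => α p.1 p.2 - Coalgebra.counit (R := k) p.1 • p.2)

variable {C X V}

lemma cyclicMap_natural [LeftComodule k B X] {W : Type u} [AddCommGroup W] [Module k W]
    {D : Type u} [AddCommGroup D] [Module k D] [Module B D] [IsScalarTower k B D]
    (l : V →ₗ[k] C ⊗[k] V) (l' : W →ₗ[k] D ⊗[k] W) (φ : C →ₗ[k] D)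
    (hφ : ∀ (b : B) c, φ (b • c) = b • φ c) (f : V →ₗ[k] W)
    (h : l' ∘ₗ f = TensorProduct.map φ f ∘ₗ l) :
    cyclicMap B X l' ∘ₗ f.lTensor X = (TensorProduct.map f φ).lTensor X ∘ₗ cyclicMap B X l := by
  refine TensorProduct.ext' fun x v => ?_
  have h' := LinearMap.congr_fun h v
  simp only [LinearMap.comp_apply] at h'
  simp only [cyclicMap, LinearMap.comp_apply, LinearMap.lTensor_tmul, TensorProduct.map_tmul, h']
  induction (LeftComodule.coact x : B ⊗[k] X) using TensorProduct.induction_on with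
  | zero => simp
  | add x y hx hy => simp only [map_add, TensorProduct.add_tmul, hx, hy]
  | tmul b x =>
    induction l v using TensorProduct.induction_on with
    | zero => simp
    | add x y hx hy => simp only [map_add, TensorProduct.tmul_add, hx, hy]
    | tmul c v => simp [hφ]

/-- The induced left coaction on `V ⊗ C`. -/
def leftExtend (l : V →ₗ[k] C ⊗[k] V) : V ⊗[k] C →ₗ[k] C ⊗[k] (V ⊗[k] C) :=
  (TensorProduct.assoc k C V C).toLinearMap ∘ₗ l.rTensor C

variable (B) in
lemma leftExtend_splitLast [ModuleCoalgebra k B C] (l : V →ₗ[k] C ⊗[k] V) :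
    leftExtend (leftExtend l) ∘ₗ splitLast k B C V =
      (splitLast k B C V).lTensor C ∘ₗ leftExtend l := by
  refine TensorProduct.ext' fun v c => ?_
  have h1 : ∀ z : C ⊗[k] C, leftExtend (leftExtend l) ((TensorProduct.assoc k V C C).symm (v ⊗ₜ z)) =
      (TensorProduct.assoc k V C C).symm.toLinearMap.lTensor C
        (TensorProduct.assoc k C V (C ⊗[k] C) (l v ⊗ₜ z)) := by
    intro z
    induction z using TensorProduct.induction_on with
    | zero => simp
    | add x y hx hy => simp only [map_add, TensorProduct.tmul_add, hx, hy]
    | tmul a b =>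
      simp only [leftExtend, LinearMap.comp_apply, TensorProduct.assoc_symm_tmul,
        LinearMap.rTensor_tmul, LinearEquiv.coe_coe]
      induction l v using TensorProduct.induction_on with
      | zero => simp
      | add x y hx hy => simp only [map_add, TensorProduct.add_tmul, hx, hy]
      | tmul a v => simp
  have h2 : ∀ w : C ⊗[k] V, (splitLast k B C V).lTensor C (TensorProduct.assoc k C V C (w ⊗ₜ c)) =
      (TensorProduct.assoc k V C C).symm.toLinearMap.lTensor C
        (TensorProduct.assoc k C V (C ⊗[k] C) (w ⊗ₜ ModuleCoalgebra.comul (k := k) B c)) := by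
    intro w
    induction w using TensorProduct.induction_on with
    | zero => simp
    | add x y hx hy => simp only [map_add, TensorProduct.add_tmul, hx, hy]
    | tmul a v => simp [splitLast]
  exact (h1 _).trans (h2 _).symm

variable (B) in
/-- Coassociativity of a left coaction. -/
def LeftCoassoc [ModuleCoalgebra k B C] (l : V →ₗ[k] C ⊗[k] V) : Prop :=
  (TensorProduct.assoc k C C V).toLinearMap ∘ₗ
      (ModuleCoalgebra.comul (k := k) B (C := C)).rTensor V ∘ₗ l = l.lTensor C ∘ₗ l

lemma LeftCoassoc.leftExtend [ModuleCoalgebra k B C] {l : V →ₗ[k] C ⊗[k] V}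
    (h : LeftCoassoc B l) : LeftCoassoc B (leftExtend l) := by
  refine TensorProduct.ext' fun v c => ?_
  have h' := LinearMap.congr_fun h v
  simp only [LinearMap.comp_apply, LinearEquiv.coe_coe] at h'
  have h1 : ∀ w : C ⊗[k] V, TensorProduct.assoc k C C (V ⊗[k] C)
      ((ModuleCoalgebra.comul (k := k) B (C := C)).rTensor (V ⊗[k] C)
        (TensorProduct.assoc k C V C (w ⊗ₜ c))) =
      (TensorProduct.assoc k C V C).toLinearMap.lTensor C (TensorProduct.assoc k C (C ⊗[k] V) C
        (TensorProduct.assoc k C C V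
          ((ModuleCoalgebra.comul (k := k) B (C := C)).rTensor V w) ⊗ₜ c)) := by
    intro w
    induction w using TensorProduct.induction_on with
    | zero => simp
    | add x y hx hy => simp only [map_add, TensorProduct.add_tmul, hx, hy]
    | tmul a v =>
      simp only [TensorProduct.assoc_tmul, LinearMap.rTensor_tmul]
      induction ModuleCoalgebra.comul (k := k) B a using TensorProduct.induction_on with
      | zero => simp
      | add x y hx hy => simp only [map_add, TensorProduct.add_tmul, hx, hy]
      | tmul p q => simp
  have h2 : ∀ w : C ⊗[k] V, (HopfHochschild.leftExtend l).lTensor C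
        (TensorProduct.assoc k C V C (w ⊗ₜ c)) =
      (TensorProduct.assoc k C V C).toLinearMap.lTensor C (TensorProduct.assoc k C (C ⊗[k] V) C
        (l.lTensor C w ⊗ₜ c)) := by
    intro w
    induction w using TensorProduct.induction_on with
    | zero => simp
    | add x y hx hy => simp only [map_add, TensorProduct.add_tmul, hx, hy]
    | tmul a v => simp [HopfHochschild.leftExtend]
  refine (h1 (l v)).trans ?_
  rw [h']
  exact (h2 (l v)).symm

variable (k B X C V) in
/-- The linear map `(b ⊗ (b' ⊗ x)) ⊗ (c ⊗ (c' ⊗ v)) ↦ x ⊗ ((v ⊗ b c) ⊗ b' c')`. -/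
def cyclicMove₂ : (B ⊗[k] (B ⊗[k] X)) ⊗[k] (C ⊗[k] (C ⊗[k] V)) →ₗ[k]
    X ⊗[k] ((V ⊗[k] C) ⊗[k] C) :=
  (TensorProduct.rightComm k V C C).toLinearMap.lTensor X ∘ₗ
    (TensorProduct.assoc k X (V ⊗[k] C) C).toLinearMap ∘ₗ
    (TensorProduct.comm k C (X ⊗[k] (V ⊗[k] C))).toLinearMap ∘ₗ
    TensorProduct.map (TensorProduct.lift (actionMap k B C)) (cyclicMove k B C X V) ∘ₗ
    (TensorProduct.tensorTensorTensorComm k B (B ⊗[k] X) C (C ⊗[k] V)).toLinearMap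

@[simp] lemma cyclicMove₂_tmul (b b' : B) (x : X) (c c' : C) (v : V) :
    cyclicMove₂ k B C X V ((b ⊗ₜ (b' ⊗ₜ x)) ⊗ₜ (c ⊗ₜ (c' ⊗ₜ v))) =
      x ⊗ₜ ((v ⊗ₜ (b • c)) ⊗ₜ (b' • c')) := by
  simp [cyclicMove₂]

lemma splitLast_cyclicMap [ModuleCoalgebra k B C] [LeftComodule k B X] {l : V →ₗ[k] C ⊗[k] V}
    (h : LeftCoassoc B l) :
    (splitLast k B C V).lTensor X ∘ₗ cyclicMap B X l =
      cyclicMap B X (HopfHochschild.leftExtend l) ∘ₗ cyclicMap B X l := by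
  have h0 : ∀ (p : B ⊗[k] B) (q : C ⊗[k] C) (x : X) (v : V),
      x ⊗ₜ[k] (TensorProduct.assoc k V C C).symm (v ⊗ₜ[k]
        (TensorProduct.homTensorHomMap (.id k) C C C C
          (TensorProduct.map (actionMap k B C) (actionMap k B C) p) q)) =
      cyclicMove₂ k B C X V
        (TensorProduct.assoc k B B X (p ⊗ₜ x) ⊗ₜ TensorProduct.assoc k C C V (q ⊗ₜ v)) := by
    intro p q x v
    induction p using TensorProduct.induction_on with
    | zero => simp
    | add y z hy hz =>
      simp only [map_add, LinearMap.add_apply, TensorProduct.tmul_add, TensorProduct.add_tmul, hy, hz]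
    | tmul b b' =>
      induction q using TensorProduct.induction_on with
      | zero => simp
      | add y z hy hz =>
        simp only [map_add, TensorProduct.tmul_add, TensorProduct.add_tmul, hy, hz]
      | tmul c c' => simp
  have h1 : ∀ (r : B ⊗[k] X) (w : C ⊗[k] V),
      (splitLast k B C V).lTensor X (cyclicMove k B C X V (r ⊗ₜ w)) =
      cyclicMove₂ k B C X V
        (TensorProduct.assoc k B B X ((Coalgebra.comul (R := k) (A := B)).rTensor X r) ⊗ₜ
          TensorProduct.assoc k C C V
            ((ModuleCoalgebra.comul (k := k) B (C := C)).rTensor V w)) := by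
    intro r w
    induction r using TensorProduct.induction_on with
    | zero => simp
    | add y z hy hz => simp only [map_add, TensorProduct.add_tmul, hy, hz]
    | tmul b x =>
      induction w using TensorProduct.induction_on with
      | zero => simp
      | add y z hy hz => simp only [map_add, TensorProduct.tmul_add, hy, hz]
      | tmul c v =>
        simp only [cyclicMove_tmul, LinearMap.lTensor_tmul, LinearMap.rTensor_tmul]
        rw [← h0, splitLast, LinearMap.comp_apply, LinearMap.lTensor_tmul,
          ModuleCoalgebra.comul_smul]
        rfl
  have h2 : ∀ (r : B ⊗[k] X) (w : C ⊗[k] V),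
      cyclicMap B X (HopfHochschild.leftExtend l) (cyclicMove k B C X V (r ⊗ₜ w)) =
      cyclicMove₂ k B C X V ((LeftComodule.coact (k := k) (B := B)).lTensor B r ⊗ₜ
        l.lTensor C w) := by
    intro r w
    induction r using TensorProduct.induction_on with
    | zero => simp
    | add y z hy hz => simp only [map_add, TensorProduct.add_tmul, hy, hz]
    | tmul b x =>
      induction w using TensorProduct.induction_on with
      | zero => simp
      | add y z hy hz => simp only [map_add, TensorProduct.tmul_add, hy, hz]
      | tmul c v =>
        simp only [cyclicMove_tmul, cyclicMap, LinearMap.comp_apply, TensorProduct.map_tmul,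
          HopfHochschild.leftExtend, LinearMap.rTensor_tmul, LinearMap.lTensor_tmul,
          LinearEquiv.coe_coe]
        induction (LeftComodule.coact x : B ⊗[k] X) using TensorProduct.induction_on with
        | zero => simp
        | add y z hy hz => simp only [map_add, TensorProduct.add_tmul, TensorProduct.tmul_add, hy, hz]
        | tmul b' x' =>
          induction l v using TensorProduct.induction_on with
          | zero => simp
          | add y z hy hz =>
            simp only [map_add, TensorProduct.add_tmul, TensorProduct.tmul_add, hy, hz]
          | tmul c' v' => simp
  refine TensorProduct.ext' fun x v => ?_
  have hx := LinearMap.congr_fun (LeftComodule.coassoc (k := k) (B := B) (X := X)) x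
  have hv := LinearMap.congr_fun h v
  simp only [LinearMap.comp_apply, LinearEquiv.coe_coe] at hx hv
  have h3 : cyclicMap B X l (x ⊗ₜ v) = cyclicMove k B C X V (LeftComodule.coact x ⊗ₜ l v) := rfl
  rw [LinearMap.comp_apply, LinearMap.comp_apply, h3, h1, h2, hx, hv]

lemma splitLast_equivariant [ModuleCoalgebra k B C] (α : B →ₗ[k] V →ₗ[k] V) :
    IsEquivariant (diagAction α (actionMap k B C))
      (diagAction (diagAction α (actionMap k B C)) (actionMap k B C)) (splitLast k B C V) := by
  refine (IsEquivariant.assoc _ _ _).symm.comp ((IsEquivariant.id _).map ?_)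
  exact fun b c => ModuleCoalgebra.comul_smul b c

lemma leftExtend_equivariant {α : B →ₗ[k] V →ₗ[k] V} {l : V →ₗ[k] C ⊗[k] V}
    (h : IsEquivariant α (diagAction (actionMap k B C) α) l) :
    IsEquivariant (diagAction α (actionMap k B C))
      (diagAction (actionMap k B C) (diagAction α (actionMap k B C))) (leftExtend l) :=
  (IsEquivariant.assoc _ _ _).comp (h.map (IsEquivariant.id _))

lemma twistedAction_comm {W : Type u} [AddCommGroup W] [Module k W]
    (β : B →ₗ[k] X →ₗ[k] X) {α : B →ₗ[k] V →ₗ[k] V} {α' : B →ₗ[k] W →ₗ[k] W} {f : V →ₗ[k] W}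
    (h : IsEquivariant α α' f) :
    IsEquivariant (twistedAction β α) (twistedAction β α') (f.lTensor X) := by
  intro b z
  have hz : ∀ z, TensorProduct.comm k X W (f.lTensor X z) =
      TensorProduct.map f LinearMap.id (TensorProduct.comm k X V z) := by
    intro z
    induction z using TensorProduct.induction_on with
    | zero => simp
    | add x y hx hy => simp only [map_add, hx, hy]
    | tmul x v => simp
  have key := h.map (IsEquivariant.id β) b (TensorProduct.comm k X V z)
  apply (TensorProduct.comm k X W).injective
  rw [hz]
  simp only [twistedAction, LinearMap.comp_apply, LinearEquiv.coe_coe, LinearEquiv.conj_apply,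
    TensorProduct.comm_symm, TensorProduct.comm_comm, hz]
  simpa using key

lemma coinvKer_le_of_equivariant {V W : Type u} [AddCommGroup V] [Module k V]
    [AddCommGroup W] [Module k W]
    {α : B →ₗ[k] V →ₗ[k] V} {α' : B →ₗ[k] W →ₗ[k] W} {f : V →ₗ[k] W}
    (h : IsEquivariant α α' f) : coinvKer α ≤ (coinvKer α').comap f := by
  rw [coinvKer, Submodule.span_le]
  rintro _ ⟨⟨b, v⟩, rfl⟩
  refine Submodule.subset_span ⟨(b, f v), ?_⟩
  simp [h b v]

variable (k B) in
/-- The iterated comultiplication `b ↦ b₍₁₎ ⊗ (b₍₂₎ ⊗ b₍₃₎)`. -/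
def comul₃ : B →ₗ[k] B ⊗[k] (B ⊗[k] B) :=
  (Coalgebra.comul (R := k) (A := B)).lTensor B ∘ₗ Coalgebra.comul

variable (k B) in
/-- The reassociation `(b₁ ⊗ (b₂ ⊗ b₃)) ⊗ b₄ ↦ b₁ ⊗ (b₂ ⊗ (b₃ ⊗ b₄))`. -/
def nest : (B ⊗[k] (B ⊗[k] B)) ⊗[k] B →ₗ[k] B ⊗[k] (B ⊗[k] (B ⊗[k] B)) :=
  (TensorProduct.assoc k B B B).toLinearMap.lTensor B ∘ₗ
    (TensorProduct.assoc k B (B ⊗[k] B) B).toLinearMap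

variable (k B) in
lemma comul_five (b : B) :
    (TensorProduct.assoc k B B (B ⊗[k] (B ⊗[k] B)))
      (TensorProduct.map Coalgebra.comul (comul₃ k B) (Coalgebra.comul b)) =
    (nest k B ∘ₗ (comul₃ k B).rTensor B).lTensor B (comul₃ k B b) := by
  have : (TensorProduct.assoc k B B (B ⊗[k] (B ⊗[k] B))).toLinearMap ∘ₗ
      TensorProduct.map Coalgebra.comul (comul₃ k B) ∘ₗ Coalgebra.comul =
    (nest k B ∘ₗ (comul₃ k B).rTensor B).lTensor B ∘ₗ comul₃ k B := by
    unfold nest comul₃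
    simp only [coassoc_simps]
  exact LinearMap.congr_fun this b

/-- The linear map
`b₁ ⊗ (b₂ ⊗ (b₃ ⊗ (b₄ ⊗ b₅))) ↦ b₄ y ⊗ (b₂ v ⊗ b₃ u S⁻¹(b₅) b₁ c)`. -/
def fiveMap [Module B X] [IsScalarTower k B X] [BijectiveAntipode k B]
    (α : B →ₗ[k] V →ₗ[k] V) (u : B) (y : X) (c : C) (v : V) :
    B ⊗[k] (B ⊗[k] (B ⊗[k] (B ⊗[k] B))) →ₗ[k] X ⊗[k] (V ⊗[k] C) :=
  ((((actionMap k B C).flip c ∘ₗ LinearMap.mul' k B ∘ₗ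
      (LinearMap.mul' k B ∘ₗ (TensorProduct.comm k B B).toLinearMap).lTensor B ∘ₗ
      (TensorProduct.leftComm k B B B).toLinearMap).lTensor V).lTensor X) ∘ₗ
    (TensorProduct.leftComm k B V (B ⊗[k] B)).toLinearMap.lTensor X ∘ₗ
    (TensorProduct.leftComm k B X (V ⊗[k] (B ⊗[k] B))).toLinearMap ∘ₗ
    ((TensorProduct.leftComm k V X (B ⊗[k] B)).toLinearMap ∘ₗ
      (TensorProduct.leftComm k B X B).toLinearMap.lTensor V).lTensor B ∘ₗ
    (TensorProduct.map (α.flip v) (TensorProduct.map (LinearMap.mulRight k u)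
      (TensorProduct.map ((actionMap k B X).flip y) (antipodeInv k B)))).lTensor B

@[simp] lemma fiveMap_tmul [Module B X] [IsScalarTower k B X] [BijectiveAntipode k B]
    (α : B →ₗ[k] V →ₗ[k] V) (u : B) (y : X) (c : C) (v : V) (b₁ b₂ b₃ b₄ b₅ : B) :
    fiveMap α u y c v (b₁ ⊗ₜ (b₂ ⊗ₜ (b₃ ⊗ₜ (b₄ ⊗ₜ b₅)))) =
      (b₄ • y) ⊗ₜ (α b₂ v ⊗ₜ ((b₃ * u * (antipodeInv k B b₅ * b₁)) • c)) := by
  simp [fiveMap]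

lemma cyclicMove_fiveMap [Module B X] [IsScalarTower k B X] [BijectiveAntipode k B]
    (α : B →ₗ[k] V →ₗ[k] V) (u : B) (y : X) (c : C) (v : V) (q : B ⊗[k] B)
    (r : B ⊗[k] (B ⊗[k] B)) :
    cyclicMove k B C X V (aydTwist k B X r (u ⊗ₜ y) ⊗ₜ
      (TensorProduct.homTensorHomMap (.id k) C V C V
        (TensorProduct.map (actionMap k B C) α q) (c ⊗ₜ v))) =
      fiveMap α u y c v (TensorProduct.assoc k B B _ (q ⊗ₜ r)) := by
  induction q using TensorProduct.induction_on with
  | zero => simp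
  | add x z hx hz =>
    simp only [map_add, LinearMap.add_apply, TensorProduct.tmul_add, TensorProduct.add_tmul, hx, hz]
  | tmul b₁ b₂ =>
    induction r using TensorProduct.induction_on with
    | zero => simp
    | add x z hx hz =>
      simp only [map_add, LinearMap.add_apply, TensorProduct.tmul_add, TensorProduct.add_tmul, hx,
        hz]
    | tmul b₃ r =>
      induction r using TensorProduct.induction_on with
      | zero => simp
      | add x z hx hz =>
        simp only [map_add, LinearMap.add_apply, TensorProduct.tmul_add, TensorProduct.add_tmul, hx,
          hz]
      | tmul b₄ b₅ => simp [mul_assoc, mul_smul]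

lemma fiveMap_nest [Module B X] [IsScalarTower k B X] [BijectiveAntipode k B]
    (α : B →ₗ[k] V →ₗ[k] V) (u : B) (y : X) (c : C) (v : V) (b₁ b₂ b₃ : B) :
    fiveMap α u y c v (b₁ ⊗ₜ nest k B (comul₃ k B b₂ ⊗ₜ b₃)) =
      twistedAction (actionMap k B X) (diagAction α (actionMap k B C)) b₂
        (y ⊗ₜ (v ⊗ₜ ((u * (antipodeInv k B b₃ * b₁)) • c))) := by
  have hT : ∀ z : B ⊗[k] B, fiveMap α u y c v (b₁ ⊗ₜ nest k B
      (TensorProduct.assoc k B B B ((Coalgebra.comul (R := k) (A := B)).rTensor B z) ⊗ₜ b₃)) =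
      TensorProduct.comm k _ _ (TensorProduct.homTensorHomMap (.id k) (V ⊗[k] C) X (V ⊗[k] C) X
        (TensorProduct.map (diagAction α (actionMap k B C)) (actionMap k B X) z)
        ((v ⊗ₜ ((u * (antipodeInv k B b₃ * b₁)) • c)) ⊗ₜ y)) := by
    intro z
    induction z using TensorProduct.induction_on with
    | zero => simp
    | add x z hx hz =>
      simp only [map_add, LinearMap.add_apply, TensorProduct.tmul_add, TensorProduct.add_tmul, hx,
        hz]
    | tmul z₁ z₃ =>
      simp only [LinearMap.rTensor_tmul, TensorProduct.map_tmul,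
        TensorProduct.homTensorHomMap_apply, diagAction_apply]
      induction (Coalgebra.comul z₁ : B ⊗[k] B) using TensorProduct.induction_on with
      | zero => simp
      | add x z hx hz =>
        simp only [map_add, LinearMap.add_apply, TensorProduct.tmul_add, TensorProduct.add_tmul, hx,
          hz]
      | tmul z₁ z₂ => simp [nest, mul_assoc, mul_smul]
  have := hT (Coalgebra.comul b₂)
  rw [Coalgebra.coassoc_apply] at this
  exact this

lemma cyclicMap_coinvKer [Module B X] [IsScalarTower k B X] [BijectiveAntipode k B]
    [AYDModule k B X] {α : B →ₗ[k] V →ₗ[k] V} {l : V →ₗ[k] C ⊗[k] V}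
    (h : IsEquivariant α (diagAction (actionMap k B C) α) l) :
    coinvKer (twistedAction (actionMap k B X) α) ≤
      (coinvKer (twistedAction (actionMap k B X) (diagAction α (actionMap k B C)))).comap
        (cyclicMap B X l) := by
  set J := coinvKer (twistedAction (actionMap k B X) (diagAction α (actionMap k B C))) with hJ
  have hmk : ∀ b w, J.mkQ (twistedAction (actionMap k B X) (diagAction α (actionMap k B C)) b w) =
      Coalgebra.counit (R := k) b • J.mkQ w := by
    intro b w
    rw [← sub_eq_zero, ← map_smul, ← map_sub, Submodule.mkQ_apply, Submodule.Quotient.mk_eq_zero]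
    exact Submodule.subset_span ⟨(b, w), rfl⟩
  -- the action on `(B ⊗ X) ⊗ (C ⊗ V)`
  let H : B ⊗[k] B →ₗ[k] (B ⊗[k] X) ⊗[k] (C ⊗[k] V) →ₗ[k] (B ⊗[k] X) ⊗[k] (C ⊗[k] V) :=
    TensorProduct.homTensorHomMap (.id k) (B ⊗[k] X) (C ⊗[k] V) (B ⊗[k] X) (C ⊗[k] V) ∘ₗ
      TensorProduct.map (aydTwist k B X ∘ₗ comul₃ k B) (diagAction (actionMap k B C) α) ∘ₗ
      (TensorProduct.comm k B B).toLinearMap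
  have hH : ∀ (p : B ⊗[k] B) (u : B) (y : X) (c : C) (v : V),
      cyclicMove k B C X V (H p ((u ⊗ₜ y) ⊗ₜ (c ⊗ₜ v))) = fiveMap α u y c v
        (TensorProduct.assoc k B B _ (TensorProduct.map Coalgebra.comul (comul₃ k B) p)) := by
    intro p u y c v
    induction p using TensorProduct.induction_on with
    | zero => simp
    | add x z hx hz => simp only [map_add, LinearMap.add_apply, hx, hz]
    | tmul p q =>
      rw [TensorProduct.map_tmul, ← cyclicMove_fiveMap]
      rfl
  have hR : ∀ (t : B ⊗[k] (B ⊗[k] B)) (u : B) (y : X) (c : C) (v : V),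
      J.mkQ (fiveMap α u y c v ((nest k B ∘ₗ (comul₃ k B).rTensor B).lTensor B t)) =
      J.mkQ (y ⊗ₜ (v ⊗ₜ ((u * TensorProduct.lift ((LinearMap.mul k B).flip.compl₂
        (antipodeInv k B)) (((TensorProduct.lid k B).toLinearMap ∘ₗ
          (Coalgebra.counit (R := k) (A := B)).rTensor B).lTensor B t)) • c))) := by
    intro t u y c v
    induction t using TensorProduct.induction_on with
    | zero => simp
    | add x z hx hz =>
      simp only [map_add, mul_add, add_smul, TensorProduct.tmul_add, hx, hz]
    | tmul b₁ t =>
      induction t using TensorProduct.induction_on with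
      | zero => simp
      | add x z hx hz =>
        simp only [map_add, mul_add, add_smul, TensorProduct.tmul_add, hx, hz]
      | tmul b₂ b₃ =>
        simp only [LinearMap.lTensor_tmul, LinearMap.comp_apply, LinearMap.rTensor_tmul]
        rw [fiveMap_nest, hmk, ← map_smul]
        simp
  have hfin : ∀ (b : B) (S : (B ⊗[k] X) ⊗[k] (C ⊗[k] V)),
      J.mkQ (cyclicMove k B C X V (H (Coalgebra.comul b) S)) =
        Coalgebra.counit (R := k) b • J.mkQ (cyclicMove k B C X V S) := by
    intro b S
    induction S using TensorProduct.induction_on with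
    | zero => simp
    | add x z hx hz => simp only [map_add, smul_add, hx, hz]
    | tmul r w =>
      induction r using TensorProduct.induction_on with
      | zero => simp
      | add x z hx hz => simp only [map_add, TensorProduct.add_tmul, smul_add, hx, hz]
      | tmul u y =>
        induction w using TensorProduct.induction_on with
        | zero => simp
        | add x z hx hz => simp only [map_add, TensorProduct.tmul_add, smul_add, hx, hz]
        | tmul c v =>
          have hε : ((TensorProduct.lid k B).toLinearMap ∘ₗ
              (Coalgebra.counit (R := k) (A := B)).rTensor B).lTensor B (comul₃ k B b) =
              Coalgebra.comul b := by
            have : ((TensorProduct.lid k B).toLinearMap ∘ₗ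
              (Coalgebra.counit (R := k) (A := B)).rTensor B) ∘ₗ Coalgebra.comul =
              LinearMap.id := by
              ext b; simp
            rw [comul₃, LinearMap.comp_apply, ← LinearMap.comp_apply (LinearMap.lTensor _ _),
              ← LinearMap.lTensor_comp, this, LinearMap.lTensor_id, LinearMap.id_apply]
          rw [hH, comul_five, hR, hε, antipodeInv_mul]
          simp
  have hK : ∀ (p : B ⊗[k] B) (x : X) (v : V),
      cyclicMap B X l (TensorProduct.comm k V X (TensorProduct.homTensorHomMap (.id k) V X V X
        (TensorProduct.map α (actionMap k B X) p) (v ⊗ₜ x))) =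
      cyclicMove k B C X V (H p (LeftComodule.coact x ⊗ₜ l v)) := by
    intro p x v
    induction p using TensorProduct.induction_on with
    | zero => simp
    | add x z hx hz => simp only [map_add, LinearMap.add_apply, hx, hz]
    | tmul p q =>
      simp only [TensorProduct.map_tmul, TensorProduct.homTensorHomMap_apply,
        TensorProduct.comm_tmul, actionMap_apply, cyclicMap, LinearMap.comp_apply]
      rw [AYDModule.coact_smul, h]
      rfl
  rw [coinvKer, Submodule.span_le]
  rintro _ ⟨⟨b, z⟩, rfl⟩
  change cyclicMap B X l _ ∈ J
  rw [← Submodule.Quotient.mk_eq_zero, ← Submodule.mkQ_apply, map_sub, map_sub, sub_eq_zero,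
    map_smul, map_smul]
  induction z using TensorProduct.induction_on with
  | zero => simp
  | add x z hx hz =>
    simp only at hx hz
    simp only [map_add, smul_add, hx, hz]
  | tmul x v =>
    have := hfin b (LeftComodule.coact x ⊗ₜ l v)
    rw [← hK] at this
    exact this

end Cyclic

section Complexes

variable {C M : Type u}
  [AddCommGroup C] [Module k C] [Module B C] [IsScalarTower k B C] [ModuleCoalgebra k B C]
  [AddCommGroup M] [Module k M] [Module B M] [IsScalarTower k B M]

/-- The left coaction on the first factor,
`m ⊗ c¹ ⊗ ⋯ ⊗ cⁿ ↦ m₍₋₁₎ ⊗ (m₍₀₎ ⊗ c¹ ⊗ ⋯ ⊗ cⁿ)`. -/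
def leftCoact (N : EquivBicomodule k B C M) :
    ∀ n : ℕ, tpow k C M n →ₗ[k] C ⊗[k] tpow k C M n
  | 0 => N.left
  | n + 1 => leftExtend (leftCoact N n)

lemma leftCoact_coassoc (N : EquivBicomodule k B C M) (n : ℕ) :
    LeftCoassoc B (leftCoact N n) := by
  induction n with
  | zero => exact N.left_coassoc
  | succ n ih => exact ih.leftExtend

lemma leftCoact_equivariant (N : EquivBicomodule k B C M) (n : ℕ) :
    IsEquivariant (tpowAction k B C M n) (diagAction (actionMap k B C) (tpowAction k B C M n))
      (leftCoact N n) := by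
  induction n with
  | zero => exact N.left_smul
  | succ n ih => exact leftExtend_equivariant ih

lemma face_equivariant (N : EquivBicomodule k B C M) (n : ℕ) (j : Fin (n + 1)) :
    IsEquivariant (tpowAction k B C M n) (tpowAction k B C M (n + 1)) (face N n j) := by
  induction n with
  | zero => exact N.right_smul
  | succ n ih =>
    induction j using Fin.lastCases with
    | last => rw [face_last]; exact splitLast_equivariant (tpowAction k B C M n)
    | cast j => rw [face_castSucc]; exact (ih j).map (IsEquivariant.id _)

lemma leftExtend_rTensor {V : Type u} [AddCommGroup V] [Module k V] {l : V →ₗ[k] C ⊗[k] V}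
    {e : V →ₗ[k] V ⊗[k] C} (h : leftExtend l ∘ₗ e = e.lTensor C ∘ₗ l) :
    leftExtend (leftExtend l) ∘ₗ e.rTensor C = (e.rTensor C).lTensor C ∘ₗ leftExtend l := by
  refine TensorProduct.ext' fun v c => ?_
  have hv := LinearMap.congr_fun h v
  rw [LinearMap.comp_apply, LinearMap.comp_apply] at hv
  rw [LinearMap.comp_apply, LinearMap.rTensor_tmul]
  have h1 : leftExtend (leftExtend l) (e v ⊗ₜ c) =
      TensorProduct.assoc k C (V ⊗[k] C) C (leftExtend l (e v) ⊗ₜ c) := rfl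
  have h2 : ((e.rTensor C).lTensor C ∘ₗ leftExtend l) (v ⊗ₜ c) =
      (e.rTensor C).lTensor C (TensorProduct.assoc k C V C (l v ⊗ₜ c)) := rfl
  rw [h1, h2, hv]
  induction l v using TensorProduct.induction_on with
  | zero => simp
  | add x y hx hy => simp only [map_add, TensorProduct.add_tmul, hx, hy]
  | tmul a v => simp

lemma leftExtend_step {V : Type u} [AddCommGroup V] [Module k V] {l : V →ₗ[k] C ⊗[k] V}
    {e : V →ₗ[k] V ⊗[k] C} (h : leftExtend l ∘ₗ e = e.lTensor C ∘ₗ l) (s : k) :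
    leftExtend (leftExtend l) ∘ₗ (e.rTensor C + s • splitLast k B C V) =
      (e.rTensor C + s • splitLast k B C V).lTensor C ∘ₗ leftExtend l := by
  rw [LinearMap.comp_add, LinearMap.comp_smul, leftExtend_rTensor h, leftExtend_splitLast,
    LinearMap.lTensor_add, LinearMap.lTensor_smul, LinearMap.add_comp, LinearMap.smul_comp]

lemma leftCoact_barD (N : EquivBicomodule k B C M) (n : ℕ) :
    leftCoact N (n + 1) ∘ₗ barD N n = (barD N n).lTensor C ∘ₗ leftCoact N n := by
  induction n with
  | zero => rw [barD_zero]; exact N.left_right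
  | succ n ih =>
    rw [barD_succ]
    exact leftExtend_step ih _

variable (X : Type u) [AddCommGroup X] [Module k X]

/-- The map `∂_{n+1}` on `X ⊗ M ⊗ C^{⊗ n}`,
`x ⊗ m ⊗ c¹ ⊗ ⋯ ⊗ cⁿ ↦ x₍₀₎ ⊗ m₍₀₎ ⊗ c¹ ⊗ ⋯ ⊗ cⁿ ⊗ x₍₋₁₎ m₍₋₁₎`. -/
def chCyclic [LeftComodule k B X] (N : EquivBicomodule k B C M) (n : ℕ) :
    X ⊗[k] tpow k C M n →ₗ[k] X ⊗[k] tpow k C M (n + 1) :=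
  cyclicMap B X (leftCoact N n)

/-- The maps `∂_j` for `0 ≤ j ≤ n + 1` on `X ⊗ M ⊗ C^{⊗ n}`: `id_X ⊗ ∂_j` for `j ≤ n`, and
the cyclic map for `j = n + 1`. -/
def chFace [LeftComodule k B X] (N : EquivBicomodule k B C M) (n : ℕ) (j : Fin (n + 2)) :
    X ⊗[k] tpow k C M n →ₗ[k] X ⊗[k] tpow k C M (n + 1) :=
  Fin.lastCases (motive := fun _ => X ⊗[k] tpow k C M n →ₗ[k] X ⊗[k] tpow k C M (n + 1))
    (chCyclic X N n) (fun i => (face N n i).lTensor X) j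

/-- The differential `∑_{j=0}^{n+1} (-1)^j ∂_j` of the twisted Cartier–Hochschild complex
`CH^tw_*(C, M; X)`, with `CH^tw_n(C, M; X) = X ⊗ M ⊗ C^{⊗ n}`. -/
def chD [LeftComodule k B X] (N : EquivBicomodule k B C M) (n : ℕ) :
    X ⊗[k] tpow k C M n →ₗ[k] X ⊗[k] tpow k C M (n + 1) :=
  ∑ j : Fin (n + 2), (-1 : k) ^ (j : ℕ) • chFace X N n j

variable (k B C M) in
/-- The action of `B` on `CH^tw_n(C, M; X)`,
`L_b (x ⊗ m ⊗ c¹ ⊗ ⋯ ⊗ cⁿ) = b₍ₙ₊₂₎ x ⊗ b₍₁₎ m ⊗ b₍₂₎ c¹ ⊗ ⋯ ⊗ b₍ₙ₊₁₎ cⁿ`. -/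
def chAction [Module B X] [IsScalarTower k B X] (n : ℕ) : B →ₗ[k] X ⊗[k] tpow k C M n →ₗ[k] X ⊗[k] tpow k C M n :=
  twistedAction (actionMap k B X) (tpowAction k B C M n)

lemma chD_eq [LeftComodule k B X] (N : EquivBicomodule k B C M) (n : ℕ) :
    chD X N n = (barD N n).lTensor X + (-1 : k) ^ (n + 1) • chCyclic X N n := by
  unfold chD
  rw [Fin.sum_univ_castSucc]
  have h1 : chFace X N n (Fin.last (n + 1)) = chCyclic X N n := by
    unfold chFace; rw [Fin.lastCases_last]
  have h2 : ∀ j : Fin (n + 1), chFace X N n j.castSucc = (face N n j).lTensor X := by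
    intro j; unfold chFace; rw [Fin.lastCases_castSucc]
  simp only [h1, h2, Fin.val_castSucc, Fin.val_last]
  congr 1
  unfold barD
  rw [← LinearMap.coe_lTensorHom, map_sum]
  simp only [map_smul]

lemma ch_step [LeftComodule k B X] {V : Type u} [AddCommGroup V] [Module k V]
    {l : V →ₗ[k] C ⊗[k] V} (hl : LeftCoassoc B l) {e : V →ₗ[k] V ⊗[k] C}
    (he : leftExtend l ∘ₗ e = e.lTensor C ∘ₗ l) (s : k)
    (h : (e.rTensor C + s • splitLast k B C V) ∘ₗ e = 0) :
    ((e.rTensor C + s • splitLast k B C V).lTensor X + (-s) • cyclicMap B X (leftExtend l)) ∘ₗ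
      (e.lTensor X + s • cyclicMap B X l) = 0 := by
  have h1 : (e.rTensor C + s • splitLast k B C V).lTensor X ∘ₗ e.lTensor X = 0 := by
    rw [← LinearMap.lTensor_comp, h, LinearMap.lTensor_zero]
  have h2 : (e.rTensor C + s • splitLast k B C V).lTensor X ∘ₗ cyclicMap B X l =
      cyclicMap B X (leftExtend l) ∘ₗ (e.lTensor X + s • cyclicMap B X l) := by
    rw [LinearMap.lTensor_add, LinearMap.lTensor_smul, LinearMap.add_comp, LinearMap.smul_comp,
      LinearMap.comp_add, LinearMap.comp_smul, splitLast_cyclicMap hl,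
      cyclicMap_natural l (leftExtend l) (LinearMap.id : C →ₗ[k] C) (fun _ _ => rfl) e he]
    rfl
  rw [LinearMap.add_comp, LinearMap.smul_comp, ← h2, LinearMap.comp_add, LinearMap.comp_smul, h1]
  module

lemma chD_comp_chD [LeftComodule k B X] (N : EquivBicomodule k B C M) (n : ℕ) :
    chD X N (n + 1) ∘ₗ chD X N n = 0 := by
  have h := barD_comp_barD N n
  rw [barD_succ] at h
  rw [chD_eq, chD_eq, barD_succ, pow_succ (-1 : k) (n + 1), mul_neg_one]
  exact ch_step X (leftCoact_coassoc N n) (leftCoact_barD N n) _ h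

variable {X} in
lemma chFace_last [LeftComodule k B X] (N : EquivBicomodule k B C M) (n : ℕ) :
    chFace X N n (Fin.last (n + 1)) = chCyclic X N n := by
  unfold chFace; rw [Fin.lastCases_last]

variable {X} in
lemma chFace_castSucc [LeftComodule k B X] (N : EquivBicomodule k B C M) (n : ℕ)
    (j : Fin (n + 1)) : chFace X N n j.castSucc = (face N n j).lTensor X := by
  unfold chFace; rw [Fin.lastCases_castSucc]

lemma chD_coinvKer [Module B X] [IsScalarTower k B X] [BijectiveAntipode k B] [AYDModule k B X]
    (N : EquivBicomodule k B C M) (n : ℕ) : coinvKer (chAction k B C M X n) ≤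
      (coinvKer (chAction k B C M X (n + 1))).comap (chD X N n) := by
  intro z hz
  rw [Submodule.mem_comap, chD, LinearMap.sum_apply]
  refine Submodule.sum_mem _ fun j _ => ?_
  rw [LinearMap.smul_apply]
  refine Submodule.smul_mem _ _ ?_
  induction j using Fin.lastCases with
  | last =>
    rw [chFace_last]
    exact cyclicMap_coinvKer (leftCoact_equivariant N n) hz
  | cast j =>
    rw [chFace_castSucc]
    exact coinvKer_le_of_equivariant (twistedAction_comm _ (face_equivariant N n j)) hz

/-- The complex `k ⊗_B CH^tw_*(C, M; X)`. -/
def coinvCH [Module B X] [IsScalarTower k B X] [BijectiveAntipode k B] [AYDModule k B X]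
    (N : EquivBicomodule k B C M) :
    CochainComplex (ModuleCat.{u} k) ℕ :=
  CochainComplex.of
    (fun n => ModuleCat.of k ((X ⊗[k] tpow k C M n) ⧸ coinvKer (chAction k B C M X n)))
    (fun n => ModuleCat.ofHom (Submodule.mapQ _ _ (chD X N n) (chD_coinvKer X N n)))
    (fun n => by
      refine ModuleCat.hom_ext (Submodule.linearMap_qext _ (LinearMap.ext fun z => ?_))
      change Submodule.Quotient.mk ((chD X N (n + 1) ∘ₗ chD X N n) z) = 0
      rw [chD_comp_chD]
      rfl)

lemma coinvCH_d [Module B X] [IsScalarTower k B X] [BijectiveAntipode k B] [AYDModule k B X]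
    (N : EquivBicomodule k B C M) (n : ℕ) : (coinvCH X N).d n (n + 1) =
      ModuleCat.ofHom (Submodule.mapQ _ _ (chD X N n) (chD_coinvKer X N n)) :=
  CochainComplex.of_d
    (fun n => ModuleCat.of k ((X ⊗[k] tpow k C M n) ⧸ coinvKer (chAction k B C M X n)))
    (fun n => ModuleCat.ofHom (Submodule.mapQ _ _ (chD X N n) (chD_coinvKer X N n))) n

variable (k B C) in
/-- `C` as a bicomodule over itself. -/
def regular : EquivBicomodule k B C C where
  left := ModuleCoalgebra.comul B
  right := ModuleCoalgebra.comul B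
  left_coassoc := ModuleCoalgebra.coassoc
  right_coassoc := ModuleCoalgebra.coassoc
  left_right := ModuleCoalgebra.coassoc
  left_smul := ModuleCoalgebra.comul_smul
  right_smul := ModuleCoalgebra.comul_smul

variable (k B C) in
/-- The bar complex `CB_*(C)`, with `CB_n(C) = C^{⊗ n+1}` for `n ≥ 0` and
`d = ∑_{j=0}^{n} (-1)^j ∂_j`, where `∂_j` comultiplies the factor `cʲ` of
`c⁰ ⊗ ⋯ ⊗ cⁿ`. -/
def barComplex : CochainComplex (ModuleCat.{u} k) ℕ :=
  CochainComplex.of (fun n => ModuleCat.of k (tpow k C C n))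
    (fun n => ModuleCat.ofHom (X := tpow k C C n) (Y := tpow k C C (n + 1))
      (barD (regular k B C) n))
    (fun n => ModuleCat.hom_ext (barD_comp_barD (regular k B C) n))

variable (k B C) in
/-- `C` is H-counital if its bar complex is acyclic. -/
def HCounital : Prop := (barComplex k B C).Acyclic

end Complexes

section Functoriality

variable {C D M N : Type u}
  [AddCommGroup C] [Module k C] [Module B C] [IsScalarTower k B C] [ModuleCoalgebra k B C]
  [AddCommGroup D] [Module k D] [Module B D] [IsScalarTower k B D] [ModuleCoalgebra k B D]
  [AddCommGroup M] [Module k M] [Module B M] [IsScalarTower k B M]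
  [AddCommGroup N] [Module k N] [Module B N] [IsScalarTower k B N]

/-- A `B`-linear map `f : M → N` from a `C`-bicomodule to a `D`-bicomodule is compatible with the
coactions along a morphism `φ : C → D`. -/
structure IsBicomoduleMap (P : EquivBicomodule k B C M) (P' : EquivBicomodule k B D N)
    (φ : ModuleCoalgebraHom k B C D) (f : M →ₗ[B] N) : Prop where
  left : P'.left ∘ₗ f.restrictScalars k =
    TensorProduct.map (φ.toFun.restrictScalars k) (f.restrictScalars k) ∘ₗ P.left
  right : P'.right ∘ₗ f.restrictScalars k =
    TensorProduct.map (f.restrictScalars k) (φ.toFun.restrictScalars k) ∘ₗ P.right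

/-- The map `f ⊗ φ ⊗ ⋯ ⊗ φ : M ⊗ C^{⊗ n} → N ⊗ D^{⊗ n}`. -/
def tpowMap (φ : ModuleCoalgebraHom k B C D) (f : M →ₗ[B] N) :
    ∀ n : ℕ, tpow k C M n →ₗ[k] tpow k D N n
  | 0 => f.restrictScalars k
  | n + 1 => TensorProduct.map (tpowMap φ f n) (φ.toFun.restrictScalars k)

lemma actionMap_equivariant {M N : Type u}
  [AddCommGroup M] [Module k M] [Module B M] [IsScalarTower k B M]
  [AddCommGroup N] [Module k N] [Module B N] [IsScalarTower k B N] (f : M →ₗ[B] N) :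
    IsEquivariant (k := k) (actionMap k B M) (actionMap k B N) (f.restrictScalars k) :=
  fun b m => f.map_smul b m

lemma tpowMap_equivariant (φ : ModuleCoalgebraHom k B C D) (f : M →ₗ[B] N) (n : ℕ) :
    IsEquivariant (tpowAction k B C M n) (tpowAction k B D N n) (tpowMap φ f n) := by
  induction n with
  | zero => exact fun b m => f.map_smul b m
  | succ n ih => exact ih.map (actionMap_equivariant φ.toFun)

lemma splitLast_map (φ : ModuleCoalgebraHom k B C D) {V W : Type u} [AddCommGroup V] [Module k V]
    [AddCommGroup W] [Module k W] (f : V →ₗ[k] W) :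
    splitLast k B D W ∘ₗ TensorProduct.map f (φ.toFun.restrictScalars k) =
      TensorProduct.map (TensorProduct.map f (φ.toFun.restrictScalars k))
        (φ.toFun.restrictScalars k) ∘ₗ splitLast k B C V := by
  refine TensorProduct.ext' fun v c => ?_
  have h := LinearMap.congr_fun φ.map_comul c
  simp only [LinearMap.comp_apply] at h
  simp only [splitLast, LinearMap.comp_apply, TensorProduct.map_tmul, LinearMap.lTensor_tmul, ← h,
    LinearEquiv.coe_coe]
  induction ModuleCoalgebra.comul (k := k) B c using TensorProduct.induction_on with
  | zero => simp
  | add x y hx hy => simp only [map_add, TensorProduct.tmul_add, hx, hy]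
  | tmul a b => simp

lemma leftExtend_map (φ : C →ₗ[k] D) {V W : Type u} [AddCommGroup V] [Module k V]
    [AddCommGroup W] [Module k W] {l : V →ₗ[k] C ⊗[k] V} {l' : W →ₗ[k] D ⊗[k] W} {f : V →ₗ[k] W}
    (h : l' ∘ₗ f = TensorProduct.map φ f ∘ₗ l) :
    leftExtend l' ∘ₗ TensorProduct.map f φ =
      TensorProduct.map φ (TensorProduct.map f φ) ∘ₗ leftExtend l := by
  refine TensorProduct.ext' fun v c => ?_
  have hv := LinearMap.congr_fun h v
  simp only [LinearMap.comp_apply] at hv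
  simp only [leftExtend, LinearMap.comp_apply, TensorProduct.map_tmul, LinearMap.rTensor_tmul, hv,
    LinearEquiv.coe_coe]
  induction l v using TensorProduct.induction_on with
  | zero => simp
  | add x y hx hy => simp only [map_add, TensorProduct.add_tmul, hx, hy]
  | tmul a b => simp

variable {P : EquivBicomodule k B C M} {P' : EquivBicomodule k B D N}
  {φ : ModuleCoalgebraHom k B C D} {f : M →ₗ[B] N}

lemma leftCoact_tpowMap (h : IsBicomoduleMap P P' φ f) (n : ℕ) :
    leftCoact P' n ∘ₗ tpowMap φ f n =
      TensorProduct.map (φ.toFun.restrictScalars k) (tpowMap φ f n) ∘ₗ leftCoact P n := by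
  induction n with
  | zero => exact h.left
  | succ n ih => exact leftExtend_map _ ih

lemma face_tpowMap (h : IsBicomoduleMap P P' φ f) (n : ℕ) (j : Fin (n + 1)) :
    face P' n j ∘ₗ tpowMap φ f n = tpowMap φ f (n + 1) ∘ₗ face P n j := by
  induction n with
  | zero => exact h.right
  | succ n ih =>
    induction j using Fin.lastCases with
    | last => rw [face_last, face_last]; exact splitLast_map φ (tpowMap φ f n)
    | cast j =>
      rw [face_castSucc, face_castSucc]
      refine tpow_hom_ext C fun t c => ?_
      exact congrArg (· ⊗ₜ[k] φ.toFun c) (LinearMap.congr_fun (ih j) t)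

variable (X : Type u) [AddCommGroup X] [Module k X]

lemma chD_tpowMap [LeftComodule k B X] (h : IsBicomoduleMap P P' φ f) (n : ℕ) :
    chD X P' n ∘ₗ (tpowMap φ f n).lTensor X = (tpowMap φ f (n + 1)).lTensor X ∘ₗ chD X P n := by
  unfold chD
  refine LinearMap.ext fun z => ?_
  simp only [LinearMap.comp_apply, LinearMap.sum_apply, map_sum, LinearMap.smul_apply, map_smul]
  refine Finset.sum_congr rfl fun j _ => congrArg _ ?_
  induction j using Fin.lastCases with
  | last =>
    rw [chFace_last, chFace_last]
    exact LinearMap.congr_fun (cyclicMap_natural (leftCoact P n) (leftCoact P' n)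
      (φ.toFun.restrictScalars k) (fun b c => φ.toFun.map_smul b c) (tpowMap φ f n)
      (leftCoact_tpowMap h n)) z
  | cast j =>
    rw [chFace_castSucc, chFace_castSucc, ← LinearMap.comp_apply, ← LinearMap.comp_apply,
      ← LinearMap.lTensor_comp, ← LinearMap.lTensor_comp, face_tpowMap h]

lemma tpowMap_coinvKer [Module B X] [IsScalarTower k B X] (φ : ModuleCoalgebraHom k B C D)
    (f : M →ₗ[B] N) (n : ℕ) : coinvKer (chAction k B C M X n) ≤
      (coinvKer (chAction k B D N X n)).comap ((tpowMap φ f n).lTensor X) :=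
  coinvKer_le_of_equivariant (twistedAction_comm _ (tpowMap_equivariant φ f n))

/-- The map `k ⊗_B CH^tw_*(C, M; X) → k ⊗_B CH^tw_*(D, N; X)` induced by
`id_X ⊗ f ⊗ φ ⊗ ⋯ ⊗ φ`. -/
def coinvCHMap [Module B X] [IsScalarTower k B X] [BijectiveAntipode k B] [AYDModule k B X]
    (h : IsBicomoduleMap P P' φ f) : coinvCH X P ⟶ coinvCH X P' :=
  CochainComplex.ofHom
    (fun n => ModuleCat.ofHom (Submodule.mapQ _ _ ((tpowMap φ f n).lTensor X)
      (tpowMap_coinvKer X φ f n)))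
    (fun n => by
      rw [coinvCH_d, coinvCH_d]
      refine ModuleCat.hom_ext (Submodule.linearMap_qext _ (LinearMap.ext fun z => ?_))
      exact congrArg Submodule.Quotient.mk (LinearMap.congr_fun (chD_tpowMap X h n) z))

end Functoriality

section Quotient

variable {K C Q : Type u}
  [AddCommGroup K] [Module k K] [Module B K] [IsScalarTower k B K] [ModuleCoalgebra k B K]
  [AddCommGroup C] [Module k C] [Module B C] [IsScalarTower k B C] [ModuleCoalgebra k B C]
  [AddCommGroup Q] [Module k Q] [Module B Q] [IsScalarTower k B Q] [ModuleCoalgebra k B Q]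

/-- `0 → K → C → Q → 0` is a short exact sequence of `B`-module coalgebras. -/
structure IsShortExact (ι : ModuleCoalgebraHom k B K C) (π : ModuleCoalgebraHom k B C Q) : Prop
    where
  injective : Function.Injective ι.toFun
  exact : Function.Exact ι.toFun π.toFun
  surjective : Function.Surjective π.toFun

variable {ι : ModuleCoalgebraHom k B K C} {π : ModuleCoalgebraHom k B C Q}

/-- The map `Q → V` induced by a map `g : C → V` that vanishes on the image of `K`. -/
def IsShortExact.desc (h : IsShortExact ι π) {V : Type u} [AddCommGroup V] [Module k V]
    (g : C →ₗ[k] V) (hg : ∀ x, g (ι.toFun x) = 0) : Q →ₗ[k] V :=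
  (LinearMap.ker (π.toFun.restrictScalars k)).liftQ g (fun c hc => by
      obtain ⟨x, rfl⟩ := (h.exact c).1 hc
      exact hg x) ∘ₗ
    ((π.toFun.restrictScalars k).quotKerEquivOfSurjective h.surjective).symm.toLinearMap

lemma IsShortExact.desc_apply (h : IsShortExact ι π) {V : Type u} [AddCommGroup V] [Module k V]
    (g : C →ₗ[k] V) (hg : ∀ x, g (ι.toFun x) = 0) (c : C) : h.desc g hg (π.toFun c) = g c := by
  have : ((π.toFun.restrictScalars k).quotKerEquivOfSurjective h.surjective).symm (π.toFun c) =
      Submodule.Quotient.mk c := by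
    rw [LinearEquiv.symm_apply_eq]; rfl
  rw [IsShortExact.desc, LinearMap.comp_apply, LinearEquiv.coe_coe, this]
  rfl

lemma IsShortExact.comp_eq_zero (h : IsShortExact ι π) :
    π.toFun.restrictScalars k ∘ₗ ι.toFun.restrictScalars k = 0 :=
  LinearMap.ext fun x => h.exact.apply_apply_eq_zero x

/-- The left `C`-coaction `π(c) ↦ c₍₁₎ ⊗ π(c₍₂₎)` on `Q`. -/
def IsShortExact.quotLeft (h : IsShortExact ι π) : Q →ₗ[k] C ⊗[k] Q :=
  h.desc ((π.toFun.restrictScalars k).lTensor C ∘ₗ ModuleCoalgebra.comul B) (fun x => by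
    have := LinearMap.congr_fun ι.map_comul x
    simp only [LinearMap.comp_apply, LinearMap.restrictScalars_apply] at this
    rw [LinearMap.comp_apply, ← this, LinearMap.lTensor, ← LinearMap.comp_apply,
      ← TensorProduct.map_comp, h.comp_eq_zero, TensorProduct.map_zero_right,
      LinearMap.zero_apply])

/-- The right `C`-coaction `π(c) ↦ π(c₍₁₎) ⊗ c₍₂₎` on `Q`. -/
def IsShortExact.quotRight (h : IsShortExact ι π) : Q →ₗ[k] Q ⊗[k] C :=
  h.desc ((π.toFun.restrictScalars k).rTensor C ∘ₗ ModuleCoalgebra.comul B) (fun x => by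
    have := LinearMap.congr_fun ι.map_comul x
    simp only [LinearMap.comp_apply, LinearMap.restrictScalars_apply] at this
    rw [LinearMap.comp_apply, ← this, LinearMap.rTensor, ← LinearMap.comp_apply,
      ← TensorProduct.map_comp, h.comp_eq_zero, TensorProduct.map_zero_left,
      LinearMap.zero_apply])

lemma IsShortExact.quotLeft_comp (h : IsShortExact ι π) :
    h.quotLeft ∘ₗ π.toFun.restrictScalars k =
      (π.toFun.restrictScalars k).lTensor C ∘ₗ ModuleCoalgebra.comul B :=
  LinearMap.ext fun c => by rw [LinearMap.comp_apply]; exact h.desc_apply _ _ c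

lemma IsShortExact.quotRight_comp (h : IsShortExact ι π) :
    h.quotRight ∘ₗ π.toFun.restrictScalars k =
      (π.toFun.restrictScalars k).rTensor C ∘ₗ ModuleCoalgebra.comul B :=
  LinearMap.ext fun c => by rw [LinearMap.comp_apply]; exact h.desc_apply _ _ c

lemma IsShortExact.hom_ext (h : IsShortExact ι π) {V : Type u} [AddCommGroup V] [Module k V]
    {f g : Q →ₗ[k] V}
    (hfg : f ∘ₗ π.toFun.restrictScalars k = g ∘ₗ π.toFun.restrictScalars k) : f = g := by
  refine LinearMap.ext fun q => ?_
  obtain ⟨c, rfl⟩ := h.surjective q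
  exact LinearMap.congr_fun hfg c

/-- The `B`-equivariant `C`-bicomodule structure on the quotient `Q` of `C`. -/
def IsShortExact.quotBicomodule (h : IsShortExact ι π) : EquivBicomodule k B C Q where
  left := h.quotLeft
  right := h.quotRight
  left_coassoc := by
    refine h.hom_ext (LinearMap.ext fun c => ?_)
    have h1 : ∀ c, h.quotLeft (π.toFun c) = (π.toFun.restrictScalars k).lTensor C
      (ModuleCoalgebra.comul B c) := fun c => LinearMap.congr_fun h.quotLeft_comp c
    have h2 := LinearMap.congr_fun (ModuleCoalgebra.coassoc (k := k) (B := B) (C := C)) c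
    simp only [LinearMap.comp_apply, LinearMap.restrictScalars_apply, LinearEquiv.coe_coe]
      at h1 h2 ⊢
    have h3 : ∀ z : C ⊗[k] C, TensorProduct.assoc k C C Q
        ((ModuleCoalgebra.comul (k := k) B).rTensor Q ((π.toFun.restrictScalars k).lTensor C z)) =
        ((π.toFun.restrictScalars k).lTensor C).lTensor C (TensorProduct.assoc k C C C
          ((ModuleCoalgebra.comul (k := k) B).rTensor C z)) := by
      intro z
      induction z using TensorProduct.induction_on with
      | zero => simp
      | add x y hx hy => simp only [map_add, hx, hy]
      | tmul a b =>
        simp only [LinearMap.lTensor_tmul, LinearMap.rTensor_tmul]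
        induction ModuleCoalgebra.comul (k := k) B a using TensorProduct.induction_on with
        | zero => simp
        | add x y hx hy => simp only [map_add, TensorProduct.add_tmul, hx, hy]
        | tmul p q => simp
    have h4 : ∀ z : C ⊗[k] C, h.quotLeft.lTensor C ((π.toFun.restrictScalars k).lTensor C z) =
        ((π.toFun.restrictScalars k).lTensor C).lTensor C
          ((ModuleCoalgebra.comul (k := k) B).lTensor C z) := by
      intro z
      induction z using TensorProduct.induction_on with
      | zero => simp
      | add x y hx hy => simp only [map_add, hx, hy]
      | tmul a b => simp [h1]
    rw [h1, h3, h4, h2]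
  right_coassoc := by
    refine h.hom_ext (LinearMap.ext fun c => ?_)
    have h1 : ∀ c, h.quotRight (π.toFun c) = (π.toFun.restrictScalars k).rTensor C
      (ModuleCoalgebra.comul B c) := fun c => LinearMap.congr_fun h.quotRight_comp c
    have h2 := LinearMap.congr_fun (ModuleCoalgebra.coassoc (k := k) (B := B) (C := C)) c
    simp only [LinearMap.comp_apply, LinearMap.restrictScalars_apply, LinearEquiv.coe_coe]
      at h1 h2 ⊢
    have h3 : ∀ z : C ⊗[k] C, TensorProduct.assoc k Q C C
        (h.quotRight.rTensor C ((π.toFun.restrictScalars k).rTensor C z)) =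
        (π.toFun.restrictScalars k).rTensor (C ⊗[k] C) (TensorProduct.assoc k C C C
          ((ModuleCoalgebra.comul (k := k) B).rTensor C z)) := by
      intro z
      induction z using TensorProduct.induction_on with
      | zero => simp
      | add x y hx hy => simp only [map_add, hx, hy]
      | tmul a b =>
        simp only [LinearMap.rTensor_tmul, LinearMap.restrictScalars_apply, h1]
        induction ModuleCoalgebra.comul (k := k) B a using TensorProduct.induction_on with
        | zero => simp
        | add x y hx hy => simp only [map_add, TensorProduct.add_tmul, hx, hy]
        | tmul p q => simp
    have h4 : ∀ z : C ⊗[k] C, (ModuleCoalgebra.comul (k := k) B).lTensor Q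
          ((π.toFun.restrictScalars k).rTensor C z) =
        (π.toFun.restrictScalars k).rTensor (C ⊗[k] C)
          ((ModuleCoalgebra.comul (k := k) B).lTensor C z) := by
      intro z
      induction z using TensorProduct.induction_on with
      | zero => simp
      | add x y hx hy => simp only [map_add, hx, hy]
      | tmul a b => simp
    rw [h1, h3, h4, h2]
  left_right := by
    refine h.hom_ext (LinearMap.ext fun c => ?_)
    have h1 : ∀ c, h.quotLeft (π.toFun c) = (π.toFun.restrictScalars k).lTensor C
      (ModuleCoalgebra.comul B c) := fun c => LinearMap.congr_fun h.quotLeft_comp c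
    have h1' : ∀ c, h.quotRight (π.toFun c) = (π.toFun.restrictScalars k).rTensor C
      (ModuleCoalgebra.comul B c) := fun c => LinearMap.congr_fun h.quotRight_comp c
    have h2 := LinearMap.congr_fun (ModuleCoalgebra.coassoc (k := k) (B := B) (C := C)) c
    simp only [LinearMap.comp_apply, LinearMap.restrictScalars_apply, LinearEquiv.coe_coe]
      at h1 h1' h2 ⊢
    have h3 : ∀ z : C ⊗[k] C, TensorProduct.assoc k C Q C
        (h.quotLeft.rTensor C ((π.toFun.restrictScalars k).rTensor C z)) =
        ((π.toFun.restrictScalars k).rTensor C).lTensor C (TensorProduct.assoc k C C C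
          ((ModuleCoalgebra.comul (k := k) B).rTensor C z)) := by
      intro z
      induction z using TensorProduct.induction_on with
      | zero => simp
      | add x y hx hy => simp only [map_add, hx, hy]
      | tmul a b =>
        simp only [LinearMap.rTensor_tmul, LinearMap.restrictScalars_apply, h1]
        induction ModuleCoalgebra.comul (k := k) B a using TensorProduct.induction_on with
        | zero => simp
        | add x y hx hy => simp only [map_add, TensorProduct.add_tmul, hx, hy]
        | tmul p q => simp
    have h4 : ∀ z : C ⊗[k] C, h.quotRight.lTensor C ((π.toFun.restrictScalars k).lTensor C z) =
        ((π.toFun.restrictScalars k).rTensor C).lTensor C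
          ((ModuleCoalgebra.comul (k := k) B).lTensor C z) := by
      intro z
      induction z using TensorProduct.induction_on with
      | zero => simp
      | add x y hx hy => simp only [map_add, hx, hy]
      | tmul a b => simp [h1']
    rw [h1, h1', h3, h4, h2]
  left_smul := by
    intro b q
    obtain ⟨c, rfl⟩ := h.surjective q
    have h1 := fun c => LinearMap.congr_fun h.quotLeft_comp c
    simp only [LinearMap.comp_apply, LinearMap.restrictScalars_apply] at h1
    rw [← map_smul, h1, h1, ModuleCoalgebra.comul_smul]
    exact (IsEquivariant.id (actionMap k B C)).map (actionMap_equivariant π.toFun) b _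
  right_smul := by
    intro b q
    obtain ⟨c, rfl⟩ := h.surjective q
    have h1 := fun c => LinearMap.congr_fun h.quotRight_comp c
    simp only [LinearMap.comp_apply, LinearMap.restrictScalars_apply] at h1
    rw [← map_smul, h1, h1, ModuleCoalgebra.comul_smul]
    exact (actionMap_equivariant π.toFun).map (IsEquivariant.id (actionMap k B C)) b _

lemma IsShortExact.id_isBicomoduleMap (h : IsShortExact ι π) :
    IsBicomoduleMap h.quotBicomodule (regular k B Q) π LinearMap.id where
  left := by
    apply h.hom_ext
    have h1 := h.quotLeft_comp
    have h2 := π.map_comul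
    change ModuleCoalgebra.comul B ∘ₗ π.toFun.restrictScalars k =
      ((π.toFun.restrictScalars k).rTensor Q ∘ₗ h.quotLeft) ∘ₗ π.toFun.restrictScalars k
    rw [LinearMap.comp_assoc, h1, ← h2, ← LinearMap.comp_assoc, LinearMap.rTensor_comp_lTensor]
  right := by
    apply h.hom_ext
    have h1 := h.quotRight_comp
    have h2 := π.map_comul
    change ModuleCoalgebra.comul B ∘ₗ π.toFun.restrictScalars k =
      ((π.toFun.restrictScalars k).lTensor Q ∘ₗ h.quotRight) ∘ₗ π.toFun.restrictScalars k
    rw [LinearMap.comp_assoc, h1, ← h2, ← LinearMap.comp_assoc, LinearMap.lTensor_comp_rTensor]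

/-- The map `k ⊗_B CH^tw_*(C, Q; X) → k ⊗_B CH^tw_*(Q; X)` induced by `π : C → Q`. -/
def IsShortExact.inducedMap (h : IsShortExact ι π) (X : Type u) [AddCommGroup X] [Module k X]
    [Module B X] [IsScalarTower k B X] [BijectiveAntipode k B] [AYDModule k B X] :
    coinvCH X h.quotBicomodule ⟶ coinvCH X (regular k B Q) :=
  coinvCHMap X h.id_isBicomoduleMap

end Quotient

end Algebraic

end

end HopfHochschild

/-! Write `Q` for `C/K`. In each degree the map is surjective with a `B`-linear section, so it is
enough to show that its kernel is exact (`quasiIso_of_surjective_of_kernel_exact`). Everything is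
done with elements of `X ⊗ Q ⊗ C^{⊗ n}` modulo `coinvKer`; the splittings used are `B`-linear, so
they survive `k ⊗_B`.

As `Q` is projective, `C = K ⊕ Q` over `B`, and `idem` is the projection onto the copy of `Q`. The
tensors having a factor from `K` beyond the first `p` factors `C` form the kernel of `proj p`. These
kernels are subcomplexes (`proj_chD_proj`) that shrink as `p` grows: `p = 0` gives the kernel of the
map to be studied, and in degree `n` the kernel is zero once `p ≥ n`. So a cycle of the kernel can
be corrected by boundaries one `p` at a time (`exists_proj_sub_chD_mem`, `exists_sub_chD_mem`).

In degree `p + 1 + l` the layer between `proj p` and `proj (p + 1)` is `X ⊗ Q ⊗ C^{⊗ p} ⊗ K ⊗ Q^{⊗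
l}`, that is `X ⊗ Q ⊗ W ⊗ Q^{⊗ l}` with `W = C^{⊗ p} ⊗ K`. The faces acting before `K` push `K` one
place to the right, and `Δ(K) ⊆ K ⊗ K`; in either case a factor `K` appears in a place where `proj
(p + 1)` kills it. What is left is the comultiplication of the last factors `Q` and the cyclic face,
which now uses the comultiplication of `Q` on the leading factor (`proj_chD_embed`).

The rotation `x ⊗ m ⊗ u ↦ x₍₀₎ ⊗ u ⊗ x₍₋₁₎ m` moves the leading `Q` to the end. It is bijective
because `S` is, it respects coinvariants because `X` is anti-Yetter-Drinfeld (`rotateEquiv_mem`),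
and it turns the cyclic face into the comultiplication of the new last factor
(`rotateEquiv_freeCyclic`). The layer thus becomes the bar complex of `Q` tensored with `X` and an
inert `W` (`rotateT_freeD`).

That bar complex tensored with `W` is exact since `Q` is H-counital. Exactness persists in `k ⊗_B (X
⊗ -)`: when `X` is projective this is a dual basis argument (`balKer_exact`), and in general one
inducts on the projective dimension of `X` (`coinvExact_of_hasProjectiveDimensionLE`). The induction
needs `k ⊗_B (W ⊗ Q^{⊗ l} ⊗ -)` to be exact, which holds because `C`, and hence its summand `K`, is
projective. -/

namespace HopfHochschild

noncomputable section

/-! ### Coinvariants of a tensor product as a balanced tensor product. -/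

section Actions

variable {k B : Type u} [Field k] [Ring B] [HopfAlgebra k B]
variable {V W Y : Type u} [AddCommGroup V] [Module k V] [AddCommGroup W] [Module k W]
  [AddCommGroup Y] [Module k Y]

/-- The linear map `α : B → End V` is a unital multiplicative action. -/
structure IsAction (α : B →ₗ[k] V →ₗ[k] V) : Prop where
  one : α 1 = LinearMap.id
  mul : ∀ a b, α (a * b) = α a ∘ₗ α b

lemma IsAction.mul_apply {α : B →ₗ[k] V →ₗ[k] V} (h : IsAction α) (a b : B) (v : V) :
    α (a * b) v = α a (α b v) := by
  rw [h.mul, LinearMap.comp_apply]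

lemma IsAction.one_apply {α : B →ₗ[k] V →ₗ[k] V} (h : IsAction α) (v : V) : α 1 v = v := by
  rw [h.one, LinearMap.id_apply]

lemma isAction_actionMap (V : Type u) [AddCommGroup V] [Module k V] [Module B V]
    [IsScalarTower k B V] : IsAction (actionMap k B V) where
  one := LinearMap.ext fun v => one_smul B v
  mul a b := LinearMap.ext fun v => mul_smul a b v

/-- This is where the comultiplication being a unital algebra map enters. -/
lemma IsAction.diag {α : B →ₗ[k] V →ₗ[k] V} {β : B →ₗ[k] W →ₗ[k] W} (hα : IsAction α)
    (hβ : IsAction β) : IsAction (diagAction α β) where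
  one := by
    rw [diagAction_apply, Bialgebra.comul_one, Algebra.TensorProduct.one_def,
      TensorProduct.map_tmul, hα.one, hβ.one, TensorProduct.homTensorHomMap_apply,
      TensorProduct.map_id]
  mul a b := by
    rw [diagAction_apply, diagAction_apply, diagAction_apply, Bialgebra.comul_mul]
    generalize (Coalgebra.comul a : B ⊗[k] B) = x
    generalize (Coalgebra.comul b : B ⊗[k] B) = y
    induction x using TensorProduct.induction_on with
    | zero => simp
    | add x x' hx hx' => simp only [add_mul, map_add, hx, hx', LinearMap.add_comp]
    | tmul p q =>
      induction y using TensorProduct.induction_on with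
      | zero => simp
      | add x x' hx hx' => simp only [mul_add, map_add, hx, hx', LinearMap.comp_add]
      | tmul r s =>
        simp only [Algebra.TensorProduct.tmul_mul_tmul, TensorProduct.map_tmul,
          TensorProduct.homTensorHomMap_apply, hα.mul, hβ.mul, TensorProduct.map_comp]

/-- The span of the elements `b v ⊗ w - v ⊗ σ(b) w`. -/
def balKer (α : B →ₗ[k] V →ₗ[k] V) (β : B →ₗ[k] W →ₗ[k] W) (σ : B →ₗ[k] B) :
    Submodule k (V ⊗[k] W) :=
  Submodule.span k (Set.range fun p : B × V × W =>
    α p.1 p.2.1 ⊗ₜ[k] p.2.2 - p.2.1 ⊗ₜ[k] β (σ p.1) p.2.2)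

lemma sub_mem_balKer (α : B →ₗ[k] V →ₗ[k] V) (β : B →ₗ[k] W →ₗ[k] W) (σ : B →ₗ[k] B) (b : B)
    (v : V) (w : W) : α b v ⊗ₜ[k] w - v ⊗ₜ[k] β (σ b) w ∈ balKer α β σ :=
  Submodule.subset_span ⟨(b, v, w), rfl⟩

lemma sub_mem_coinvKer (α : B →ₗ[k] V →ₗ[k] V) (b : B) (v : V) :
    α b v - Coalgebra.counit (R := k) b • v ∈ coinvKer α :=
  Submodule.subset_span ⟨(b, v), rfl⟩

lemma mkQ_coinvKer (α : B →ₗ[k] V →ₗ[k] V) (b : B) (v : V) :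
    (coinvKer α).mkQ (α b v) = Coalgebra.counit (R := k) b • (coinvKer α).mkQ v := by
  rw [← sub_eq_zero, ← map_smul, ← map_sub, Submodule.mkQ_apply, Submodule.Quotient.mk_eq_zero]
  exact sub_mem_coinvKer α b v

lemma mkQ_balKer (α : B →ₗ[k] V →ₗ[k] V) (β : B →ₗ[k] W →ₗ[k] W) (σ : B →ₗ[k] B) (b : B)
    (v : V) (w : W) :
    (balKer α β σ).mkQ (α b v ⊗ₜ[k] w) = (balKer α β σ).mkQ (v ⊗ₜ[k] β (σ b) w) := by
  rw [← sub_eq_zero, ← map_sub, Submodule.mkQ_apply, Submodule.Quotient.mk_eq_zero]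
  exact sub_mem_balKer α β σ b v w

/-- The counit axiom `ε(b₍₁₎) f(b₍₂₎) = f(b)`, in the shape produced when coinvariance replaces an
action by `ε`. -/
lemma comul_counit_left (f : B →ₗ[k] V) (b : B) :
    TensorProduct.lift (LinearMap.lsmul k V ∘ₗ Coalgebra.counit)
      (f.lTensor B (Coalgebra.comul b)) = f b := by
  have : ∀ z : B ⊗[k] B, TensorProduct.lift (LinearMap.lsmul k V ∘ₗ Coalgebra.counit)
      (f.lTensor B z) = f (TensorProduct.lid k B
        ((Coalgebra.counit (R := k) (A := B)).rTensor B z)) := by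
    intro z
    induction z using TensorProduct.induction_on with
    | zero => simp
    | add x y hx hy => simp only [map_add, hx, hy]
    | tmul p q => simp
  rw [this]; simp

lemma comul_counit_right (f : B →ₗ[k] V) (b : B) :
    TensorProduct.lift (LinearMap.lsmul k V ∘ₗ Coalgebra.counit).flip
      (f.rTensor B (Coalgebra.comul b)) = f b := by
  have : ∀ z : B ⊗[k] B, TensorProduct.lift (LinearMap.lsmul k V ∘ₗ Coalgebra.counit).flip
      (f.rTensor B z) = f (TensorProduct.rid k B
        ((Coalgebra.counit (R := k) (A := B)).lTensor B z)) := by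
    intro z
    induction z using TensorProduct.induction_on with
    | zero => simp
    | add x y hx hy => simp only [map_add, hx, hy]
    | tmul p q => simp
  rw [this]; simp

/-- `k ⊗_B (V ⊗ W)` is obtained by identifying `b v ⊗ w` with `v ⊗ S(b) w`. -/
lemma coinvKer_diagAction {α : B →ₗ[k] V →ₗ[k] V} {β : B →ₗ[k] W →ₗ[k] W}
    (hβ : IsAction β) :
    coinvKer (diagAction α β) = balKer α β (HopfAlgebra.antipode k) := by
  apply le_antisymm
  · rw [coinvKer, Submodule.span_le]
    rintro _ ⟨⟨b, z⟩, rfl⟩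
    change _ ∈ balKer α β (HopfAlgebra.antipode k)
    rw [← Submodule.Quotient.mk_eq_zero, ← Submodule.mkQ_apply, map_sub, sub_eq_zero]
    induction z using TensorProduct.induction_on with
    | zero => simp
    | add x y hx hy => simp only at hx hy; simp only [map_add, smul_add, hx, hy]
    | tmul v w =>
      -- Balancing gives `b₍₁₎ v ⊗ b₍₂₎ w ≡ v ⊗ S(b₍₁₎) b₍₂₎ w`, and the antipode axiom collapses
      -- the right side to `ε(b)`.
      have h : ∀ t : B ⊗[k] B, (balKer α β (HopfAlgebra.antipode k)).mkQ
          (TensorProduct.homTensorHomMap (.id k) V W V W (TensorProduct.map α β t) (v ⊗ₜ w)) =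
          (balKer α β (HopfAlgebra.antipode k)).mkQ (v ⊗ₜ β (LinearMap.mul' k B
            ((HopfAlgebra.antipode k).rTensor B t)) w) := by
        intro t
        induction t using TensorProduct.induction_on with
        | zero => simp
        | add x y hx hy =>
          simp only [map_add, LinearMap.add_apply, TensorProduct.tmul_add, hx, hy]
        | tmul p q =>
          simp only [TensorProduct.map_tmul, TensorProduct.homTensorHomMap_apply,
            LinearMap.rTensor_tmul, LinearMap.mul'_apply, hβ.mul_apply, mkQ_balKer]
      simp only [diagAction_apply]
      rw [h, HopfAlgebra.mul_antipode_rTensor_comul_apply, Algebra.algebraMap_eq_smul_one,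
        map_smul, LinearMap.smul_apply, hβ.one_apply, TensorProduct.tmul_smul]
  · rw [balKer, Submodule.span_le]
    rintro _ ⟨⟨b, v, w⟩, rfl⟩
    change _ ∈ coinvKer (diagAction α β)
    rw [← Submodule.Quotient.mk_eq_zero, ← Submodule.mkQ_apply, map_sub, sub_eq_zero]
    simp only
    -- `Φ` is `b₁ ⊗ b₂ ⊗ b₃ ↦ b₁ v ⊗ b₂ S(b₃) w`. On the iterated comultiplication it can be read in
    -- two ways: grouping the first two legs gives `v ⊗ S(b) w` modulo coinvariance, grouping the
    -- last two gives `b v ⊗ w`.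
    let Φ : B ⊗[k] (B ⊗[k] B) →ₗ[k] V ⊗[k] W := TensorProduct.map (α.flip v)
      (β.flip w ∘ₗ LinearMap.mul' k B ∘ₗ (HopfAlgebra.antipode k).lTensor B)
    have h1 : ∀ t : B ⊗[k] B, (coinvKer (diagAction α β)).mkQ
        (Φ (TensorProduct.assoc k B B B ((Coalgebra.comul (R := k) (A := B)).rTensor B t))) =
        TensorProduct.lift (LinearMap.lsmul k _ ∘ₗ Coalgebra.counit)
          (((coinvKer (diagAction α β)).mkQ ∘ₗ TensorProduct.mk k V W v ∘ₗ β.flip w ∘ₗ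
            HopfAlgebra.antipode k).lTensor B t) := by
      intro t
      induction t using TensorProduct.induction_on with
      | zero => simp
      | add x y hx hy => simp only [map_add, hx, hy]
      | tmul p q =>
        simp only [LinearMap.lTensor_tmul, LinearMap.rTensor_tmul, TensorProduct.lift.tmul,
          LinearMap.comp_apply, LinearMap.lsmul_apply, TensorProduct.mk_apply,
          LinearMap.flip_apply]
        rw [← mkQ_coinvKer, diagAction_apply]
        congr 1
        induction (Coalgebra.comul p : B ⊗[k] B) using TensorProduct.induction_on with
        | zero => simp
        | add x y hx hy =>
          simp only [map_add, TensorProduct.add_tmul, LinearMap.add_apply, hx, hy]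
        | tmul r s => simp [Φ, hβ.mul_apply]
    have h2 : ∀ t : B ⊗[k] B, Φ ((Coalgebra.comul (R := k) (A := B)).lTensor B t) =
        α (TensorProduct.rid k B ((Coalgebra.counit (R := k) (A := B)).lTensor B t)) v ⊗ₜ w := by
      intro t
      induction t using TensorProduct.induction_on with
      | zero => simp
      | add x y hx hy =>
        simp only [map_add, LinearMap.add_apply, TensorProduct.add_tmul, hx, hy]
      | tmul p q =>
        simp only [Φ, LinearMap.lTensor_tmul, TensorProduct.map_tmul, LinearMap.comp_apply,
          HopfAlgebra.mul_antipode_lTensor_comul_apply, Algebra.algebraMap_eq_smul_one,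
          map_smul, LinearMap.flip_apply, hβ.one_apply]
        simp [TensorProduct.smul_tmul]
    have := h1 (Coalgebra.comul b)
    rw [Coalgebra.coassoc_apply, h2, comul_counit_left] at this
    simpa using this

/-! ### The inverse antipode, and moving the action to the other factor. -/

section AntipodeInv

variable [BijectiveAntipode k B]

variable (k B) in
lemma antipode_antipodeInv (b : B) : HopfAlgebra.antipode k (antipodeInv k B b) = b :=
  LinearEquiv.apply_symm_apply (LinearEquiv.ofBijective (HopfAlgebra.antipode k (A := B)) _) b

variable (k B) in
lemma antipodeInv_antipode (b : B) : antipodeInv k B (HopfAlgebra.antipode k b) = b :=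
  LinearEquiv.symm_apply_apply (LinearEquiv.ofBijective (HopfAlgebra.antipode k (A := B)) _) b

variable (k) in
lemma antipodeInv_mul_antidistrib (a b : B) :
    antipodeInv k B (a * b) = antipodeInv k B b * antipodeInv k B a := by
  apply (BijectiveAntipode.bijective (k := k) (B := B)).1
  simp only [HopfAlgebra.antipode_mul_antidistrib, antipode_antipodeInv]

variable (k B) in
lemma antipodeInv_one : antipodeInv k B 1 = 1 := by
  apply (BijectiveAntipode.bijective (k := k) (B := B)).1
  rw [antipode_antipodeInv, HopfAlgebra.antipode_one]

variable (k B) in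
/-- `b₍₂₎ S⁻¹(b₍₁₎) = ε(b)`. -/
lemma mul_antipodeInv (b : B) :
    TensorProduct.lift ((LinearMap.mul k B).flip ∘ₗ antipodeInv k B) (Coalgebra.comul b) =
      Coalgebra.counit (R := k) b • (1 : B) := by
  apply (BijectiveAntipode.bijective (k := k) (B := B)).1
  rw [map_smul, HopfAlgebra.antipode_one, ← Algebra.algebraMap_eq_smul_one,
    ← HopfAlgebra.mul_antipode_lTensor_comul_apply]
  induction (Coalgebra.comul b : B ⊗[k] B) using TensorProduct.induction_on with
  | zero => simp
  | add x y hx hy => simp only [map_add, hx, hy]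
  | tmul p q => simp [HopfAlgebra.antipode_mul_antidistrib, antipode_antipodeInv]

/-- `k ⊗_B (V ⊗ W)` is obtained by identifying `v ⊗ b w` with `S⁻¹(b) v ⊗ w`. -/
lemma coinvKer_diagAction_comm {α : B →ₗ[k] V →ₗ[k] V} {β : B →ₗ[k] W →ₗ[k] W}
    (hα : IsAction α) :
    coinvKer (diagAction α β) =
      (balKer β α (antipodeInv k B)).comap (TensorProduct.comm k V W).toLinearMap := by
  apply le_antisymm
  · rw [coinvKer, Submodule.span_le]
    rintro _ ⟨⟨b, z⟩, rfl⟩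
    change (TensorProduct.comm k V W) _ ∈ balKer β α (antipodeInv k B)
    rw [← Submodule.Quotient.mk_eq_zero, ← Submodule.mkQ_apply, map_sub, map_sub, sub_eq_zero]
    induction z using TensorProduct.induction_on with
    | zero => simp
    | add x y hx hy => simp only at hx hy; simp only [map_add, smul_add, hx, hy]
    | tmul v w =>
      have h : ∀ t : B ⊗[k] B, (balKer β α (antipodeInv k B)).mkQ (TensorProduct.comm k V W
          (TensorProduct.homTensorHomMap (.id k) V W V W (TensorProduct.map α β t) (v ⊗ₜ w))) =
          (balKer β α (antipodeInv k B)).mkQ (w ⊗ₜ α (TensorProduct.lift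
            ((LinearMap.mul k B).flip.compl₂ (antipodeInv k B)) t) v) := by
        intro t
        induction t using TensorProduct.induction_on with
        | zero => simp
        | add x y hx hy =>
          simp only [map_add, LinearMap.add_apply, TensorProduct.tmul_add, hx, hy]
        | tmul p q =>
          simp only [TensorProduct.map_tmul, TensorProduct.homTensorHomMap_apply,
            TensorProduct.comm_tmul, mkQ_balKer]
          simp [hα.mul_apply]
      simp only [diagAction_apply]
      rw [h, antipodeInv_mul, map_smul, LinearMap.smul_apply, hα.one_apply]
      simp
  · have key : balKer β α (antipodeInv k B) ≤
        (coinvKer (diagAction α β)).comap (TensorProduct.comm k V W).symm.toLinearMap := by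
      rw [balKer, Submodule.span_le]
      rintro _ ⟨⟨b, w, v⟩, rfl⟩
      change (TensorProduct.comm k V W).symm _ ∈ coinvKer (diagAction α β)
      rw [← Submodule.Quotient.mk_eq_zero, ← Submodule.mkQ_apply, map_sub, map_sub, sub_eq_zero]
      simp only [TensorProduct.comm_symm_tmul]
      -- The mirror image of the previous argument, with `b₁ ⊗ b₂ ⊗ b₃ ↦ b₂ S⁻¹(b₁) v ⊗ b₃ w`: the
      -- first two legs collapse by `mul_antipodeInv`, the last two by coinvariance.
      let Φ : (B ⊗[k] B) ⊗[k] B →ₗ[k] V ⊗[k] W := TensorProduct.map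
        (α.flip v ∘ₗ TensorProduct.lift ((LinearMap.mul k B).flip ∘ₗ antipodeInv k B)) (β.flip w)
      have h1 : ∀ t : B ⊗[k] B, (coinvKer (diagAction α β)).mkQ
          (Φ ((TensorProduct.assoc k B B B).symm
            ((Coalgebra.comul (R := k) (A := B)).lTensor B t))) =
          TensorProduct.lift (LinearMap.lsmul k _ ∘ₗ Coalgebra.counit).flip
            (((coinvKer (diagAction α β)).mkQ ∘ₗ (TensorProduct.mk k V W).flip w ∘ₗ α.flip v ∘ₗ
              antipodeInv k B).rTensor B t) := by
        intro t
        induction t using TensorProduct.induction_on with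
        | zero => simp
        | add x y hx hy => simp only [map_add, hx, hy]
        | tmul p q =>
          simp only [LinearMap.lTensor_tmul, LinearMap.rTensor_tmul, TensorProduct.lift.tmul,
            LinearMap.comp_apply, LinearMap.lsmul_apply, TensorProduct.mk_apply,
            LinearMap.flip_apply]
          rw [← mkQ_coinvKer, diagAction_apply]
          congr 1
          induction (Coalgebra.comul q : B ⊗[k] B) using TensorProduct.induction_on with
          | zero => simp
          | add x y hx hy =>
            simp only [map_add, TensorProduct.tmul_add, LinearMap.add_apply, hx, hy]
          | tmul r s => simp [Φ, hα.mul_apply]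
      have h2 : ∀ t : B ⊗[k] B, Φ ((Coalgebra.comul (R := k) (A := B)).rTensor B t) =
          v ⊗ₜ β (TensorProduct.lid k B ((Coalgebra.counit (R := k) (A := B)).rTensor B t)) w := by
        intro t
        induction t using TensorProduct.induction_on with
        | zero => simp
        | add x y hx hy =>
          simp only [map_add, LinearMap.add_apply, TensorProduct.tmul_add, hx, hy]
        | tmul p q =>
          simp only [Φ, LinearMap.rTensor_tmul, TensorProduct.map_tmul, LinearMap.comp_apply,
            mul_antipodeInv, map_smul, LinearMap.flip_apply, hα.one_apply]
          simp [TensorProduct.smul_tmul]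
      have := h1 (Coalgebra.comul b)
      rw [Coalgebra.coassoc_symm_apply, h2, comul_counit_right] at this
      simpa using this
    intro z hz
    have := key hz
    simpa using this

end AntipodeInv

end Actions

/-! ### Exactness of coinvariants when one tensor factor is projective. -/

section Flatness

variable {k B : Type u} [Field k] [Ring B] [HopfAlgebra k B]

/-- The sequence `N → N' → N''` of maps becomes exact modulo the coinvariance relations of the
actions on `N'` and `N''`. -/
def CoinvExact {N N' N'' : Type u} [AddCommGroup N] [Module k N] [AddCommGroup N'] [Module k N']
    [AddCommGroup N''] [Module k N''] (β' : B →ₗ[k] N' →ₗ[k] N') (β'' : B →ₗ[k] N'' →ₗ[k] N'')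
    (f : N →ₗ[k] N') (g : N' →ₗ[k] N'') : Prop :=
  ∀ z, g z ∈ coinvKer β'' → ∃ y, z - f y ∈ coinvKer β'

/-- The functor `N ↦ k ⊗_B (W ⊗ N)` is exact. -/
def CoinvFlat {W : Type u} [AddCommGroup W] [Module k W] (α : B →ₗ[k] W →ₗ[k] W) : Prop :=
  ∀ ⦃N N' N'' : ModuleCat.{u} k⦄ ⦃β : B →ₗ[k] N →ₗ[k] N⦄ ⦃β' : B →ₗ[k] N' →ₗ[k] N'⦄
    ⦃β'' : B →ₗ[k] N'' →ₗ[k] N''⦄ ⦃f : N →ₗ[k] N'⦄ ⦃g : N' →ₗ[k] N''⦄,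
    IsAction β → IsAction β' → IsAction β'' → IsEquivariant β β' f → IsEquivariant β' β'' g →
    Function.Exact f g →
    CoinvExact (diagAction α β') (diagAction α β'') (f.lTensor W) (g.lTensor W)

variable {P : Type u} [AddCommGroup P] [Module k P] [Module B P] [IsScalarTower k B P]
variable {N N' N'' : Type u} [AddCommGroup N] [Module k N] [AddCommGroup N'] [Module k N']
    [AddCommGroup N''] [Module k N'']

/-- The coordinates `p ⊗ n ↦ (σ(sᵢ(p)) n)ᵢ` attached to a map `s : P → B^{(P)}`. -/
def balCoord (s : P →ₗ[B] (P →₀ B)) (σ : B →ₗ[k] B) (β : B →ₗ[k] N →ₗ[k] N) (i : P) :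
    P ⊗[k] N →ₗ[k] N :=
  TensorProduct.lift (β ∘ₗ σ ∘ₗ Finsupp.lapply i ∘ₗ s.restrictScalars k)

@[simp] lemma balCoord_tmul (s : P →ₗ[B] (P →₀ B)) (σ : B →ₗ[k] B) (β : B →ₗ[k] N →ₗ[k] N) (i : P)
    (p : P) (n : N) : balCoord s σ β i (p ⊗ₜ n) = β (σ (s p i)) n := rfl

/-- The coordinates descend to the balanced tensor product because `s` is `B`-linear and `σ`
reverses products: `σ(b sᵢ(p)) n = σ(sᵢ(p)) σ(b) n`. -/
lemma balCoord_balKer (s : P →ₗ[B] (P →₀ B)) {σ : B →ₗ[k] B} (hσ : ∀ a b, σ (a * b) = σ b * σ a)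
    {β : B →ₗ[k] N →ₗ[k] N} (hβ : IsAction β) (i : P) {z : P ⊗[k] N}
    (hz : z ∈ balKer (actionMap k B P) β σ) : balCoord s σ β i z = 0 := by
  have : balKer (actionMap k B P) β σ ≤ LinearMap.ker (balCoord s σ β i) := by
    rw [balKer, Submodule.span_le]
    rintro _ ⟨⟨b, p, n⟩, rfl⟩
    simp [hσ, hβ.mul_apply]
  exact this hz

lemma balCoord_natural (s : P →ₗ[B] (P →₀ B)) (σ : B →ₗ[k] B) {β : B →ₗ[k] N →ₗ[k] N}
    {β' : B →ₗ[k] N' →ₗ[k] N'} {f : N →ₗ[k] N'} (hf : IsEquivariant β β' f) (i : P)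
    (z : P ⊗[k] N) : balCoord s σ β' i (f.lTensor P z) = f (balCoord s σ β i z) := by
  induction z using TensorProduct.induction_on with
  | zero => simp
  | add x y hx hy => simp only [map_add, hx, hy]
  | tmul p n => simp [hf (σ (s p i)) n]

/-- Dual basis expansion: `p = ∑ sᵢ(p) i`, and balancing moves each `sᵢ(p)` across the tensor sign.
Allowing every larger index set lets the sets for two summands be merged. -/
lemma exists_balCoord_support (s : P →ₗ[B] (P →₀ B)) (σ : B →ₗ[k] B) (β : B →ₗ[k] N →ₗ[k] N)
    (hs : ∀ p, Finsupp.linearCombination B id (s p) = p) (z : P ⊗[k] N) :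
    ∃ t : Finset P, ∀ t', t ⊆ t' →
      z - ∑ i ∈ t', i ⊗ₜ[k] balCoord s σ β i z ∈ balKer (actionMap k B P) β σ := by
  classical
  induction z using TensorProduct.induction_on with
  | zero => exact ⟨∅, fun t' _ => by simp⟩
  | add x y hx hy =>
    obtain ⟨t, ht⟩ := hx
    obtain ⟨u, hu⟩ := hy
    refine ⟨t ∪ u, fun t' h => ?_⟩
    have := Submodule.add_mem _ (ht t' (Finset.union_subset_left h))
      (hu t' (Finset.union_subset_right h))
    simp only [map_add, TensorProduct.tmul_add, Finset.sum_add_distrib]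
    convert this using 1
    abel
  | tmul p n =>
    refine ⟨(s p).support, fun t' h => ?_⟩
    have hp : p ⊗ₜ[k] n = ∑ i ∈ t', (s p i • i) ⊗ₜ[k] n := by
      rw [← TensorProduct.sum_tmul]
      congr 1
      conv_lhs => rw [← hs p]
      rw [Finsupp.linearCombination_apply, Finsupp.sum_of_support_subset _ h _ (by simp)]
      rfl
    rw [hp, ← Finset.sum_sub_distrib]
    refine Submodule.sum_mem _ fun i _ => ?_
    have h0 : ∑ i ∈ t', (s p i • i) ⊗ₜ[k] n = p ⊗ₜ[k] n := hp.symm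
    rw [h0, balCoord_tmul]
    exact sub_mem_balKer (actionMap k B P) β σ (s p i) i n

/-- A projective module has dual basis coordinates, so exactness can be checked coordinate by
coordinate in `N'`. The map `σ` is kept general since both `S` and `S⁻¹` are needed. -/
lemma balKer_exact [Module.Projective B P] {σ : B →ₗ[k] B}
    (hσ : ∀ a b, σ (a * b) = σ b * σ a) (β' : B →ₗ[k] N' →ₗ[k] N')
    {β'' : B →ₗ[k] N'' →ₗ[k] N''}
    (hβ'' : IsAction β'') {f : N →ₗ[k] N'} {g : N' →ₗ[k] N''}
    (hg : IsEquivariant β' β'' g) (hfg : Function.Exact f g)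
    (z : P ⊗[k] N') (hz : g.lTensor P z ∈ balKer (actionMap k B P) β'' σ) :
    ∃ y, z - f.lTensor P y ∈ balKer (actionMap k B P) β' σ := by
  obtain ⟨s, hs⟩ := (Module.projective_def (R := B) (P := P)).1 inferInstance
  obtain ⟨t, ht⟩ := exists_balCoord_support s σ β' hs z
  -- Each coordinate of `z` is killed by `g` on the nose, not merely up to relations, so exactness
  -- at `N'` applies to it.
  have h : ∀ i, ∃ n, f n = balCoord s σ β' i z := fun i => by
    refine (hfg _).1 ?_
    rw [← balCoord_natural s σ hg]
    exact balCoord_balKer s hσ hβ'' i hz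
  choose n hn using h
  refine ⟨∑ i ∈ t, i ⊗ₜ[k] n i, ?_⟩
  simpa [hn] using ht t subset_rfl

lemma coinvFlat_of_projective [Module.Projective B P] : CoinvFlat (actionMap k B P) := by
  intro N N' N'' β β' β'' f g hβ hβ' hβ'' hf hg hfg z hz
  rw [coinvKer_diagAction hβ''] at hz
  rw [coinvKer_diagAction hβ']
  exact balKer_exact HopfAlgebra.antipode_mul_antidistrib β' hβ'' hg hfg z hz

lemma mem_coinvKer_equiv {V W : Type u} [AddCommGroup V] [Module k V] [AddCommGroup W]
    [Module k W] {α : B →ₗ[k] V →ₗ[k] V} {β : B →ₗ[k] W →ₗ[k] W} {e : V ≃ₗ[k] W}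
    (h : IsEquivariant α β e.toLinearMap) (v : V) : e v ∈ coinvKer β ↔ v ∈ coinvKer α := by
  refine ⟨fun hv => ?_, fun hv => coinvKer_le_of_equivariant h hv⟩
  have := coinvKer_le_of_equivariant h.symm hv
  simpa using this

/-- Reassociate to `W ⊗ (V ⊗ N)`; tensoring with `V` over the field `k` is exact and preserves
actions, so the flatness of `W` applies. -/
lemma CoinvFlat.diagAction {W V : Type u} [AddCommGroup W] [Module k W] [AddCommGroup V]
    [Module k V] {α : B →ₗ[k] W →ₗ[k] W} (hα : CoinvFlat α) {γ : B →ₗ[k] V →ₗ[k] V}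
    (hγ : IsAction γ) : CoinvFlat (diagAction α γ) := by
  intro N N' N'' β β' β'' f g hβ hβ' hβ'' hf hg hfg z hz
  have hnat : ∀ {N N' : Type u} [AddCommGroup N] [Module k N] [AddCommGroup N'] [Module k N']
      (f : N →ₗ[k] N') (z : (W ⊗[k] V) ⊗[k] N),
      TensorProduct.assoc k W V N' (f.lTensor (W ⊗[k] V) z) =
        (f.lTensor V).lTensor W (TensorProduct.assoc k W V N z) := fun f z => by
    rw [LinearMap.lTensor_tensor]; simp
  rw [← mem_coinvKer_equiv (IsEquivariant.assoc α γ β''), hnat] at hz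
  obtain ⟨y, hy⟩ := hα (N := ModuleCat.of k (V ⊗[k] N)) (N' := ModuleCat.of k (V ⊗[k] N'))
    (N'' := ModuleCat.of k (V ⊗[k] N'')) (hγ.diag hβ) (hγ.diag hβ') (hγ.diag hβ'')
    ((IsEquivariant.id γ).map hf) ((IsEquivariant.id γ).map hg)
    (Module.Flat.lTensor_exact V hfg) _ hz
  refine ⟨(TensorProduct.assoc k W V N).symm y, ?_⟩
  rw [← mem_coinvKer_equiv (IsEquivariant.assoc α γ β'), map_sub, hnat]
  rwa [LinearEquiv.apply_symm_apply]

lemma mem_coinvKer_comm {X V : Type u} [AddCommGroup X] [Module k X] [AddCommGroup V] [Module k V]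
    (β : B →ₗ[k] X →ₗ[k] X) (α : B →ₗ[k] V →ₗ[k] V) (z : X ⊗[k] V) :
    TensorProduct.comm k X V z ∈ coinvKer (HopfHochschild.diagAction α β) ↔
      z ∈ coinvKer (twistedAction β α) := by
  refine mem_coinvKer_equiv (fun b z => ?_) z
  simp [twistedAction, LinearEquiv.conj_apply]

/-- Here the projective factor receives the last leg of the comultiplication, so the balancing is by
`S⁻¹`. This is the case of a projective coefficient module `X`. -/
lemma coinvExact_twistedAction [BijectiveAntipode k B] [Module.Projective B P]
    {β' : B →ₗ[k] N' →ₗ[k] N'} {β'' : B →ₗ[k] N'' →ₗ[k] N''}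
    (hβ' : IsAction β') (hβ'' : IsAction β'') {f : N →ₗ[k] N'} {g : N' →ₗ[k] N''}
    (hg : IsEquivariant β' β'' g) (hfg : Function.Exact f g) :
    CoinvExact (twistedAction (actionMap k B P) β') (twistedAction (actionMap k B P) β'')
      (f.lTensor P) (g.lTensor P) := by
  intro z hz
  rw [← mem_coinvKer_comm, coinvKer_diagAction_comm hβ''] at hz
  obtain ⟨y, hy⟩ := balKer_exact (σ := antipodeInv k B) (antipodeInv_mul_antidistrib k) β' hβ'' hg
    hfg z (by simpa using hz)
  refine ⟨y, ?_⟩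
  rw [← mem_coinvKer_comm, coinvKer_diagAction_comm hβ']
  simpa using hy

end Flatness

/-! ### The rotation isomorphism and the anti-Yetter-Drinfeld condition. -/

section Rotation

variable {k B : Type u} [Field k] [Ring B] [HopfAlgebra k B]
variable {X Q U : Type u} [AddCommGroup X] [Module k X]
  [AddCommGroup Q] [Module k Q] [Module B Q] [IsScalarTower k B Q]
  [AddCommGroup U] [Module k U]

lemma coact_counit [LeftComodule k B X] {V : Type u} [AddCommGroup V] [Module k V]
    (f : X →ₗ[k] V) (x : X) : TensorProduct.lift (LinearMap.lsmul k V ∘ₗ Coalgebra.counit)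
      (f.lTensor B (LeftComodule.coact x)) = f x := by
  have : ∀ z : B ⊗[k] X, TensorProduct.lift (LinearMap.lsmul k V ∘ₗ Coalgebra.counit)
      (f.lTensor B z) = f (TensorProduct.lid k X
        ((Coalgebra.counit (R := k) (A := B)).rTensor X z)) := by
    intro z
    induction z using TensorProduct.induction_on with
    | zero => simp
    | add x y hx hy => simp only [map_add, hx, hy]
    | tmul p q => simp
  rw [this]
  exact congrArg f (LinearMap.congr_fun (LeftComodule.counit_coact (k := k) (B := B) (X := X)) x)

variable (k B X Q) in
/-- The linear map `(b ⊗ x) ⊗ m ↦ b m ⊗ x`. -/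
def pushLeft : (B ⊗[k] X) ⊗[k] Q →ₗ[k] Q ⊗[k] X :=
  (TensorProduct.lift (actionMap k B Q)).rTensor X ∘ₗ
    (TensorProduct.rightComm k B X Q).toLinearMap

@[simp] lemma pushLeft_tmul (b : B) (x : X) (m : Q) :
    pushLeft k B X Q ((b ⊗ₜ x) ⊗ₜ m) = (b • m) ⊗ₜ x := by
  simp [pushLeft]

variable [BijectiveAntipode k B]

variable (k B X Q) in
/-- The linear map `(b ⊗ x) ⊗ m ↦ x ⊗ S⁻¹(b) m`. -/
def pushRight : (B ⊗[k] X) ⊗[k] Q →ₗ[k] X ⊗[k] Q :=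
  (TensorProduct.comm k Q X).toLinearMap ∘ₗ pushLeft k B X Q ∘ₗ
    ((antipodeInv k B).rTensor X).rTensor Q

@[simp] lemma pushRight_tmul (b : B) (x : X) (m : Q) :
    pushRight k B X Q ((b ⊗ₜ x) ⊗ₜ m) = x ⊗ₜ (antipodeInv k B b • m) := by
  simp [pushRight]

omit [BijectiveAntipode k B] in
lemma coact_coassoc_apply [LeftComodule k B X] (x : X) : TensorProduct.assoc k B B X
      ((Coalgebra.comul (R := k) (A := B)).rTensor X (LeftComodule.coact x)) =
    (LeftComodule.coact (k := k) (B := B)).lTensor B (LeftComodule.coact x) :=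
  LinearMap.congr_fun (LeftComodule.coassoc (k := k) (B := B) (X := X)) x

/-- By coassociativity the composite acts on `m` by `x₍₋₁₎ S⁻¹(x₍₋₂₎)`, which is the counit by
`mul_antipodeInv`. In the other order the identity needed is `antipodeInv_mul`. -/
lemma pushLeft_pushRight [LeftComodule k B X] (x : X) (m : Q) :
    pushLeft k B X Q ((LeftComodule.coact (k := k) (B := B)).rTensor Q
      (pushRight k B X Q (LeftComodule.coact x ⊗ₜ m))) = m ⊗ₜ x := by
  let H : B ⊗[k] (B ⊗[k] X) →ₗ[k] Q ⊗[k] X := ((actionMap k B Q).flip m ∘ₗ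
    TensorProduct.lift ((LinearMap.mul k B).flip ∘ₗ antipodeInv k B)).rTensor X ∘ₗ
      (TensorProduct.assoc k B B X).symm.toLinearMap
  have h1 : ∀ z : B ⊗[k] X, pushLeft k B X Q ((LeftComodule.coact (k := k) (B := B)).rTensor Q
      (pushRight k B X Q (z ⊗ₜ m))) = H ((LeftComodule.coact (k := k) (B := B)).lTensor B z) := by
    intro z
    induction z using TensorProduct.induction_on with
    | zero => simp
    | add x y hx hy => simp only [map_add, TensorProduct.add_tmul, hx, hy]
    | tmul b x =>
      simp only [pushRight_tmul, LinearMap.rTensor_tmul, LinearMap.lTensor_tmul]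
      induction (LeftComodule.coact x : B ⊗[k] X) using TensorProduct.induction_on with
      | zero => simp
      | add x y hx hy => simp only [map_add, TensorProduct.add_tmul, TensorProduct.tmul_add, hx, hy]
      | tmul c x => simp [H, mul_smul]
  have h2 : ∀ z : B ⊗[k] X,
      H (TensorProduct.assoc k B B X ((Coalgebra.comul (R := k) (A := B)).rTensor X z)) =
      TensorProduct.lift (LinearMap.lsmul k (Q ⊗[k] X) ∘ₗ Coalgebra.counit)
        ((TensorProduct.mk k Q X m).lTensor B z) := by
    intro z
    induction z using TensorProduct.induction_on with
    | zero => simp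
    | add x y hx hy => simp only [map_add, hx, hy]
    | tmul b x => simp [H, mul_antipodeInv, TensorProduct.smul_tmul']
  rw [h1, ← coact_coassoc_apply, h2, coact_counit]
  rfl

lemma pushRight_pushLeft [LeftComodule k B X] (x : X) (m : Q) :
    pushRight k B X Q ((TensorProduct.comm k Q (B ⊗[k] X)) ((LeftComodule.coact
      (k := k) (B := B)).lTensor Q (pushLeft k B X Q (LeftComodule.coact x ⊗ₜ m)))) = x ⊗ₜ m := by
  let H : B ⊗[k] (B ⊗[k] X) →ₗ[k] X ⊗[k] Q := (TensorProduct.comm k Q X).toLinearMap ∘ₗ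
    ((actionMap k B Q).flip m ∘ₗ TensorProduct.lift ((LinearMap.mul k B).flip.compl₂
      (antipodeInv k B))).rTensor X ∘ₗ (TensorProduct.assoc k B B X).symm.toLinearMap
  have h1 : ∀ z : B ⊗[k] X, pushRight k B X Q ((TensorProduct.comm k Q (B ⊗[k] X))
      ((LeftComodule.coact (k := k) (B := B)).lTensor Q (pushLeft k B X Q (z ⊗ₜ m)))) =
      H ((LeftComodule.coact (k := k) (B := B)).lTensor B z) := by
    intro z
    induction z using TensorProduct.induction_on with
    | zero => simp
    | add x y hx hy => simp only [map_add, TensorProduct.add_tmul, hx, hy]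
    | tmul b x =>
      simp only [pushLeft_tmul, LinearMap.lTensor_tmul]
      induction (LeftComodule.coact x : B ⊗[k] X) using TensorProduct.induction_on with
      | zero => simp
      | add x y hx hy => simp only [map_add, TensorProduct.tmul_add, hx, hy]
      | tmul c x => simp [H, mul_smul]
  have h2 : ∀ z : B ⊗[k] X,
      H (TensorProduct.assoc k B B X ((Coalgebra.comul (R := k) (A := B)).rTensor X z)) =
      TensorProduct.lift (LinearMap.lsmul k (X ⊗[k] Q) ∘ₗ Coalgebra.counit)
        (((TensorProduct.mk k X Q).flip m).lTensor B z) := by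
    intro z
    induction z using TensorProduct.induction_on with
    | zero => simp
    | add x y hx hy => simp only [map_add, hx, hy]
    | tmul b x => simp [H, antipodeInv_mul]
  rw [h1, ← coact_coassoc_apply, h2, coact_counit]
  rfl

variable (k B X Q) in
/-- The isomorphism `x ⊗ m ↦ x₍₋₁₎ m ⊗ x₍₀₎`. -/
def coactEquiv [LeftComodule k B X] : X ⊗[k] Q ≃ₗ[k] Q ⊗[k] X :=
  LinearEquiv.ofLinearMap
    (pushLeft k B X Q ∘ₗ (LeftComodule.coact (k := k) (B := B)).rTensor Q)
    (pushRight k B X Q ∘ₗ (TensorProduct.comm k Q (B ⊗[k] X)).toLinearMap ∘ₗ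
      (LeftComodule.coact (k := k) (B := B)).lTensor Q)
    (TensorProduct.ext' fun m x => pushLeft_pushRight x m)
    (TensorProduct.ext' fun x m => pushRight_pushLeft x m)

lemma coactEquiv_tmul [LeftComodule k B X] (x : X) (m : Q) :
    coactEquiv k B X Q (x ⊗ₜ m) = pushLeft k B X Q (LeftComodule.coact x ⊗ₜ m) := rfl

variable (k B Q) in
/-- The action of `B` on `Q` twisted by `S⁻²`. -/
def twistedActionMap : B →ₗ[k] Q →ₗ[k] Q :=
  actionMap k B Q ∘ₗ antipodeInv k B ∘ₗ antipodeInv k B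

variable (k B Q) in
lemma isAction_twistedActionMap : IsAction (twistedActionMap k B Q) where
  one := by simp [twistedActionMap, antipodeInv_one, (isAction_actionMap Q).one]
  mul a b := by
    simp [twistedActionMap, antipodeInv_mul_antidistrib, (isAction_actionMap Q).mul]

/-- The anti-Yetter-Drinfeld condition sends `b₍₁₎ x ⊗ S⁻²(b₍₂₎) m` to `b₍₁₎ x₍₋₁₎ S⁻¹(b₍₃₎)
S⁻²(b₍₄₎) m ⊗ b₍₂₎ x₍₀₎`. Here `S⁻¹(b₍₃₎) S⁻²(b₍₄₎) = S⁻¹(S⁻¹(b₍₄₎) b₍₃₎)` collapses to the counit,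
which is why the twist is by `S⁻²`. -/
lemma coactEquiv_equivariant [Module B X] [IsScalarTower k B X] [AYDModule k B X] :
    IsEquivariant (diagAction (actionMap k B X) (twistedActionMap k B Q))
      (diagAction (actionMap k B Q) (actionMap k B X)) (coactEquiv k B X Q).toLinearMap := by
  intro b z
  induction z using TensorProduct.induction_on with
  | zero => simp
  | add x y hx hy => simp only [map_add, hx, hy]
  | tmul x m =>
    -- `T` is the action of `S⁻¹(S⁻¹(b₄) b₃)`, with both inverse antipodes under one outer `S⁻¹` so
    -- that `antipodeInv_mul` applies to the inner product.
    let T : B ⊗[k] B →ₗ[k] Q →ₗ[k] Q :=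
      actionMap k B Q ∘ₗ antipodeInv k B ∘ₗ TensorProduct.lift
        ((LinearMap.mul k B).flip.compl₂ (antipodeInv k B))
    let Ψ : B → X → (B ⊗[k] (B ⊗[k] (B ⊗[k] B)) →ₗ[k] Q ⊗[k] X) := fun u y =>
      (TensorProduct.lift (actionMap k B Q)).rTensor X ∘ₗ
      (TensorProduct.assoc k B Q X).symm.toLinearMap ∘ₗ
      TensorProduct.map (LinearMap.mulRight k u) ((TensorProduct.comm k X Q).toLinearMap ∘ₗ
        TensorProduct.map ((actionMap k B X).flip y) (T.flip m))
    have hΨ : ∀ (u : B) (y : X) (b₁ b₂ b₃ b₄ : B), Ψ u y (b₁ ⊗ₜ (b₂ ⊗ₜ (b₃ ⊗ₜ b₄))) =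
        ((b₁ * u) • antipodeInv k B (antipodeInv k B b₄ * b₃) • m) ⊗ₜ (b₂ • y) := by
      intros; simp [Ψ, T]
    let E : B ⊗[k] B → B ⊗[k] X → Q ⊗[k] X := fun t r =>
      pushLeft k B X Q (TensorProduct.homTensorHomMap (.id k) (B ⊗[k] X) Q (B ⊗[k] X) Q
        (TensorProduct.map (aydTwist k B X ∘ₗ comul₃ k B) (twistedActionMap k B Q) t) (r ⊗ₜ m))
    have h1 : ∀ t : B ⊗[k] B, coactEquiv k B X Q (TensorProduct.homTensorHomMap (.id k) X Q X Q
        (TensorProduct.map (actionMap k B X) (twistedActionMap k B Q) t) (x ⊗ₜ m)) =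
        E t (LeftComodule.coact x) := by
      intro t
      induction t using TensorProduct.induction_on with
      | zero => simp [E]
      | add x y hx hy => simp only [E, map_add, LinearMap.add_apply] at hx hy ⊢; rw [hx, hy]
      | tmul p q =>
        simp only [E, TensorProduct.map_tmul, TensorProduct.homTensorHomMap_apply,
          coactEquiv_tmul, actionMap_apply, AYDModule.coact_smul]
        rfl
    have h2 : ∀ (u : B) (y : X) (t : B ⊗[k] B), E t (u ⊗ₜ y) =
        Ψ u y (nest k B ((comul₃ k B).rTensor B t)) := by
      intro u y t
      induction t using TensorProduct.induction_on with
      | zero => simp [E]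
      | add x y hx hy => simp only [E, map_add, LinearMap.add_apply] at hx hy ⊢; rw [hx, hy]
      | tmul p q =>
        simp only [E, TensorProduct.map_tmul, TensorProduct.homTensorHomMap_apply,
          LinearMap.comp_apply, LinearMap.rTensor_tmul]
        generalize comul₃ k B p = c
        induction c using TensorProduct.induction_on with
        | zero => simp
        | add x y hx hy =>
          simp only [map_add, LinearMap.add_apply, TensorProduct.add_tmul, hx, hy]
        | tmul b₁ c =>
          induction c using TensorProduct.induction_on with
          | zero => simp
          | add x y hx hy =>
            simp only [map_add, LinearMap.add_apply, TensorProduct.add_tmul, TensorProduct.tmul_add,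
              hx, hy]
          | tmul b₂ b₃ =>
            simp [nest, hΨ, twistedActionMap, antipodeInv_mul_antidistrib, mul_smul]
    -- Coassociativity regroups the four legs so that the last two are the comultiplication of a
    -- single element, on which `T` is the counit.
    have h3 : nest k B ((comul₃ k B).rTensor B (Coalgebra.comul b)) =
        ((Coalgebra.comul (R := k) (A := B)).lTensor B).lTensor B (comul₃ k B b) := by
      have : nest k B ∘ₗ (comul₃ k B).rTensor B ∘ₗ Coalgebra.comul =
          ((Coalgebra.comul (R := k) (A := B)).lTensor B).lTensor B ∘ₗ comul₃ k B := by
        unfold nest comul₃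
        simp only [coassoc_simps]
      exact LinearMap.congr_fun this b
    have h4 : ∀ (u : B) (y : X) (t : B ⊗[k] (B ⊗[k] B)),
        Ψ u y (((Coalgebra.comul (R := k) (A := B)).lTensor B).lTensor B t) =
        TensorProduct.homTensorHomMap (.id k) Q X Q X (TensorProduct.map (actionMap k B Q)
          (actionMap k B X) (((TensorProduct.rid k B).toLinearMap ∘ₗ
            (Coalgebra.counit (R := k) (A := B)).lTensor B).lTensor B t)) ((u • m) ⊗ₜ y) := by
      intro u y t
      induction t using TensorProduct.induction_on with
      | zero => simp
      | add x y hx hy => simp only [map_add, LinearMap.add_apply, hx, hy]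
      | tmul b₁ t =>
        induction t using TensorProduct.induction_on with
        | zero => simp
        | add x y hx hy =>
          simp only [map_add, LinearMap.add_apply, TensorProduct.tmul_add, hx, hy]
        | tmul b₂ b₃ =>
          simp [Ψ, T, antipodeInv_mul, antipodeInv_one, mul_smul, TensorProduct.smul_tmul']
    have h5 : ((TensorProduct.rid k B).toLinearMap ∘ₗ
        (Coalgebra.counit (R := k) (A := B)).lTensor B).lTensor B (comul₃ k B b) =
        Coalgebra.comul b := by
      have : ((TensorProduct.rid k B).toLinearMap ∘ₗ
          (Coalgebra.counit (R := k) (A := B)).lTensor B) ∘ₗ Coalgebra.comul =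
          LinearMap.id := by
        ext b; simp
      rw [comul₃, LinearMap.comp_apply, ← LinearMap.comp_apply (LinearMap.lTensor _ _),
        ← LinearMap.lTensor_comp, this, LinearMap.lTensor_id, LinearMap.id_apply]
    have h6 : ∀ r : B ⊗[k] X, E (Coalgebra.comul b) r =
        diagAction (actionMap k B Q) (actionMap k B X) b (pushLeft k B X Q (r ⊗ₜ m)) := by
      intro r
      induction r using TensorProduct.induction_on with
      | zero => simp [E]
      | add x y hx hy =>
        simp only [E, map_add, TensorProduct.add_tmul] at hx hy ⊢; rw [hx, hy]
      | tmul u y => rw [h2, h3, h4, h5, pushLeft_tmul, diagAction_apply]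
    rw [diagAction_apply, LinearEquiv.coe_coe, h1, h6]
    rfl

variable (k B X Q U) in
/-- The isomorphism `x ⊗ (m ⊗ u) ↦ x₍₀₎ ⊗ (u ⊗ x₍₋₁₎ m)`. -/
def rotateEquiv [LeftComodule k B X] : X ⊗[k] (Q ⊗[k] U) ≃ₗ[k] X ⊗[k] (U ⊗[k] Q) :=
  TensorProduct.comm k X (Q ⊗[k] U) ≪≫ₗ TensorProduct.assoc k Q U X ≪≫ₗ
    TensorProduct.comm k Q (U ⊗[k] X) ≪≫ₗ TensorProduct.assoc k U X Q ≪≫ₗ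
    TensorProduct.congr (LinearEquiv.refl k U) (coactEquiv k B X Q) ≪≫ₗ
    (TensorProduct.assoc k U Q X).symm ≪≫ₗ (TensorProduct.comm k X (U ⊗[k] Q)).symm

lemma rotateEquiv_tmul [LeftComodule k B X] (x : X) (m : Q) (u : U) :
    rotateEquiv k B X Q U (x ⊗ₜ (m ⊗ₜ u)) =
      cyclicMove k B Q X U (LeftComodule.coact x ⊗ₜ (m ⊗ₜ u)) := by
  simp only [rotateEquiv, LinearEquiv.trans_apply, TensorProduct.comm_tmul,
    TensorProduct.assoc_tmul, TensorProduct.congr_tmul, coactEquiv_tmul, LinearEquiv.refl_apply]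
  induction (LeftComodule.coact x : B ⊗[k] X) using TensorProduct.induction_on with
  | zero => simp
  | add x y hx hy => simp only [map_add, TensorProduct.add_tmul, TensorProduct.tmul_add, hx, hy]
  | tmul b x => simp

/-- Moving `Q` from the first tensor factor to the last changes its action by `S⁻²`: the relations
are balanced by `S⁻¹` on one side and by `S` on the other. `coactEquiv` then passes `Q` over `X` and
removes this twist. -/
lemma rotateEquiv_mem [Module B X] [IsScalarTower k B X] [AYDModule k B X]
    (α : B →ₗ[k] U →ₗ[k] U) (z : X ⊗[k] (Q ⊗[k] U)) :
    rotateEquiv k B X Q U z ∈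
        coinvKer (twistedAction (actionMap k B X) (diagAction α (actionMap k B Q))) ↔
      z ∈ coinvKer (twistedAction (actionMap k B X) (diagAction (actionMap k B Q) α)) := by
  -- The two sets of relations agree because `S⁻² ∘ S = S⁻¹`.
  have hker : balKer (diagAction α (actionMap k B X)) (actionMap k B Q) (antipodeInv k B) =
      balKer (diagAction α (actionMap k B X)) (twistedActionMap k B Q) (HopfAlgebra.antipode k) := by
    simp [balKer, twistedActionMap, antipodeInv_antipode]
  have e : IsEquivariant (diagAction α (diagAction (actionMap k B X) (twistedActionMap k B Q)))
      (diagAction α (diagAction (actionMap k B Q) (actionMap k B X)))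
      (TensorProduct.congr (LinearEquiv.refl k U) (coactEquiv k B X Q)).toLinearMap :=
    (IsEquivariant.id α).map coactEquiv_equivariant
  rw [← mem_coinvKer_comm, ← mem_coinvKer_comm,
    ← mem_coinvKer_equiv (IsEquivariant.assoc (actionMap k B Q) α (actionMap k B X)),
    coinvKer_diagAction_comm (isAction_actionMap Q), Submodule.mem_comap, hker,
    ← coinvKer_diagAction (isAction_twistedActionMap k B Q),
    ← mem_coinvKer_equiv (IsEquivariant.assoc α (actionMap k B X) (twistedActionMap k B Q)),
    ← mem_coinvKer_equiv e, ← mem_coinvKer_equiv (IsEquivariant.assoc _ _ _).symm]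
  simp [rotateEquiv]

end Rotation

/-! ### Coefficients of finite projective dimension: dimension shifting. -/

section FiniteProjectiveDimension

variable {k B : Type u} [Field k] [Ring B] [HopfAlgebra k B]

lemma CoinvFlat.twistedAction {U N N' N'' : Type u} [AddCommGroup U] [Module k U]
    [AddCommGroup N] [Module k N] [AddCommGroup N'] [Module k N'] [AddCommGroup N''] [Module k N'']
    {α : B →ₗ[k] U →ₗ[k] U} (hα : CoinvFlat α)
    {β : B →ₗ[k] N →ₗ[k] N} {β' : B →ₗ[k] N' →ₗ[k] N'} {β'' : B →ₗ[k] N'' →ₗ[k] N''}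
    (hβ : IsAction β) (hβ' : IsAction β') (hβ'' : IsAction β'') {f : N →ₗ[k] N'} {g : N' →ₗ[k] N''}
    (hf : IsEquivariant β β' f) (hg : IsEquivariant β' β'' g) (hfg : Function.Exact f g) :
    CoinvExact (twistedAction β' α) (twistedAction β'' α) (f.rTensor U) (g.rTensor U) := by
  intro z hz
  rw [← mem_coinvKer_comm, ← LinearMap.lTensor_comm] at hz
  obtain ⟨y, hy⟩ := hα (N := ModuleCat.of k N) (N' := ModuleCat.of k N') (N'' := ModuleCat.of k N'')
    hβ hβ' hβ'' hf hg hfg _ hz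
  refine ⟨(TensorProduct.comm k N U).symm y, ?_⟩
  rw [← mem_coinvKer_comm, map_sub, ← LinearMap.lTensor_comm, LinearEquiv.apply_symm_apply]
  exact hy

lemma equivariant_rTensor {X Y V : Type u} [AddCommGroup X] [Module k X] [AddCommGroup Y]
    [Module k Y] [AddCommGroup V] [Module k V] {β : B →ₗ[k] X →ₗ[k] X} {β' : B →ₗ[k] Y →ₗ[k] Y}
    {f : X →ₗ[k] Y} (h : IsEquivariant β β' f) (α : B →ₗ[k] V →ₗ[k] V) :
    IsEquivariant (twistedAction β α) (twistedAction β' α) (f.rTensor V) := by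
  intro b z
  have key := (IsEquivariant.id α).map h b (TensorProduct.comm k X V z)
  apply (TensorProduct.comm k Y V).injective
  simp only [twistedAction, LinearMap.comp_apply, LinearEquiv.coe_coe, LinearEquiv.conj_apply,
    TensorProduct.comm_symm, TensorProduct.comm_comm, ← LinearMap.lTensor_comm]
  exact key

lemma lTensor_rTensor_apply {X Y V W : Type u} [AddCommGroup X] [Module k X] [AddCommGroup Y]
    [Module k Y] [AddCommGroup V] [Module k V] [AddCommGroup W] [Module k W] (f : X →ₗ[k] Y)
    (d : V →ₗ[k] W) (y : X ⊗[k] V) :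
    d.lTensor Y (f.rTensor V y) = f.rTensor W (d.lTensor X y) := by
  rw [← LinearMap.comp_apply, ← LinearMap.comp_apply, LinearMap.lTensor_comp_rTensor,
    LinearMap.rTensor_comp_lTensor]

/-- The diagram chase behind dimension shifting for `0 → X' → F → X → 0`: exactness with
coefficients `F` at `U₁` and `X'` at `U₂` gives exactness with coefficients `X` at `U₁`. The
hypothesis `hinj` says that `i` stays injective on coinvariants, written as exactness after a zero
map. -/
lemma coinvExact_of_resolution_step {X' F X U₀ U₁ U₂ U₃ : Type u}
    [AddCommGroup X'] [Module k X'] [AddCommGroup F] [Module k F] [AddCommGroup X] [Module k X]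
    [AddCommGroup U₀] [Module k U₀] [AddCommGroup U₁] [Module k U₁] [AddCommGroup U₂] [Module k U₂]
    [AddCommGroup U₃] [Module k U₃]
    {β' : B →ₗ[k] X' →ₗ[k] X'} {φ : B →ₗ[k] F →ₗ[k] F} {β : B →ₗ[k] X →ₗ[k] X}
    {α₁ : B →ₗ[k] U₁ →ₗ[k] U₁} {α₂ : B →ₗ[k] U₂ →ₗ[k] U₂} {α₃ : B →ₗ[k] U₃ →ₗ[k] U₃}
    {d₀ : U₀ →ₗ[k] U₁} {d₁ : U₁ →ₗ[k] U₂} {d₂ : U₂ →ₗ[k] U₃} {i : X' →ₗ[k] F} {p : F →ₗ[k] X}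
    (hd₂ : IsEquivariant α₂ α₃ d₂) (hdd : d₂ ∘ₗ d₁ = 0)
    (hi : IsEquivariant β' φ i) (hp : IsEquivariant φ β p) (hpi : p ∘ₗ i = 0)
    (hsurj : Function.Surjective p)
    (hmid : CoinvExact (twistedAction φ α₂) (twistedAction β α₂) (i.rTensor U₂) (p.rTensor U₂))
    (hinj : CoinvExact (twistedAction β' α₃) (twistedAction φ α₃)
      ((0 : X' →ₗ[k] X').rTensor U₃) (i.rTensor U₃))
    (hF : CoinvExact (twistedAction φ α₁) (twistedAction φ α₂) (d₀.lTensor F) (d₁.lTensor F))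
    (hX' : CoinvExact (twistedAction β' α₂) (twistedAction β' α₃) (d₁.lTensor X')
      (d₂.lTensor X')) :
    CoinvExact (twistedAction β α₁) (twistedAction β α₂) (d₀.lTensor X) (d₁.lTensor X) := by
  intro z hz
  obtain ⟨y, rfl⟩ := LinearMap.rTensor_surjective U₁ hsurj z
  rw [lTensor_rTensor_apply] at hz
  obtain ⟨w, hw⟩ := hmid _ hz
  have hdy : d₂.lTensor F (d₁.lTensor F y) = 0 := by
    rw [← LinearMap.comp_apply, ← LinearMap.lTensor_comp, hdd, LinearMap.lTensor_zero,
      LinearMap.zero_apply]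
  have hw1 := coinvKer_le_of_equivariant (twistedAction_comm φ hd₂) hw
  rw [Submodule.mem_comap, map_sub, hdy, zero_sub, Submodule.neg_mem_iff,
    lTensor_rTensor_apply] at hw1
  obtain ⟨w₁, hw₁⟩ := hinj _ hw1
  rw [LinearMap.rTensor_zero, LinearMap.zero_apply, sub_zero] at hw₁
  obtain ⟨w', hw'⟩ := hX' w hw₁
  have hiw := coinvKer_le_of_equivariant (equivariant_rTensor hi α₂) hw'
  -- The boundary of the lift `y` is `i w` with `w ≡ d₁ w'`, so subtracting `i w'` makes the lift a
  -- cycle without changing its image in `X`.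
  obtain ⟨y', hy'⟩ := hF (y - i.rTensor U₁ w') (by
    have h := Submodule.add_mem _ hw hiw
    rw [map_sub, sub_add_sub_cancel] at h
    rwa [map_sub, lTensor_rTensor_apply])
  refine ⟨p.rTensor U₀ y', ?_⟩
  have h := coinvKer_le_of_equivariant (equivariant_rTensor hp α₁) hy'
  have h0 : p.rTensor U₁ (i.rTensor U₁ w') = 0 := by
    rw [← LinearMap.comp_apply, ← LinearMap.rTensor_comp, hpi, LinearMap.rTensor_zero,
      LinearMap.zero_apply]
  rwa [Submodule.mem_comap, map_sub, map_sub, h0, sub_zero, ← lTensor_rTensor_apply] at h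

/-- Exactness of `k ⊗_B (X ⊗ U_*)` for an exact sequence `U_*` of flat `B`-modules and a `B`-module
`X` of finite projective dimension. -/
lemma coinvExact_of_hasProjectiveDimensionLE [BijectiveAntipode k B] (n : ℕ)
    (U : ℕ → ModuleCat.{u} k) (α : ∀ l, B →ₗ[k] U l →ₗ[k] U l) (hα : ∀ l, IsAction (α l))
    (hflat : ∀ l, CoinvFlat (α l)) (d : ∀ l, U l →ₗ[k] U (l + 1))
    (hd : ∀ l, IsEquivariant (α l) (α (l + 1)) (d l))
    (hexact : ∀ l, Function.Exact (d l) (d (l + 1))) :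
    ∀ (X : Type u) [AddCommGroup X] [Module k X] [Module B X] [IsScalarTower k B X],
      HasProjectiveDimensionLE (ModuleCat.of B X) n → ∀ l,
      CoinvExact (twistedAction (actionMap k B X) (α (l + 1)))
        (twistedAction (actionMap k B X) (α (l + 2))) ((d l).lTensor X)
        ((d (l + 1)).lTensor X) := by
  induction n with
  | zero =>
    intro X _ _ _ _ hX l
    have h1 : Projective (ModuleCat.of B X) := inferInstance
    have h2 : Module.Projective B X := (IsProjective.iff_projective X).2 h1
    exact coinvExact_twistedAction (hα _) (hα _) (hd _) (hexact l)
  | succ n ih =>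
    intro X _ _ _ _ hX l
    let p : (X →₀ B) →ₗ[B] X := Finsupp.linearCombination B id
    have hp : Function.Surjective p := fun x => ⟨Finsupp.single x 1, by simp [p]⟩
    let i : LinearMap.ker p →ₗ[B] (X →₀ B) := (LinearMap.ker p).subtype
    have hip : Function.Exact i p := LinearMap.exact_subtype_ker_map p
    have hi : Function.Injective i := Subtype.val_injective
    have hS := LinearMap.shortExact_shortComplexKer hp
    have hF : Module.Projective B (X →₀ B) := inferInstance
    have hF1 : Projective (ModuleCat.of B (X →₀ B)) := (IsProjective.iff_projective _).1 hF
    have hF2 : HasProjectiveDimensionLT (ModuleCat.of B (X →₀ B)) (n + 1) :=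
      hasProjectiveDimensionLT_of_ge _ 1 _ (by omega)
    -- `HasProjectiveDimensionLE _ n` means `HasProjectiveDimensionLT _ (n + 1)`; the syzygy of a
    -- module of dimension at most `n + 1` in a free module has dimension at most `n`.
    have hker : HasProjectiveDimensionLE (ModuleCat.of B (LinearMap.ker p)) n :=
      hS.hasProjectiveDimensionLT_X₁ (n + 1) hF2 hX
    let i' : LinearMap.ker p →ₗ[k] (X →₀ B) := i.restrictScalars k
    let p' : (X →₀ B) →ₗ[k] X := p.restrictScalars k
    have eqi : IsEquivariant (actionMap k B (LinearMap.ker p))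
        (actionMap k B (X →₀ B)) i' := fun b m => i.map_smul b m
    have eqp : IsEquivariant (actionMap k B (X →₀ B)) (actionMap k B X) p' :=
      fun b m => p.map_smul b m
    have hmid := fun m => (hflat m).twistedAction (isAction_actionMap _) (isAction_actionMap _)
      (isAction_actionMap _) eqi eqp hip
    -- Injectivity is phrased as exactness after the zero map so that flatness of the `U l`
    -- transports it to coinvariants.
    have hzero : Function.Exact (0 : LinearMap.ker p →ₗ[k] LinearMap.ker p) i' := fun x =>
      ⟨fun hx => ⟨0, (hi (hx.trans (map_zero i).symm)).symm⟩, by rintro ⟨_, rfl⟩; exact map_zero i⟩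
    have hinj := fun m => (hflat m).twistedAction (β := actionMap k B (LinearMap.ker p))
      (isAction_actionMap _) (isAction_actionMap _) (isAction_actionMap _)
      (fun b x => (map_zero (actionMap k B (LinearMap.ker p) b)).symm) eqi hzero
    -- The syzygy is used one degree higher, at `l + 1`. The complex continues indefinitely upwards,
    -- so it is the finite projective dimension that makes this stop.
    exact coinvExact_of_resolution_step (hd (l + 2)) (hexact (l + 1)).linearMap_comp_eq_zero eqi eqp
      (LinearMap.ext hip.apply_apply_eq_zero) hp (hmid (l + 2)) (hinj (l + 3))
      (coinvExact_twistedAction (hα _) (hα _) (hd _) (hexact l)) (ih _ hker (l + 1))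

end FiniteProjectiveDimension

/-! ### The bar complex of an H-counital coalgebra with an inert factor. -/

section ZeroBar

variable {k B : Type u} [Field k] [Ring B] [HopfAlgebra k B]
variable (D : Type u) [AddCommGroup D] [Module k D] [Module B D] [IsScalarTower k B D]
variable {W : Type u} [AddCommGroup W] [Module k W]

/-- The diagonal action on `W ⊗ D^{⊗ n}`, for an action on `W`. -/
def tpowActionOf (α : B →ₗ[k] W →ₗ[k] W) : ∀ n : ℕ, B →ₗ[k] tpow k D W n →ₗ[k] tpow k D W n
  | 0 => α
  | n + 1 => diagAction (tpowActionOf α n) (actionMap k B D)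

lemma isAction_tpowActionOf {α : B →ₗ[k] W →ₗ[k] W} (hα : IsAction α) (n : ℕ) :
    IsAction (tpowActionOf D α n) := by
  induction n with
  | zero => exact hα
  | succ n ih => exact ih.diag (isAction_actionMap D)

lemma coinvFlat_tpowActionOf {α : B →ₗ[k] W →ₗ[k] W} (hα : CoinvFlat α) (n : ℕ) :
    CoinvFlat (tpowActionOf D α n) := by
  induction n with
  | zero => exact hα
  | succ n ih => exact ih.diagAction (isAction_actionMap D)

variable [ModuleCoalgebra k B D]

variable (k B W) in
/-- `splitLast` as a map `W ⊗ D^{⊗ l+1} → W ⊗ D^{⊗ l+2}`. -/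
def splitLastOf (l : ℕ) : tpow k D W (l + 1) →ₗ[k] tpow k D W (l + 2) :=
  splitLast k B D (tpow k D W l)

variable (k B W) in
/-- The signed sum of the comultiplications of the factors `D` of `W ⊗ D^{⊗ l}`, with signs
starting at `(-1)^{t+1}`. -/
def zeroBar (t : ℕ) : ∀ l : ℕ, tpow k D W l →ₗ[k] tpow k D W (l + 1)
  | 0 => 0
  | l + 1 => rTensorT (zeroBar t l) + (-1 : k) ^ (t + l + 1) • splitLastOf k B D W l

variable (k B W) in
lemma zeroBar_zero (t : ℕ) : zeroBar k B D W t 0 = 0 := rfl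

variable (k B W) in
lemma zeroBar_succ (t l : ℕ) : zeroBar k B D W t (l + 1) =
    rTensorT (zeroBar k B D W t l) + (-1 : k) ^ (t + l + 1) • splitLastOf k B D W l := rfl

lemma isEquivariant_add_smul {V V' : Type u} [AddCommGroup V] [Module k V] [AddCommGroup V']
    [Module k V'] {α : B →ₗ[k] V →ₗ[k] V} {β : B →ₗ[k] V' →ₗ[k] V'} {f g : V →ₗ[k] V'}
    (hf : IsEquivariant α β f) (hg : IsEquivariant α β g) (s : k) :
    IsEquivariant α β (f + s • g) := fun b v => by
  simp [hf b v, hg b v]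

lemma zeroBar_equivariant (α : B →ₗ[k] W →ₗ[k] W) (t l : ℕ) :
    IsEquivariant (tpowActionOf D α l) (tpowActionOf D α (l + 1)) (zeroBar k B D W t l) := by
  induction l with
  | zero => exact fun b v => (map_zero _).symm
  | succ l ih =>
    exact isEquivariant_add_smul (ih.map (IsEquivariant.id _))
      (splitLast_equivariant (tpowActionOf D α l)) _

variable (k W) in
/-- The isomorphism `W ⊗ D^{⊗ l+1} ≃ W ⊗ (D ⊗ D^{⊗ l})`. -/
def tpowAssoc : ∀ l : ℕ, tpow k D W (l + 1) ≃ₗ[k] W ⊗[k] tpow k D D l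
  | 0 => LinearEquiv.refl k (W ⊗[k] D)
  | l + 1 => (TensorProduct.congr (tpowAssoc l) (LinearEquiv.refl k D)).trans
      (TensorProduct.assoc k W (tpow k D D l) D)

variable (B) in
-- The induction step of `tpowAssoc_zeroBar` for arbitrary modules: adding one factor `D` extends
-- both differentials by a comultiplication of the last factor, with signs in the fixed ratio `r`.
lemma tpowAssoc_step {V T : Type u} [AddCommGroup V] [Module k V] [AddCommGroup T] [Module k T]
    (c : V →ₗ[k] W ⊗[k] T) (z : V →ₗ[k] V ⊗[k] D) (e : T →ₗ[k] T ⊗[k] D) (r s : k)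
    (h : ((TensorProduct.assoc k W T D).toLinearMap ∘ₗ c.rTensor D) ∘ₗ z =
      r • (e.lTensor W ∘ₗ c)) :
    ((TensorProduct.assoc k W (T ⊗[k] D) D).toLinearMap ∘ₗ
      ((TensorProduct.assoc k W T D).toLinearMap ∘ₗ c.rTensor D).rTensor D) ∘ₗ
        (z.rTensor D + (r * s) • splitLast k B D V) =
      r • ((e.rTensor D + s • splitLast k B D T).lTensor W ∘ₗ
        ((TensorProduct.assoc k W T D).toLinearMap ∘ₗ c.rTensor D)) := by
  have h1 : ((TensorProduct.assoc k W (T ⊗[k] D) D).toLinearMap ∘ₗ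
      ((TensorProduct.assoc k W T D).toLinearMap ∘ₗ c.rTensor D).rTensor D) ∘ₗ z.rTensor D =
      r • ((e.rTensor D).lTensor W ∘ₗ
        ((TensorProduct.assoc k W T D).toLinearMap ∘ₗ c.rTensor D)) := by
    rw [LinearMap.comp_assoc, ← LinearMap.rTensor_comp, h, LinearMap.rTensor_smul,
      LinearMap.comp_smul]
    congr 1
    refine TensorProduct.ext' fun v d => ?_
    simp only [LinearMap.comp_apply, LinearMap.rTensor_tmul, LinearEquiv.coe_coe]
    induction c v using TensorProduct.induction_on with
    | zero => simp
    | add x y hx hy => simp only [map_add, TensorProduct.add_tmul, hx, hy]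
    | tmul w t => simp
  have h2 : ((TensorProduct.assoc k W (T ⊗[k] D) D).toLinearMap ∘ₗ
      ((TensorProduct.assoc k W T D).toLinearMap ∘ₗ c.rTensor D).rTensor D) ∘ₗ
        splitLast k B D V = (splitLast k B D T).lTensor W ∘ₗ
        ((TensorProduct.assoc k W T D).toLinearMap ∘ₗ c.rTensor D) := by
    refine TensorProduct.ext' fun v d => ?_
    have h3 : ∀ q : D ⊗[k] D, (TensorProduct.assoc k W (T ⊗[k] D) D)
        (((TensorProduct.assoc k W T D).toLinearMap ∘ₗ c.rTensor D).rTensor D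
          ((TensorProduct.assoc k V D D).symm (v ⊗ₜ q))) =
        ((TensorProduct.assoc k T D D).symm.toLinearMap.lTensor W)
          (TensorProduct.assoc k W T (D ⊗[k] D) (c v ⊗ₜ q)) := by
      intro q
      induction q using TensorProduct.induction_on with
      | zero => simp
      | add x y hx hy => simp only [map_add, TensorProduct.tmul_add, hx, hy]
      | tmul d₁ d₂ =>
        simp only [TensorProduct.assoc_symm_tmul, LinearMap.rTensor_tmul, LinearMap.comp_apply,
          LinearEquiv.coe_coe]
        induction c v using TensorProduct.induction_on with
        | zero => simp
        | add x y hx hy => simp only [map_add, TensorProduct.add_tmul, hx, hy]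
        | tmul w t => simp
    refine (h3 (ModuleCoalgebra.comul B d)).trans ?_
    simp only [LinearMap.comp_apply, LinearMap.rTensor_tmul, LinearEquiv.coe_coe]
    induction c v using TensorProduct.induction_on with
    | zero => simp
    | add x y hx hy => simp only [map_add, TensorProduct.add_tmul, hx, hy]
    | tmul w t => simp [splitLast]
  rw [LinearMap.comp_add, LinearMap.comp_smul, h1, h2, LinearMap.lTensor_add,
    LinearMap.lTensor_smul, LinearMap.add_comp, LinearMap.smul_comp, smul_add, smul_smul]

variable (B) in
-- In both differentials the signs alternate from factor to factor. The first factor `D` has sign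
-- `(-1)^{t+1}` in one and `+1` in the other, which accounts for the global sign.
lemma tpowAssoc_zeroBar (t l : ℕ) :
    (tpowAssoc k D W (l + 1)).toLinearMap ∘ₗ zeroBar k B D W t (l + 1) =
      (-1 : k) ^ (t + 1) • ((barD (regular k B D) l).lTensor W ∘ₗ
        (tpowAssoc k D W l).toLinearMap) := by
  induction l with
  | zero =>
    rw [barD_zero]
    have h1 : rTensorT (zeroBar k B D W t 0) = 0 := LinearMap.rTensor_zero _
    have h2 : zeroBar k B D W t (0 + 1) = (-1 : k) ^ (t + 1) • splitLastOf k B D W 0 := by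
      rw [zeroBar_succ, h1]
      exact zero_add _
    rw [h2, LinearMap.comp_smul]
    refine congrArg _ ?_
    refine TensorProduct.ext' (M := W) (N := D) fun w d => ?_
    change TensorProduct.assoc k W D D ((TensorProduct.congr (LinearEquiv.refl k (W ⊗[k] D))
      (LinearEquiv.refl k D)) (splitLast k B D W (w ⊗ₜ d))) = w ⊗ₜ ModuleCoalgebra.comul B d
    simp [splitLast]
  | succ l ih =>
    have h := tpowAssoc_step B D (tpowAssoc k D W l).toLinearMap (zeroBar k B D W t (l + 1))
      (barD (regular k B D) l) ((-1) ^ (t + 1)) ((-1) ^ (l + 1)) ih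
    rw [← pow_add, show t + 1 + (l + 1) = t + (l + 1) + 1 by omega] at h
    rw [barD_succ]
    exact h

variable {D} in
lemma HCounital.injective (h : HCounital k B D) :
    Function.Injective (barD (regular k B D) 0) := by
  have h0 := h 0
  rw [HomologicalComplex.exactAt_iff' _ 0 0 1 (by simp) (by simp),
    ShortComplex.ShortExact.moduleCat_exact_iff_function_exact] at h0
  rw [injective_iff_map_eq_zero]
  intro x hx
  have hd : (barComplex k B D).d 0 1 = ModuleCat.ofHom (X := tpow k D D 0) (Y := tpow k D D 1)
      (barD (regular k B D) 0) :=
    CochainComplex.of_d (fun n => ModuleCat.of k (tpow k D D n))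
      (fun n => ModuleCat.ofHom (X := tpow k D D n) (Y := tpow k D D (n + 1))
        (barD (regular k B D) n)) 0
  obtain ⟨y, hy⟩ := (h0 x).1 (by
    change (barComplex k B D).d 0 1 x = 0
    rw [hd]
    exact hx)
  -- The degree before `0` is `0` itself in this indexing, so the incoming map is zero and exactness
  -- in degree `0` amounts to injectivity.
  have hz : (barComplex k B D).d 0 0 = 0 := HomologicalComplex.shape _ _ _ (by simp)
  change (barComplex k B D).d 0 0 y = x at hy
  rw [hz] at hy
  exact hy.symm

variable {D} in
lemma HCounital.exact (h : HCounital k B D) (l : ℕ) :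
    Function.Exact (barD (regular k B D) l) (barD (regular k B D) (l + 1)) := by
  have h0 := h (l + 1)
  rw [HomologicalComplex.exactAt_iff' _ l (l + 1) (l + 2) (by simp) (by simp),
    ShortComplex.ShortExact.moduleCat_exact_iff_function_exact] at h0
  have hd : ∀ l, (barComplex k B D).d l (l + 1) = ModuleCat.ofHom (X := tpow k D D l)
      (Y := tpow k D D (l + 1)) (barD (regular k B D) l) := fun l =>
    CochainComplex.of_d (fun n => ModuleCat.of k (tpow k D D n))
      (fun n => ModuleCat.ofHom (X := tpow k D D n) (Y := tpow k D D (n + 1))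
        (barD (regular k B D) n)) l
  intro x
  have h1 := h0 x
  change (barComplex k B D).d (l + 1) (l + 2) x = 0 ↔
    x ∈ Set.range ((barComplex k B D).d l (l + 1)) at h1
  rw [hd, hd] at h1
  exact h1

/-- From degree `1` on this is, up to sign, `W` tensored with the bar complex, exact because `W` is
flat over a field. The extra term `W` in degree `0` has zero differential. -/
lemma zeroBar_exact (h : HCounital k B D) (t l : ℕ) :
    Function.Exact (zeroBar k B D W t l) (zeroBar k B D W t (l + 1)) := by
  have hs : (-1 : k) ^ (t + 1) * (-1 : k) ^ (t + 1) = 1 := by rw [← mul_pow]; simp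
  have hc : ∀ (l : ℕ) x, tpowAssoc k D W (l + 1) (zeroBar k B D W t (l + 1) x) =
      (-1 : k) ^ (t + 1) • (barD (regular k B D) l).lTensor W (tpowAssoc k D W l x) :=
    fun l x => LinearMap.congr_fun (tpowAssoc_zeroBar B D t l) x
  have hker : ∀ (l : ℕ) x, zeroBar k B D W t (l + 1) x = 0 ↔
      (barD (regular k B D) l).lTensor W (tpowAssoc k D W l x) = 0 := fun l x => by
    rw [← (tpowAssoc k D W (l + 1)).map_eq_zero_iff, hc, smul_eq_zero_iff_right
      (pow_ne_zero _ (by simp))]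
  intro x
  rw [hker]
  cases l with
  | zero =>
    -- The incoming map is zero, so this case asks for injectivity of `id_W ⊗ Δ`, where
    -- H-counitality is used in degree `0`.
    have hinj := Module.Flat.lTensor_preserves_injective_linearMap (M := W) _ h.injective
    rw [map_eq_zero_iff _ hinj, LinearEquiv.map_eq_zero_iff]
    exact ⟨fun hx => ⟨0, by rw [hx, map_zero]⟩, by rintro ⟨y, rfl⟩; rfl⟩
  | succ l =>
    rw [(Module.Flat.lTensor_exact W (h.exact l)) (tpowAssoc k D W (l + 1) x)]
    constructor
    · rintro ⟨y, hy⟩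
      refine ⟨(-1 : k) ^ (t + 1) • (tpowAssoc k D W l).symm y, ?_⟩
      apply (tpowAssoc k D W (l + 1)).injective
      rw [map_smul, map_smul, hc, smul_smul, hs, one_smul, LinearEquiv.apply_symm_apply, hy]
    · rintro ⟨y, rfl⟩
      rw [hc]
      exact ⟨(-1 : k) ^ (t + 1) • tpowAssoc k D W l y, by rw [map_smul]⟩

end ZeroBar

/-! ### The rotation carries the cyclic face to a comultiplication. -/

section RotatedComplex

variable {k B : Type u} [Field k] [Ring B] [HopfAlgebra k B]
variable (X : Type u) [AddCommGroup X] [Module k X]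
variable {Q : Type u} [AddCommGroup Q] [Module k Q] [Module B Q] [IsScalarTower k B Q]
  [ModuleCoalgebra k B Q]
variable (U : Type u) [AddCommGroup U] [Module k U]

variable (k B Q) in
/-- The left coaction `m ⊗ u ↦ m₍₁₎ ⊗ (m₍₂₎ ⊗ u)` on `Q ⊗ U`. -/
def freeCoact : Q ⊗[k] U →ₗ[k] Q ⊗[k] (Q ⊗[k] U) :=
  (TensorProduct.assoc k Q Q U).toLinearMap ∘ₗ (ModuleCoalgebra.comul (k := k) B (C := Q)).rTensor U

variable (k B Q) in
/-- The map `x ⊗ (m ⊗ u) ↦ x₍₀₎ ⊗ (m₍₂₎ ⊗ (u ⊗ x₍₋₁₎ m₍₁₎))`. -/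
def freeCyclic [LeftComodule k B X] : X ⊗[k] (Q ⊗[k] U) →ₗ[k] X ⊗[k] (Q ⊗[k] (U ⊗[k] Q)) :=
  (TensorProduct.assoc k Q U Q).toLinearMap.lTensor X ∘ₗ cyclicMap B X (freeCoact k B Q U)

variable {X U}

omit [ModuleCoalgebra k B Q] in
lemma rotateEquiv_lTensor [BijectiveAntipode k B] [LeftComodule k B X] {U' : Type u}
    [AddCommGroup U'] [Module k U'] (e : U →ₗ[k] U') (z : X ⊗[k] (Q ⊗[k] U)) :
    rotateEquiv k B X Q U' ((e.lTensor Q).lTensor X z) =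
      (e.rTensor Q).lTensor X (rotateEquiv k B X Q U z) := by
  induction z using TensorProduct.induction_on with
  | zero => simp
  | add x y hx hy => simp only [map_add, hx, hy]
  | tmul x z =>
    induction z using TensorProduct.induction_on with
    | zero => simp
    | add x y hx hy => simp only [map_add, TensorProduct.tmul_add, hx, hy]
    | tmul m u =>
      simp only [LinearMap.lTensor_tmul, rotateEquiv_tmul]
      induction (LeftComodule.coact x : B ⊗[k] X) using TensorProduct.induction_on with
      | zero => simp
      | add x y hx hy => simp only [map_add, TensorProduct.add_tmul, hx, hy]
      | tmul b x => simp

/-- By `Δ(b m) = b₍₁₎ m₍₁₎ ⊗ b₍₂₎ m₍₂₎`, comultiplying the moved factor amounts to splitting `b` and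
`m` before the move. -/
lemma splitLast_cyclicMove (r : B ⊗[k] X) (m : Q) (u : U) :
    (splitLast k B Q U).lTensor X (cyclicMove k B Q X U (r ⊗ₜ (m ⊗ₜ u))) =
      cyclicMove₂ k B Q X U
        (TensorProduct.assoc k B B X ((Coalgebra.comul (R := k) (A := B)).rTensor X r) ⊗ₜ
          freeCoact k B Q U (m ⊗ₜ u)) := by
  have h0 : ∀ (p : B ⊗[k] B) (q : Q ⊗[k] Q) (x : X),
      x ⊗ₜ[k] (TensorProduct.assoc k U Q Q).symm (u ⊗ₜ[k]
        (TensorProduct.homTensorHomMap (.id k) Q Q Q Q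
          (TensorProduct.map (actionMap k B Q) (actionMap k B Q) p) q)) =
      cyclicMove₂ k B Q X U
        (TensorProduct.assoc k B B X (p ⊗ₜ x) ⊗ₜ TensorProduct.assoc k Q Q U (q ⊗ₜ u)) := by
    intro p q x
    induction p using TensorProduct.induction_on with
    | zero => simp
    | add y z hy hz =>
      simp only [map_add, LinearMap.add_apply, TensorProduct.tmul_add, TensorProduct.add_tmul, hy, hz]
    | tmul b b' =>
      induction q using TensorProduct.induction_on with
      | zero => simp
      | add y z hy hz =>
        simp only [map_add, TensorProduct.tmul_add, TensorProduct.add_tmul, hy, hz]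
      | tmul c c' => simp
  induction r using TensorProduct.induction_on with
  | zero => simp
  | add y z hy hz => simp only [map_add, TensorProduct.add_tmul, hy, hz]
  | tmul b x =>
    simp only [cyclicMove_tmul, LinearMap.lTensor_tmul, LinearMap.rTensor_tmul, freeCoact,
      LinearMap.comp_apply, LinearEquiv.coe_coe]
    rw [← h0, splitLast, LinearMap.comp_apply, LinearMap.lTensor_tmul, ModuleCoalgebra.comul_smul]
    rfl

/-- Both sides are `x₍₀₎ ⊗ u ⊗ x₍₋₂₎ m₍₁₎ ⊗ x₍₋₁₎ m₍₂₎`: on the left from coacting twice, on the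
right from comultiplying `x₍₋₁₎ m`. Coassociativity of the coaction on `X` identifies them. -/
lemma rotateEquiv_freeCyclic [BijectiveAntipode k B] [LeftComodule k B X]
    (z : X ⊗[k] (Q ⊗[k] U)) :
    rotateEquiv k B X Q (U ⊗[k] Q) (freeCyclic k B X Q U z) =
      (splitLast k B Q U).lTensor X (rotateEquiv k B X Q U z) := by
  have h : ∀ (r : B ⊗[k] X) (w : Q ⊗[k] (Q ⊗[k] U)), rotateEquiv k B X Q (U ⊗[k] Q)
      ((TensorProduct.assoc k Q U Q).toLinearMap.lTensor X
        (cyclicMove k B Q X (Q ⊗[k] U) (r ⊗ₜ w))) =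
      cyclicMove₂ k B Q X U ((LeftComodule.coact (k := k) (B := B)).lTensor B r ⊗ₜ w) := by
    intro r w
    induction r using TensorProduct.induction_on with
    | zero => simp
    | add x y hx hy => simp only [map_add, TensorProduct.add_tmul, hx, hy]
    | tmul b x =>
      induction w using TensorProduct.induction_on with
      | zero => simp
      | add x y hx hy => simp only [map_add, TensorProduct.tmul_add, hx, hy]
      | tmul m₁ w =>
        induction w using TensorProduct.induction_on with
        | zero => simp
        | add x y hx hy => simp only [map_add, TensorProduct.tmul_add, hx, hy]
        | tmul m₂ u =>
          simp only [cyclicMove_tmul, LinearMap.lTensor_tmul, LinearEquiv.coe_coe,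
            TensorProduct.assoc_tmul, rotateEquiv_tmul]
          induction (LeftComodule.coact x : B ⊗[k] X) using TensorProduct.induction_on with
          | zero => simp
          | add x y hx hy =>
            simp only [map_add, TensorProduct.add_tmul, TensorProduct.tmul_add, hx, hy]
          | tmul b' x' => simp
  induction z using TensorProduct.induction_on with
  | zero => simp
  | add x y hx hy => simp only [map_add, hx, hy]
  | tmul x z =>
    induction z using TensorProduct.induction_on with
    | zero => simp
    | add x y hx hy => simp only [map_add, TensorProduct.tmul_add, hx, hy]
    | tmul m u =>
      rw [rotateEquiv_tmul, splitLast_cyclicMove, coact_coassoc_apply, ← h]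
      rfl

variable {W : Type u} [AddCommGroup W] [Module k W]

variable (k B X Q W) in
/-- `freeCyclic` as a map `X ⊗ (Q ⊗ (W ⊗ Q^{⊗ l})) → X ⊗ (Q ⊗ (W ⊗ Q^{⊗ l+1}))`. -/
def freeCyclicT [LeftComodule k B X] (l : ℕ) :
    X ⊗[k] (Q ⊗[k] tpow k Q W l) →ₗ[k] X ⊗[k] (Q ⊗[k] tpow k Q W (l + 1)) :=
  freeCyclic k B X Q (tpow k Q W l)

variable (k B X Q W) in
/-- The map `id_X ⊗ id_Q ⊗ d ± freeCyclic` on `X ⊗ (Q ⊗ (W ⊗ Q^{⊗ l}))`, where `d` is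
`zeroBar`. -/
def freeD [LeftComodule k B X] (t l : ℕ) :
    X ⊗[k] (Q ⊗[k] tpow k Q W l) →ₗ[k] X ⊗[k] (Q ⊗[k] tpow k Q W (l + 1)) :=
  ((zeroBar k B Q W t l).lTensor Q).lTensor X +
    (-1 : k) ^ (t + l + 1) • freeCyclicT k B X Q W l

variable [BijectiveAntipode k B]

variable (k B X Q W) in
/-- `rotateEquiv` as an isomorphism `X ⊗ (Q ⊗ (W ⊗ Q^{⊗ l})) ≃ X ⊗ (W ⊗ Q^{⊗ l+1})`. -/
def rotateT [LeftComodule k B X] (l : ℕ) :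
    X ⊗[k] (Q ⊗[k] tpow k Q W l) ≃ₗ[k] X ⊗[k] tpow k Q W (l + 1) :=
  rotateEquiv k B X Q (tpow k Q W l)

/-- The sign of the cyclic face is the sign of the last comultiplication in `zeroBar` one degree up,
so the two differentials match with no correction. -/
lemma rotateT_freeD [LeftComodule k B X] (t l : ℕ) (z : X ⊗[k] (Q ⊗[k] tpow k Q W l)) :
    rotateT k B X Q W (l + 1) (freeD k B X Q W t l z) =
      (zeroBar k B Q W t (l + 1)).lTensor X (rotateT k B X Q W l z) := by
  rw [zeroBar_succ, LinearMap.lTensor_add, LinearMap.lTensor_smul, LinearMap.add_apply,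
    LinearMap.smul_apply, freeD, LinearMap.add_apply, LinearMap.smul_apply, map_add, map_smul]
  have h1 : rotateT k B X Q W (l + 1) (((zeroBar k B Q W t l).lTensor Q).lTensor X z) =
      (rTensorT (zeroBar k B Q W t l)).lTensor X (rotateT k B X Q W l z) :=
    rotateEquiv_lTensor (zeroBar k B Q W t l) z
  have h2 : rotateT k B X Q W (l + 1) (freeCyclicT k B X Q W l z) =
      (splitLastOf k B Q W l).lTensor X (rotateT k B X Q W l z) :=
    rotateEquiv_freeCyclic z
  rw [h1, h2]

variable [Module B X] [IsScalarTower k B X] [AYDModule k B X]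

omit [ModuleCoalgebra k B Q] in
lemma rotateT_mem (α : B →ₗ[k] W →ₗ[k] W) (l : ℕ) (z : X ⊗[k] (Q ⊗[k] tpow k Q W l)) :
    rotateT k B X Q W l z ∈
        coinvKer (twistedAction (actionMap k B X) (tpowActionOf Q α (l + 1))) ↔
      z ∈ coinvKer (twistedAction (actionMap k B X)
        (diagAction (actionMap k B Q) (tpowActionOf Q α l))) :=
  rotateEquiv_mem (tpowActionOf Q α l) z

/-- After rotation a cycle modulo coinvariance is a cycle of `zeroBar` in degree `l + 1`, where the
bar complex with coefficients `X` is exact. -/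
lemma freeD_exact {α : B →ₗ[k] W →ₗ[k] W} (hα : IsAction α) (hflat : CoinvFlat α)
    (hQ : HCounital k B Q) {n : ℕ} (hX : HasProjectiveDimensionLE (ModuleCat.of B X) n) (t l : ℕ)
    {z : X ⊗[k] (Q ⊗[k] tpow k Q W l)}
    (hz : freeD k B X Q W t l z ∈ coinvKer (twistedAction (actionMap k B X)
      (diagAction (actionMap k B Q) (tpowActionOf Q α (l + 1))))) :
    ∃ y, rotateT k B X Q W l z - (zeroBar k B Q W t l).lTensor X y ∈
      coinvKer (twistedAction (actionMap k B X) (tpowActionOf Q α (l + 1))) := by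
  rw [← rotateT_mem, rotateT_freeD] at hz
  exact coinvExact_of_hasProjectiveDimensionLE n (fun l => tpow k Q W l) (tpowActionOf Q α)
    (isAction_tpowActionOf Q hα) (coinvFlat_tpowActionOf Q hflat) (zeroBar k B Q W t)
    (zeroBar_equivariant Q α t) (zeroBar_exact Q hQ t) X hX l _ hz

/-- The rotated complex starts with the zero map, so the boundary provided by `freeD_exact` vanishes
at the bottom. -/
lemma freeD_zero_exact {α : B →ₗ[k] W →ₗ[k] W} (hα : IsAction α) (hflat : CoinvFlat α)
    (hQ : HCounital k B Q) {n : ℕ} (hX : HasProjectiveDimensionLE (ModuleCat.of B X) n) (t : ℕ)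
    {z : X ⊗[k] (Q ⊗[k] tpow k Q W 0)}
    (hz : freeD k B X Q W t 0 z ∈ coinvKer (twistedAction (actionMap k B X)
      (diagAction (actionMap k B Q) (tpowActionOf Q α 1)))) :
    z ∈ coinvKer (twistedAction (actionMap k B X)
      (diagAction (actionMap k B Q) (tpowActionOf Q α 0))) := by
  obtain ⟨y, hy⟩ := freeD_exact hα hflat hQ hX t 0 hz
  rw [zeroBar_zero, LinearMap.lTensor_zero, LinearMap.zero_apply, sub_zero] at hy
  exact (rotateT_mem α 0 z).1 hy

lemma freeD_succ_exact {α : B →ₗ[k] W →ₗ[k] W} (hα : IsAction α) (hflat : CoinvFlat α)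
    (hQ : HCounital k B Q) {n : ℕ} (hX : HasProjectiveDimensionLE (ModuleCat.of B X) n) (t l : ℕ)
    {z : X ⊗[k] (Q ⊗[k] tpow k Q W (l + 1))}
    (hz : freeD k B X Q W t (l + 1) z ∈ coinvKer (twistedAction (actionMap k B X)
      (diagAction (actionMap k B Q) (tpowActionOf Q α (l + 2))))) :
    ∃ y, z - freeD k B X Q W t l y ∈ coinvKer (twistedAction (actionMap k B X)
      (diagAction (actionMap k B Q) (tpowActionOf Q α (l + 1)))) := by
  obtain ⟨y, hy⟩ := freeD_exact hα hflat hQ hX t (l + 1) hz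
  refine ⟨(rotateT k B X Q W l).symm y, ?_⟩
  rw [← rotateT_mem, map_sub, rotateT_freeD, LinearEquiv.apply_symm_apply]
  exact hy

end RotatedComplex

/-! ### The `B`-linear splitting and the filtration it defines. -/

section Splitting

variable {k B : Type u} [Field k] [Ring B] [HopfAlgebra k B]
variable {K C Q : Type u}
  [AddCommGroup K] [Module k K] [Module B K] [IsScalarTower k B K] [ModuleCoalgebra k B K]
  [AddCommGroup C] [Module k C] [Module B C] [IsScalarTower k B C] [ModuleCoalgebra k B C]
  [AddCommGroup Q] [Module k Q] [Module B Q] [IsScalarTower k B Q] [ModuleCoalgebra k B Q]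

/-- A `B`-linear splitting of `0 → K → C → Q → 0`. -/
structure Splitting (ι : ModuleCoalgebraHom k B K C) (π : ModuleCoalgebraHom k B C Q) where
  /-- The section of `C → Q`. -/
  sec : Q →ₗ[B] C
  /-- The retraction of `K → C`. -/
  ret : C →ₗ[B] K
  map_sec : ∀ q, π.toFun (sec q) = q
  map_map : ∀ x, π.toFun (ι.toFun x) = 0
  ret_map : ∀ x, ret (ι.toFun x) = x
  map_ret_add : ∀ c, ι.toFun (ret c) + sec (π.toFun c) = c

variable {ι : ModuleCoalgebraHom k B K C} {π : ModuleCoalgebraHom k B C Q}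

lemma IsShortExact.exists_splitting (h : IsShortExact ι π) [Module.Projective B Q] :
    Nonempty (Splitting ι π) := by
  obtain ⟨s, hs⟩ := Module.projective_lifting_property π.toFun LinearMap.id h.surjective
  have hs' : ∀ q, π.toFun (s q) = q := fun q => LinearMap.congr_fun hs q
  have hr : ∀ c, c - s (π.toFun c) ∈ LinearMap.range ι.toFun := fun c =>
    (h.exact _).1 (by rw [map_sub, hs', sub_self])
  let r : C →ₗ[B] K := (LinearEquiv.ofInjective ι.toFun h.injective).symm.toLinearMap ∘ₗ
    (LinearMap.id - s ∘ₗ π.toFun).codRestrict (LinearMap.range ι.toFun) hr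
  have hι : ∀ c, ι.toFun (r c) = c - s (π.toFun c) := fun c => by
    have := LinearEquiv.apply_symm_apply (LinearEquiv.ofInjective ι.toFun h.injective) ⟨_, hr c⟩
    exact congrArg Subtype.val this
  refine ⟨⟨s, r, hs', h.exact.apply_apply_eq_zero, fun x => h.injective ?_, fun c => ?_⟩⟩
  · rw [hι, h.exact.apply_apply_eq_zero, map_zero, sub_zero]
  · rw [hι, sub_add_cancel]

namespace Splitting

variable (σ : Splitting ι π)

/-- The section as a `k`-linear map. -/
def secₖ : Q →ₗ[k] C := σ.sec.restrictScalars k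

/-- The retraction as a `k`-linear map. -/
def retₖ : C →ₗ[k] K := σ.ret.restrictScalars k

/-- The idempotent of `C` with kernel `K`. -/
def idem : C →ₗ[k] C := σ.secₖ ∘ₗ π.toFun.restrictScalars k

lemma secₖ_apply (q : Q) : σ.secₖ q = σ.sec q := rfl

lemma retₖ_apply (c : C) : σ.retₖ c = σ.ret c := rfl

lemma idem_apply (c : C) : σ.idem c = σ.sec (π.toFun c) := rfl

lemma idem_comp_idem : σ.idem ∘ₗ σ.idem = σ.idem :=
  LinearMap.ext fun c => by simp [idem_apply, σ.map_sec]

lemma idem_comp_map : σ.idem ∘ₗ ι.toFun.restrictScalars k = 0 :=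
  LinearMap.ext fun c => by simp [idem_apply, σ.map_map]

lemma idem_comp_sec : σ.idem ∘ₗ σ.secₖ = σ.secₖ :=
  LinearMap.ext fun c => by simp [idem_apply, secₖ_apply, σ.map_sec]

lemma secₖ_equivariant : IsEquivariant (actionMap k B Q) (actionMap k B C) σ.secₖ :=
  fun b q => σ.sec.map_smul b q

lemma retₖ_equivariant : IsEquivariant (actionMap k B C) (actionMap k B K) σ.retₖ :=
  fun b c => σ.ret.map_smul b c

lemma idem_equivariant : IsEquivariant (actionMap k B C) (actionMap k B C) σ.idem :=
  σ.secₖ_equivariant.comp (fun b c => π.toFun.map_smul b c)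

/-- The section need not be a coalgebra map, but `π` is one, so after projecting both legs the
comultiplication depends only on `π c`. All compatibility of `proj` with the differential rests on
this. -/
lemma map_idem_comul (c : C) :
    TensorProduct.map σ.idem σ.idem (ModuleCoalgebra.comul (k := k) B c) =
      TensorProduct.map σ.secₖ σ.secₖ (ModuleCoalgebra.comul (k := k) B (π.toFun c)) := by
  have h := LinearMap.congr_fun π.map_comul c
  simp only [LinearMap.comp_apply, LinearMap.restrictScalars_apply] at h
  have h' : TensorProduct.map σ.idem σ.idem = TensorProduct.map σ.secₖ σ.secₖ ∘ₗ
      TensorProduct.map (π.toFun.restrictScalars k) (π.toFun.restrictScalars k) :=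
    TensorProduct.map_comp ..
  rw [h', LinearMap.comp_apply, h]

lemma map_idem_comul_idem (c : C) :
    TensorProduct.map σ.idem σ.idem (ModuleCoalgebra.comul (k := k) B (σ.idem c)) =
      TensorProduct.map σ.idem σ.idem (ModuleCoalgebra.comul (k := k) B c) := by
  rw [map_idem_comul, map_idem_comul, idem_apply, σ.map_sec]

lemma map_idem_comul_sec (q : Q) :
    TensorProduct.map σ.idem σ.idem (ModuleCoalgebra.comul (k := k) B (σ.secₖ q)) =
      TensorProduct.map σ.secₖ σ.secₖ (ModuleCoalgebra.comul (k := k) B q) := by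
  rw [map_idem_comul, secₖ_apply, σ.map_sec]

lemma map_comp_splitLast {V V' : Type u} [AddCommGroup V] [Module k V] [AddCommGroup V']
    [Module k V'] (g : V →ₗ[k] V') (f f' : C →ₗ[k] C) (v : V) (c : C) :
    TensorProduct.map (TensorProduct.map g f) f' (splitLast k B C V (v ⊗ₜ c)) =
      (TensorProduct.assoc k V' C C).symm (g v ⊗ₜ
        TensorProduct.map f f' (ModuleCoalgebra.comul (k := k) B c)) := by
  simp only [splitLast, LinearMap.comp_apply, LinearMap.lTensor_tmul, LinearEquiv.coe_coe]
  induction ModuleCoalgebra.comul (k := k) B c using TensorProduct.induction_on with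
  | zero => simp
  | add x y hx hy => simp only [map_add, TensorProduct.tmul_add, hx, hy]
  | tmul a b => simp

variable {M : Type u} [AddCommGroup M] [Module k M] [Module B M] [IsScalarTower k B M]

variable (M) in
/-- The idempotent of `M ⊗ C^{⊗ n}` that is the identity on `M` and on the first `p` factors `C`,
and `idem` on the remaining ones. -/
def proj (p : ℕ) : ∀ n : ℕ, tpow k C M n →ₗ[k] tpow k C M n
  | 0 => LinearMap.id
  | n + 1 => TensorProduct.map (proj p n) (if n < p then LinearMap.id else σ.idem)

omit [Module B M] [IsScalarTower k B M] in
lemma proj_of_le {p n : ℕ} (h : n ≤ p) : σ.proj M p n = LinearMap.id := by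
  induction n with
  | zero => rfl
  | succ n ih =>
    rw [proj, ih (by omega), if_pos (by omega)]
    exact TensorProduct.map_id

omit [Module B M] [IsScalarTower k B M] in
lemma proj_succ {p n : ℕ} (h : p ≤ n) :
    σ.proj M p (n + 1) = TensorProduct.map (σ.proj M p n) σ.idem := by
  rw [proj, if_neg (by omega)]

omit [Module B M] [IsScalarTower k B M] in
-- Hence the kernel of `proj q` lies in that of `proj p`: the filtration decreases in `p`. The case
-- `p = q` is idempotence.
lemma proj_comp_proj {p q : ℕ} (h : p ≤ q) (n : ℕ) :
    σ.proj M p n ∘ₗ σ.proj M q n = σ.proj M p n := by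
  induction n with
  | zero => rfl
  | succ n ih =>
    have hi : (if n < p then LinearMap.id else σ.idem) ∘ₗ
        (if n < q then LinearMap.id else σ.idem) = if n < p then LinearMap.id else σ.idem := by
      split_ifs
      · rfl
      · omega
      · rfl
      · exact σ.idem_comp_idem
    have h := TensorProduct.map_comp (σ.proj M p n) (if n < p then LinearMap.id else σ.idem)
      (σ.proj M q n) (if n < q then LinearMap.id else σ.idem)
    rw [ih, hi] at h
    exact h.symm

lemma proj_equivariant (p n : ℕ) :
    IsEquivariant (tpowAction k B C M n) (tpowAction k B C M n) (σ.proj M p n) := by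
  induction n with
  | zero => exact IsEquivariant.id _
  | succ n ih =>
    have : IsEquivariant (actionMap k B C) (actionMap k B C)
        (if n < p then LinearMap.id else σ.idem) := by
      split_ifs
      · exact IsEquivariant.id _
      · exact σ.idem_equivariant
    exact ih.map this

lemma leftExtend_comp_map {V V' T : Type u} [AddCommGroup V] [Module k V] [AddCommGroup V']
    [Module k V'] [AddCommGroup T] [Module k T] {l : V →ₗ[k] C ⊗[k] V} {g : V' →ₗ[k] V}
    {l' : V' →ₗ[k] C ⊗[k] V'} (h : l ∘ₗ g = g.lTensor C ∘ₗ l') (f : T →ₗ[k] C) (v : V') (t : T) :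
    leftExtend l (TensorProduct.map g f (v ⊗ₜ t)) =
      (TensorProduct.map g f).lTensor C (TensorProduct.assoc k C V' T (l' v ⊗ₜ t)) := by
  have hv := LinearMap.congr_fun h v
  simp only [LinearMap.comp_apply] at hv
  simp only [leftExtend, LinearMap.comp_apply, TensorProduct.map_tmul, LinearMap.rTensor_tmul, hv,
    LinearEquiv.coe_coe]
  induction l' v using TensorProduct.induction_on with
  | zero => simp
  | add x y hx hy => simp only [map_add, TensorProduct.add_tmul, hx, hy]
  | tmul a b => simp

/-- The coaction touches only the factor `M`, on which `proj` is the identity. -/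
lemma leftCoact_proj (N : EquivBicomodule k B C M) (p n : ℕ) :
    leftCoact N n ∘ₗ σ.proj M p n = (σ.proj M p n).lTensor C ∘ₗ leftCoact N n := by
  induction n with
  | zero =>
    change N.left ∘ₗ LinearMap.id = LinearMap.id.lTensor C ∘ₗ N.left
    rw [LinearMap.lTensor_id, LinearMap.comp_id, LinearMap.id_comp]
  | succ n ih =>
    refine tpow_hom_ext C fun t c => ?_
    exact leftExtend_comp_map ih (if n < p then LinearMap.id else σ.idem) t c

lemma proj_step {V : Type u} [AddCommGroup V] [Module k V] {P : V →ₗ[k] V}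
    {b : V →ₗ[k] V ⊗[k] C} {P' : V ⊗[k] C →ₗ[k] V ⊗[k] C} (hP' : P' = TensorProduct.map P σ.idem)
    (hP : P ∘ₗ P = P) (h : P' ∘ₗ b ∘ₗ P = P' ∘ₗ b) (s : k) :
    TensorProduct.map P' σ.idem ∘ₗ (b.rTensor C + s • splitLast k B C V) ∘ₗ P' =
      TensorProduct.map P' σ.idem ∘ₗ (b.rTensor C + s • splitLast k B C V) := by
  refine TensorProduct.ext' fun v c => ?_
  have h1 := LinearMap.congr_fun h v
  have h2 := LinearMap.congr_fun hP v
  have h3 := LinearMap.congr_fun σ.idem_comp_idem c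
  simp only [LinearMap.comp_apply] at h1 h2 h3
  have h4 : P' (v ⊗ₜ c) = P v ⊗ₜ σ.idem c := by rw [hP', TensorProduct.map_tmul]
  simp only [LinearMap.comp_apply, h4, LinearMap.add_apply, LinearMap.smul_apply, map_add, map_smul,
    LinearMap.rTensor_tmul, TensorProduct.map_tmul, h1, h3]
  congr 2
  rw [hP', map_comp_splitLast, map_comp_splitLast, h2, map_idem_comul_idem]

/-- The bar differential preserves the kernel of `proj p`. Up to degree `p` there is nothing to
project; beyond it both legs of a split last factor are projected, so `map_idem_comul_idem` applies.
-/
lemma proj_barD_proj (N : EquivBicomodule k B C M) (p n : ℕ) :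
    σ.proj M p (n + 1) ∘ₗ barD N n ∘ₗ σ.proj M p n = σ.proj M p (n + 1) ∘ₗ barD N n := by
  induction n with
  | zero => rfl
  | succ n ih =>
    rcases le_or_gt (n + 1) p with h | h
    · rw [σ.proj_of_le h, LinearMap.comp_id]
    · have hp : p ≤ n := by omega
      rw [barD_succ, σ.proj_succ (n := n + 1) (by omega)]
      exact σ.proj_step (σ.proj_succ hp) (σ.proj_comp_proj le_rfl n) ih _

variable (X : Type u) [AddCommGroup X] [Module k X]

/-- As `p ≤ n`, the factor appended by the cyclic face is one that gets projected, and the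
`B`-linear `idem` passes through the action of `x₍₋₁₎` to the coaction. -/
lemma proj_chCyclic [LeftComodule k B X] (N : EquivBicomodule k B C M) {p n : ℕ} (h : p ≤ n) :
    (σ.proj M p (n + 1)).lTensor X ∘ₗ chCyclic X N n =
      cyclicMap B X (σ.idem.rTensor _ ∘ₗ leftCoact N n) ∘ₗ (σ.proj M p n).lTensor X := by
  have h1 := cyclicMap_natural (X := X) (leftCoact N n) (σ.idem.rTensor _ ∘ₗ leftCoact N n)
    σ.idem (fun b c => σ.idem_equivariant b c) (σ.proj M p n) (by
      rw [LinearMap.comp_assoc, leftCoact_proj, ← LinearMap.comp_assoc,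
        LinearMap.rTensor_comp_lTensor])
  rw [h1, σ.proj_succ h]
  rfl

lemma proj_chD_proj [LeftComodule k B X] (N : EquivBicomodule k B C M) (p n : ℕ) :
    (σ.proj M p (n + 1)).lTensor X ∘ₗ chD X N n ∘ₗ (σ.proj M p n).lTensor X =
      (σ.proj M p (n + 1)).lTensor X ∘ₗ chD X N n := by
  rcases le_or_gt n p with h | h
  · rw [σ.proj_of_le h, LinearMap.lTensor_id, LinearMap.comp_id]
  · have hc : (σ.proj M p (n + 1)).lTensor X ∘ₗ chCyclic X N n ∘ₗ (σ.proj M p n).lTensor X =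
        (σ.proj M p (n + 1)).lTensor X ∘ₗ chCyclic X N n := by
      refine LinearMap.ext fun z => ?_
      have h1 := LinearMap.congr_fun (σ.proj_chCyclic X N h.le)
      have h2 := LinearMap.congr_fun (congrArg (LinearMap.lTensor X)
        (σ.proj_comp_proj (M := M) (le_refl p) n)) z
      rw [LinearMap.lTensor_comp] at h2
      exact ((h1 _).trans (congrArg (cyclicMap B X (σ.idem.rTensor _ ∘ₗ leftCoact N n)) h2)).trans
        (h1 z).symm
    rw [chD_eq, LinearMap.add_comp, LinearMap.smul_comp, LinearMap.comp_add, LinearMap.comp_smul,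
      LinearMap.comp_add, LinearMap.comp_smul, hc, ← LinearMap.lTensor_comp,
      ← LinearMap.lTensor_comp, ← LinearMap.lTensor_comp, proj_barD_proj]

end Splitting

end Splitting

/-! ### Regrouping `M ⊗ C^{⊗ p} ⊗ V` as `M ⊗ W`. -/

section Unrotate

variable {k B : Type u} [Field k] [Ring B] [HopfAlgebra k B]
variable {C M : Type u}
  [AddCommGroup C] [Module k C] [Module B C] [IsScalarTower k B C] [ModuleCoalgebra k B C]
  [AddCommGroup M] [Module k M] [Module B M] [IsScalarTower k B M]

omit [Module B C] [IsScalarTower k B C] [ModuleCoalgebra k B C] in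
lemma leftExtend_rTensor_assoc {T V : Type u} [AddCommGroup T] [Module k T] [AddCommGroup V]
    [Module k V] (l : T →ₗ[k] C ⊗[k] T) (y : T ⊗[k] (C ⊗[k] V)) :
    TensorProduct.assoc k C (T ⊗[k] C) V ((leftExtend l).rTensor V
      ((TensorProduct.assoc k T C V).symm y)) =
    (TensorProduct.assoc k T C V).symm.toLinearMap.lTensor C
      (TensorProduct.assoc k C T (C ⊗[k] V) (l.rTensor (C ⊗[k] V) y)) := by
  induction y using TensorProduct.induction_on with
  | zero => simp
  | add x y hx hy => simp only [map_add, hx, hy]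
  | tmul t y =>
    induction y using TensorProduct.induction_on with
    | zero => simp
    | add x y hx hy => simp only [map_add, TensorProduct.tmul_add, hx, hy]
    | tmul c v =>
      simp only [leftExtend, LinearMap.comp_apply, TensorProduct.assoc_symm_tmul,
        LinearMap.rTensor_tmul, LinearEquiv.coe_coe]
      induction l t using TensorProduct.induction_on with
      | zero => simp
      | add x y hx hy => simp only [map_add, TensorProduct.add_tmul, hx, hy]
      | tmul a b => simp

/-- For `C` projective, `M ⊗ C^{⊗ p} ⊗ V` has the form `M ⊗ W` compatibly with the action of `B`
and with the left coaction. -/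
lemma exists_tpow_tensor_equiv [Module.Projective B C] (N : EquivBicomodule k B C M) (p : ℕ) :
    ∀ (V : Type u) [AddCommGroup V] [Module k V] (β : B →ₗ[k] V →ₗ[k] V), IsAction β →
      CoinvFlat β → ∃ (W : Type u) (_ : AddCommGroup W) (_ : Module k W)
      (α : B →ₗ[k] W →ₗ[k] W) (e : M ⊗[k] W ≃ₗ[k] tpow k C M p ⊗[k] V), IsAction α ∧
      CoinvFlat α ∧ IsEquivariant (diagAction (actionMap k B M) α)
        (diagAction (tpowAction k B C M p) β) e.toLinearMap ∧
      ∀ z, TensorProduct.assoc k C (tpow k C M p) V ((leftCoact N p).rTensor V (e z)) =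
        e.toLinearMap.lTensor C (TensorProduct.assoc k C M W (N.left.rTensor W z)) := by
  induction p with
  | zero =>
    intro V _ _ β hβ hflat
    refine ⟨V, inferInstance, inferInstance, β, LinearEquiv.refl k (M ⊗[k] V), hβ, hflat,
      IsEquivariant.id _, fun z => ?_⟩
    have h : (LinearMap.id : M ⊗[k] V →ₗ[k] M ⊗[k] V).lTensor C = LinearMap.id :=
      LinearMap.lTensor_id ..
    exact (LinearMap.congr_fun h (TensorProduct.assoc k C M V (N.left.rTensor V z))).symm
  | succ p ih =>
    intro V _ _ β hβ hflat
    -- The last factor `C` is absorbed into `V`, which stays flat because the projective `C` stands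
    -- in front.
    obtain ⟨W, _, _, α, e, hα, hW, he, hc⟩ := ih (C ⊗[k] V) (diagAction (actionMap k B C) β)
      ((isAction_actionMap C).diag hβ) (coinvFlat_of_projective.diagAction hβ)
    refine ⟨W, inferInstance, inferInstance, α,
      e.trans (TensorProduct.assoc k (tpow k C M p) C V).symm, hα, hW,
      (IsEquivariant.assoc _ _ _).symm.comp he, fun z => ?_⟩
    refine (leftExtend_rTensor_assoc (leftCoact N p) (e z)).trans ?_
    rw [hc, ← LinearMap.comp_apply, ← LinearMap.lTensor_comp]
    rfl

end Unrotate

/-! ### The layers of the filtration and the bar part of their differential. -/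

namespace Splitting

variable {k B : Type u} [Field k] [Ring B] [HopfAlgebra k B]
variable {K C Q M W : Type u}
  [AddCommGroup K] [Module k K] [Module B K] [IsScalarTower k B K] [ModuleCoalgebra k B K]
  [AddCommGroup C] [Module k C] [Module B C] [IsScalarTower k B C] [ModuleCoalgebra k B C]
  [AddCommGroup Q] [Module k Q] [Module B Q] [IsScalarTower k B Q] [ModuleCoalgebra k B Q]
  [AddCommGroup M] [Module k M] [Module B M] [IsScalarTower k B M]
  [AddCommGroup W] [Module k W]
variable {ι : ModuleCoalgebraHom k B K C} {π : ModuleCoalgebraHom k B C Q} (σ : Splitting ι π)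
variable {p : ℕ} (e : M ⊗[k] W ≃ₗ[k] tpow k C M p ⊗[k] K)

/-- The embedding of `M ⊗ (W ⊗ Q^{⊗ l})` into `M ⊗ C^{⊗ p+1+l}` as
`M ⊗ C^{⊗ p} ⊗ K ⊗ Q^{⊗ l}`. -/
def embed : ∀ l : ℕ, M ⊗[k] tpow k Q W l →ₗ[k] tpow k C M (p + 1 + l)
  | 0 => (ι.toFun.restrictScalars k).lTensor (tpow k C M p) ∘ₗ e.toLinearMap
  | l + 1 => TensorProduct.map (embed l) σ.secₖ ∘ₗ
      (TensorProduct.assoc k M (tpow k Q W l) Q).symm.toLinearMap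

/-- The retraction of `embed`. -/
def unembed : ∀ l : ℕ, tpow k C M (p + 1 + l) →ₗ[k] M ⊗[k] tpow k Q W l
  | 0 => e.symm.toLinearMap ∘ₗ σ.retₖ.lTensor (tpow k C M p)
  | l + 1 => (TensorProduct.assoc k M (tpow k Q W l) Q).toLinearMap ∘ₗ
      TensorProduct.map (unembed l) (π.toFun.restrictScalars k)

omit [Module B M] [IsScalarTower k B M] in
lemma unembed_comp_embed (l : ℕ) : σ.unembed e l ∘ₗ σ.embed e l = LinearMap.id := by
  induction l with
  | zero =>
    have h : σ.retₖ.lTensor (tpow k C M p) ∘ₗ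
        (ι.toFun.restrictScalars k).lTensor (tpow k C M p) = LinearMap.id := by
      rw [← LinearMap.lTensor_comp, show σ.retₖ ∘ₗ ι.toFun.restrictScalars k = LinearMap.id from
        LinearMap.ext σ.ret_map, LinearMap.lTensor_id]
    refine LinearMap.ext fun z => ?_
    have := LinearMap.congr_fun h (e z)
    exact (congrArg e.symm this).trans (e.symm_apply_apply z)
  | succ l ih =>
    have h : TensorProduct.map (σ.unembed e l) (π.toFun.restrictScalars k) ∘ₗ
        TensorProduct.map (σ.embed e l) σ.secₖ = LinearMap.id := by
      rw [← TensorProduct.map_comp, ih, show π.toFun.restrictScalars k ∘ₗ σ.secₖ = LinearMap.id from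
        LinearMap.ext σ.map_sec, TensorProduct.map_id]
    refine LinearMap.ext fun z => ?_
    have := LinearMap.congr_fun h ((TensorProduct.assoc k M (tpow k Q W l) Q).symm z)
    exact (congrArg (TensorProduct.assoc k M (tpow k Q W l) Q) this).trans
      (LinearEquiv.apply_symm_apply _ z)

omit [Module B M] [IsScalarTower k B M] in
-- The layer is exactly the difference of consecutive projections: `ι ∘ ret = id - idem` in place `p
-- + 1`, the identity before it and `idem` after it.
lemma embed_comp_unembed (l : ℕ) :
    σ.embed e l ∘ₗ σ.unembed e l = σ.proj M (p + 1) (p + 1 + l) - σ.proj M p (p + 1 + l) := by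
  induction l with
  | zero =>
    have h : (ι.toFun.restrictScalars k).lTensor (tpow k C M p) ∘ₗ
        σ.retₖ.lTensor (tpow k C M p) = LinearMap.id -
          TensorProduct.map LinearMap.id σ.idem := by
      refine TensorProduct.ext' fun t c => ?_
      have := σ.map_ret_add c
      rw [← eq_sub_iff_add_eq] at this
      simp only [LinearMap.comp_apply, LinearMap.lTensor_tmul, LinearMap.sub_apply,
        TensorProduct.map_tmul, LinearMap.id_apply, LinearMap.restrictScalars_apply, retₖ_apply,
        this, TensorProduct.tmul_sub, idem_apply]
    have h1 : σ.proj M p (p + 1) = TensorProduct.map LinearMap.id σ.idem := by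
      rw [σ.proj_succ le_rfl, σ.proj_of_le le_rfl]
    have h3 : σ.proj M (p + 1) (p + 1) = LinearMap.id := σ.proj_of_le le_rfl
    have h2 : σ.embed e 0 ∘ₗ σ.unembed e 0 = (ι.toFun.restrictScalars k).lTensor (tpow k C M p) ∘ₗ
        σ.retₖ.lTensor (tpow k C M p) := by
      refine LinearMap.ext fun z => ?_
      exact congrArg ((ι.toFun.restrictScalars k).lTensor (tpow k C M p))
        (e.apply_symm_apply (σ.retₖ.lTensor (tpow k C M p) z))
    exact h2.trans (h.trans (congrArg₂ (· - ·) h3 h1).symm)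
  | succ l ih =>
    have h : TensorProduct.map (σ.embed e l) σ.secₖ ∘ₗ
        TensorProduct.map (σ.unembed e l) (π.toFun.restrictScalars k) =
        TensorProduct.map (σ.proj M (p + 1) (p + 1 + l)) σ.idem -
          TensorProduct.map (σ.proj M p (p + 1 + l)) σ.idem := by
      rw [← TensorProduct.map_comp, ih]
      exact TensorProduct.ext' fun t c => by
        simp only [TensorProduct.map_tmul, LinearMap.sub_apply, TensorProduct.sub_tmul]; rfl
    have h1 := σ.proj_succ (M := M) (p := p) (n := p + 1 + l) (by omega)
    have h2 := σ.proj_succ (M := M) (p := p + 1) (n := p + 1 + l) (by omega)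
    have h3 : σ.embed e (l + 1) ∘ₗ σ.unembed e (l + 1) = TensorProduct.map (σ.embed e l) σ.secₖ ∘ₗ
        TensorProduct.map (σ.unembed e l) (π.toFun.restrictScalars k) := by
      refine LinearMap.ext fun z => ?_
      exact congrArg (TensorProduct.map (σ.embed e l) σ.secₖ)
        (LinearEquiv.symm_apply_apply (TensorProduct.assoc k M (tpow k Q W l) Q)
          (TensorProduct.map (σ.unembed e l) (π.toFun.restrictScalars k) z))
    exact h3.trans (h.trans (congrArg₂ (· - ·) h2 h1).symm)

omit [Module B M] [IsScalarTower k B M] in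
lemma embed_eq_sub (l : ℕ) : σ.embed e l = σ.proj M (p + 1) (p + 1 + l) ∘ₗ σ.embed e l -
    σ.proj M p (p + 1 + l) ∘ₗ σ.embed e l := by
  rw [← LinearMap.sub_comp, ← σ.embed_comp_unembed e, LinearMap.comp_assoc,
    σ.unembed_comp_embed, LinearMap.comp_id]

omit [Module B M] [IsScalarTower k B M] in
lemma proj_comp_embed (l : ℕ) : σ.proj M p (p + 1 + l) ∘ₗ σ.embed e l = 0 := by
  rw [σ.embed_eq_sub e l, LinearMap.comp_sub, ← LinearMap.comp_assoc, ← LinearMap.comp_assoc,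
    σ.proj_comp_proj (Nat.le_succ p), σ.proj_comp_proj le_rfl, sub_self]

omit [Module B M] [IsScalarTower k B M] in
lemma proj_succ_comp_embed (l : ℕ) :
    σ.proj M (p + 1) (p + 1 + l) ∘ₗ σ.embed e l = σ.embed e l := by
  conv_rhs => rw [σ.embed_eq_sub e l, proj_comp_embed, sub_zero]

variable {α : B →ₗ[k] W →ₗ[k] W}

lemma embed_equivariant (he : IsEquivariant (diagAction (actionMap k B M) α)
      (diagAction (tpowAction k B C M p) (actionMap k B K)) e.toLinearMap) (l : ℕ) :
    IsEquivariant (diagAction (actionMap k B M) (tpowActionOf Q α l))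
      (tpowAction k B C M (p + 1 + l)) (σ.embed e l) := by
  induction l with
  | zero => exact ((IsEquivariant.id _).map fun b x => ι.toFun.map_smul b x).comp he
  | succ l ih => exact (ih.map σ.secₖ_equivariant).comp (IsEquivariant.assoc _ _ _).symm

lemma unembed_equivariant (he : IsEquivariant (diagAction (actionMap k B M) α)
      (diagAction (tpowAction k B C M p) (actionMap k B K)) e.toLinearMap) (l : ℕ) :
    IsEquivariant (tpowAction k B C M (p + 1 + l))
      (diagAction (actionMap k B M) (tpowActionOf Q α l)) (σ.unembed e l) := by
  induction l with
  | zero => exact he.symm.comp ((IsEquivariant.id _).map σ.retₖ_equivariant)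
  | succ l ih => exact (IsEquivariant.assoc _ _ _).comp (ih.map fun b c => π.toFun.map_smul b c)

lemma leftCoact_embed (N : EquivBicomodule k B C M)
    (he : ∀ z, TensorProduct.assoc k C (tpow k C M p) K ((leftCoact N p).rTensor K (e z)) =
        e.toLinearMap.lTensor C (TensorProduct.assoc k C M W (N.left.rTensor W z))) (l : ℕ) :
    leftCoact N (p + 1 + l) ∘ₗ σ.embed e l = (σ.embed e l).lTensor C ∘ₗ
      (TensorProduct.assoc k C M (tpow k Q W l)).toLinearMap ∘ₗ N.left.rTensor _ := by
  induction l with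
  | zero =>
    refine LinearMap.ext fun z => ?_
    have h : ∀ y : tpow k C M p ⊗[k] K, leftExtend (leftCoact N p)
        ((ι.toFun.restrictScalars k).lTensor (tpow k C M p) y) =
        ((ι.toFun.restrictScalars k).lTensor (tpow k C M p)).lTensor C
          (TensorProduct.assoc k C (tpow k C M p) K ((leftCoact N p).rTensor K y)) := by
      intro y
      induction y using TensorProduct.induction_on with
      | zero => simp
      | add x y hx hy => simp only [map_add, hx, hy]
      | tmul t x =>
        simp only [leftExtend, LinearMap.comp_apply, LinearMap.lTensor_tmul,
          LinearMap.rTensor_tmul, LinearEquiv.coe_coe]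
        induction leftCoact N p t using TensorProduct.induction_on with
        | zero => simp
        | add x y hx hy => simp only [map_add, TensorProduct.add_tmul, hx, hy]
        | tmul a b => simp
    refine (h (e z)).trans ((congrArg _ (he z)).trans ?_)
    exact (LinearMap.congr_fun (LinearMap.lTensor_comp C
      ((ι.toFun.restrictScalars k).lTensor (tpow k C M p)) e.toLinearMap)
      (TensorProduct.assoc k C M W (N.left.rTensor W z))).symm
  | succ l ih =>
    refine LinearMap.ext fun z => ?_
    have h : ∀ v : M ⊗[k] (tpow k Q W l ⊗[k] Q), leftExtend (leftCoact N (p + 1 + l))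
        (TensorProduct.map (σ.embed e l) σ.secₖ
          ((TensorProduct.assoc k M (tpow k Q W l) Q).symm v)) =
        (TensorProduct.map (σ.embed e l) σ.secₖ ∘ₗ
          (TensorProduct.assoc k M (tpow k Q W l) Q).symm.toLinearMap).lTensor C
          (TensorProduct.assoc k C M (tpow k Q W l ⊗[k] Q) (N.left.rTensor _ v)) := by
      intro v
      induction v using TensorProduct.induction_on with
      | zero => simp
      | add x y hx hy => simp only [map_add, hx, hy]
      | tmul m v =>
        induction v using TensorProduct.induction_on with
        | zero => simp
        | add x y hx hy => simp only [map_add, TensorProduct.tmul_add, hx, hy]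
        | tmul u q =>
          rw [TensorProduct.assoc_symm_tmul, leftExtend_comp_map ih]
          simp only [LinearMap.comp_apply, LinearMap.rTensor_tmul, LinearEquiv.coe_coe]
          induction N.left m using TensorProduct.induction_on with
          | zero => simp
          | add x y hx hy => simp only [map_add, TensorProduct.add_tmul, hx, hy]
          | tmul a b => simp
    exact h z

omit [Module B M] [IsScalarTower k B M] in
-- The induction step of `proj_barD_embed`: the earlier faces are carried along, and splitting the
-- last `Q` inside `C`, then projecting both legs, gives the comultiplication of `Q`.
lemma splitLast_embed_step {V U : Type u} [AddCommGroup V] [Module k V] [AddCommGroup U]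
    [Module k U] {J : M ⊗[k] U →ₗ[k] V} {b : V →ₗ[k] V ⊗[k] C} {P : V →ₗ[k] V}
    {zb : U →ₗ[k] U ⊗[k] Q} {P' : V ⊗[k] C →ₗ[k] V ⊗[k] C} (hP' : P' = TensorProduct.map P σ.idem)
    {J' : M ⊗[k] (U ⊗[k] Q) →ₗ[k] V ⊗[k] C} (hJ' : J' = TensorProduct.map J σ.secₖ ∘ₗ
      (TensorProduct.assoc k M U Q).symm.toLinearMap) (hP : P ∘ₗ J = J)
    (h : P' ∘ₗ b ∘ₗ J = J' ∘ₗ zb.lTensor M) (s : k) :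
    TensorProduct.map P' σ.idem ∘ₗ (b.rTensor C + s • splitLast k B C V) ∘ₗ J' =
      (TensorProduct.map J' σ.secₖ ∘ₗ (TensorProduct.assoc k M (U ⊗[k] Q) Q).symm.toLinearMap) ∘ₗ
        (zb.rTensor Q + s • splitLast k B Q U).lTensor M := by
  have key : ∀ (m : M) (u : U) (q : Q),
      (TensorProduct.map P' σ.idem ∘ₗ (b.rTensor C + s • splitLast k B C V) ∘ₗ J')
        (m ⊗ₜ (u ⊗ₜ q)) = (TensorProduct.map J' σ.secₖ ∘ₗ
          (TensorProduct.assoc k M (U ⊗[k] Q) Q).symm.toLinearMap)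
          ((zb.rTensor Q + s • splitLast k B Q U).lTensor M (m ⊗ₜ (u ⊗ₜ q))) := by
    intro m u q
    have h1 := LinearMap.congr_fun h (m ⊗ₜ u)
    have h2 := LinearMap.congr_fun hP (m ⊗ₜ u)
    have h3 := LinearMap.congr_fun σ.idem_comp_sec q
    simp only [LinearMap.comp_apply, LinearMap.lTensor_tmul] at h1 h2 h3
    have h4 : J' (m ⊗ₜ (u ⊗ₜ q)) = J (m ⊗ₜ u) ⊗ₜ σ.secₖ q := by simp [hJ']
    simp only [LinearMap.comp_apply, h4, LinearMap.add_apply, LinearMap.smul_apply, map_add,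
      map_smul, LinearMap.rTensor_tmul, LinearMap.lTensor_tmul, TensorProduct.map_tmul, h1, h3,
      TensorProduct.tmul_add, TensorProduct.tmul_smul, LinearEquiv.coe_coe,
      TensorProduct.assoc_symm_tmul]
    congr 2
    rw [hP', map_comp_splitLast, h2, map_idem_comul_sec]
    simp only [splitLast, LinearMap.comp_apply, LinearMap.lTensor_tmul, LinearEquiv.coe_coe]
    induction ModuleCoalgebra.comul (k := k) B q using TensorProduct.induction_on with
    | zero => simp
    | add x y hx hy => simp only [map_add, TensorProduct.tmul_add, hx, hy]
    | tmul a b => simp [hJ']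
  refine TensorProduct.ext' fun m v => ?_
  induction v using TensorProduct.induction_on with
  | zero => simp
  | add x y hx hy => simp only [TensorProduct.tmul_add, map_add, hx, hy]
  | tmul u q => exact key m u q

/-- Only comultiplications of the factors `Q` after `K` survive the projection, so the induced
differential is `zeroBar` with starting sign fixed by `t = p + 1`, the number of factors up to and
including `K`. -/
lemma proj_barD_embed (N : EquivBicomodule k B C M) (l : ℕ) :
    σ.proj M (p + 1) (p + 1 + l + 1) ∘ₗ barD N (p + 1 + l) ∘ₗ σ.embed e l =
      σ.embed e (l + 1) ∘ₗ (zeroBar k B Q W (p + 1) l).lTensor M := by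
  induction l with
  | zero =>
    -- With `K` last, the earlier faces move it to place `p + 2`, and its own comultiplication lies
    -- in `K ⊗ K`. In both cases the new last factor comes from `K` and `idem` kills it.
    have h : ∀ (b : tpow k C M p →ₗ[k] tpow k C M p ⊗[k] C) (s : k) (y : tpow k C M p ⊗[k] K),
        TensorProduct.map LinearMap.id σ.idem ((b.rTensor C + s • splitLast k B C (tpow k C M p))
          ((ι.toFun.restrictScalars k).lTensor (tpow k C M p) y)) = 0 := by
      intro b s y
      induction y using TensorProduct.induction_on with
      | zero => simp
      | add x y hx hy => simp only [map_add, hx, hy, add_zero]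
      | tmul t x =>
        have h1 := LinearMap.congr_fun σ.idem_comp_map x
        have h2 := map_comp_splitLast (B := B) (LinearMap.id (M := tpow k C M p)) LinearMap.id
          σ.idem t (ι.toFun x)
        have h3 := LinearMap.congr_fun ι.map_comul x
        simp only [LinearMap.comp_apply, LinearMap.restrictScalars_apply, LinearMap.zero_apply]
          at h1 h3
        have h4 : TensorProduct.map LinearMap.id σ.idem (TensorProduct.map
            (ι.toFun.restrictScalars k) (ι.toFun.restrictScalars k)
            (ModuleCoalgebra.comul (k := k) B x)) = 0 := by
          rw [← LinearMap.comp_apply, ← TensorProduct.map_comp, idem_comp_map,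
            TensorProduct.map_zero_right, LinearMap.zero_apply]
        rw [← h3, h4, TensorProduct.map_id] at h2
        simp only [LinearMap.lTensor_tmul, LinearMap.add_apply, LinearMap.smul_apply,
          LinearMap.rTensor_tmul, LinearMap.restrictScalars_apply, map_add, map_smul,
          TensorProduct.map_tmul, h1, h2, TensorProduct.tmul_zero, map_zero, smul_zero, add_zero]
    rw [zeroBar_zero, LinearMap.lTensor_zero, LinearMap.comp_zero]
    have h1 : σ.proj M (p + 1) (p + 1 + 1) = TensorProduct.map LinearMap.id σ.idem := by
      rw [σ.proj_succ le_rfl, σ.proj_of_le le_rfl]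
    refine LinearMap.ext fun z => (LinearMap.congr_fun h1 _).trans ?_
    have h2 := LinearMap.congr_fun (barD_succ N p) ((ι.toFun.restrictScalars k).lTensor _ (e z))
    exact (congrArg _ h2).trans (h (barD N p) _ (e z))
  | succ l ih =>
    rw [zeroBar_succ]
    have h1 : σ.proj M (p + 1) (p + 1 + (l + 1) + 1) =
      TensorProduct.map (σ.proj M (p + 1) (p + 1 + l + 1)) σ.idem := σ.proj_succ (by omega)
    have h2 : barD N (p + 1 + (l + 1)) = rTensorT (barD N (p + 1 + l)) +
      (-1 : k) ^ (p + 1 + l + 1) • splitLastT B (p + 1 + l) := barD_succ N (p + 1 + l)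
    rw [h1, h2]
    exact σ.splitLast_embed_step (σ.proj_succ (by omega)) rfl (σ.proj_succ_comp_embed e l) ih _

end Splitting

/-- The long exact homology sequence of the kernel sequence: surjectivity makes it short exact, and
an acyclic kernel forces isomorphisms on homology. The hypotheses are stated on elements so that
they can be checked modulo `coinvKer`. -/
lemma quasiIso_of_surjective_of_kernel_exact {k : Type u} [Ring k]
    {K L : CochainComplex (ModuleCat.{u} k) ℕ} (f : K ⟶ L)
    (hf : ∀ i, Function.Surjective (f.f i))
    (h0 : ∀ z, K.d 0 1 z = 0 → f.f 0 z = 0 → z = 0)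
    (h : ∀ n z, K.d (n + 1) (n + 2) z = 0 → f.f (n + 1) z = 0 →
      ∃ y, f.f n y = 0 ∧ K.d n (n + 1) y = z) : QuasiIso f := by
  have : ∀ i, Epi (f.f i) := fun i => (ModuleCat.epi_iff_surjective _).2 (hf i)
  have : Epi f := HomologicalComplex.epi_of_epi_f f inferInstance
  have hS : (ShortComplex.kernelSequence f).ShortExact :=
    { exact := ShortComplex.kernelSequence_exact f
      mono_f := inferInstanceAs (Mono (Limits.kernel.ι f))
      epi_g := inferInstanceAs (Epi f) }
  let i := Limits.kernel.ι f
  have hi : ∀ n, Function.Injective (i.f n) := fun n =>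
    (ModuleCat.mono_iff_injective _).1 (inferInstanceAs (Mono (i.f n)))
  have he : ∀ n, Function.Exact (i.f n) (f.f n) := fun n =>
    (ShortComplex.ShortExact.moduleCat_exact_iff_function_exact _).1
      (hS.map_of_exact (HomologicalComplex.eval _ _ n)).exact
  have hd : ∀ m n z, i.f n ((Limits.kernel f).d m n z) = K.d m n (i.f m z) := fun m n z =>
    (ConcreteCategory.congr_hom (i.comm m n) z).symm
  have hK : ∀ n, (ShortComplex.kernelSequence f).X₁.ExactAt n := by
    intro n
    change (Limits.kernel f).ExactAt n
    cases n with
    | zero =>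
      rw [HomologicalComplex.exactAt_iff' _ 0 0 1 (by simp) (by simp),
        ShortComplex.ShortExact.moduleCat_exact_iff_function_exact]
      intro x
      change (Limits.kernel f).d 0 1 x = 0 ↔ x ∈ Set.range ((Limits.kernel f).d 0 0)
      have hz : (Limits.kernel f).d 0 0 = 0 := HomologicalComplex.shape _ _ _ (by simp)
      refine ⟨fun hx => ⟨0, ?_⟩, ?_⟩
      · rw [map_zero]
        refine (hi 0 ?_).symm
        rw [map_zero]
        exact h0 _ ((hd 0 1 x).symm.trans ((congrArg _ hx).trans (map_zero _))) ((he 0).apply_apply_eq_zero x)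
      · rintro ⟨y, rfl⟩
        rw [hz]
        exact map_zero _
    | succ n =>
      rw [HomologicalComplex.exactAt_iff' _ n (n + 1) (n + 2) (by simp) (by simp),
        ShortComplex.ShortExact.moduleCat_exact_iff_function_exact]
      intro x
      change (Limits.kernel f).d (n + 1) (n + 2) x = 0 ↔
        x ∈ Set.range ((Limits.kernel f).d n (n + 1))
      refine ⟨fun hx => ?_, ?_⟩
      · obtain ⟨y, hy, hy'⟩ := h n (i.f (n + 1) x)
          ((hd (n + 1) (n + 2) x).symm.trans ((congrArg _ hx).trans (map_zero _)))
          ((he (n + 1)).apply_apply_eq_zero x)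
        obtain ⟨y, rfl⟩ := (he n y).1 hy
        exact ⟨y, hi (n + 1) (by rw [hd, hy'])⟩
      · rintro ⟨y, rfl⟩
        exact ConcreteCategory.congr_hom ((Limits.kernel f).d_comp_d n (n + 1) (n + 2)) y
  rw [quasiIso_iff]
  intro n
  rw [quasiIsoAt_iff_isIso_homologyMap]
  -- Vanishing of the kernel's homology in degree `n` gives a monomorphism, and in degree `n + 1`,
  -- through the connecting map, an epimorphism.
  have h1 : ∀ n, Limits.IsZero ((ShortComplex.kernelSequence f).X₁.homology n) := fun n =>
    (HomologicalComplex.exactAt_iff_isZero_homology _ _).1 (hK n)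
  have hm : Mono (HomologicalComplex.homologyMap f n) :=
    (hS.homology_exact₂ n).mono_g ((h1 n).eq_of_src _ _)
  have hp : Epi (HomologicalComplex.homologyMap f n) :=
    (hS.homology_exact₃ n (n + 1) (by simp)).epi_f ((h1 (n + 1)).eq_of_tgt _ _)
  exact isIso_of_mono_of_epi _

/-! ### The cyclic face on the layers of the filtration. -/

namespace Splitting

variable {k B : Type u} [Field k] [Ring B] [HopfAlgebra k B]
variable {K C Q W : Type u}
  [AddCommGroup K] [Module k K] [Module B K] [IsScalarTower k B K] [ModuleCoalgebra k B K]
  [AddCommGroup C] [Module k C] [Module B C] [IsScalarTower k B C] [ModuleCoalgebra k B C]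
  [AddCommGroup Q] [Module k Q] [Module B Q] [IsScalarTower k B Q] [ModuleCoalgebra k B Q]
  [AddCommGroup W] [Module k W]
variable {ι : ModuleCoalgebraHom k B K C} {π : ModuleCoalgebraHom k B C Q} (σ : Splitting ι π)
  (hex : IsShortExact ι π)

/-- Pushing the left `C`-coaction of `Q` forward along `π` gives the comultiplication of `Q`, and
`idem` factors through `π`. -/
lemma idem_rTensor_quotLeft (m : Q) : σ.idem.rTensor Q (hex.quotLeft m) =
    σ.secₖ.rTensor Q (ModuleCoalgebra.comul (k := k) B m) := by
  have h := LinearMap.congr_fun hex.id_isBicomoduleMap.left m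
  have h1 : σ.idem.rTensor Q = σ.secₖ.rTensor Q ∘ₗ (π.toFun.restrictScalars k).rTensor Q :=
    LinearMap.rTensor_comp ..
  rw [h1, LinearMap.comp_apply]
  exact (congrArg (σ.secₖ.rTensor Q) h).symm

variable {p : ℕ} (e : Q ⊗[k] W ≃ₗ[k] tpow k C Q p ⊗[k] K)
  (hc : ∀ z, TensorProduct.assoc k C (tpow k C Q p) K
      ((leftCoact hex.quotBicomodule p).rTensor K (e z)) =
    e.toLinearMap.lTensor C (TensorProduct.assoc k C Q W (hex.quotLeft.rTensor W z)))

include hc in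
-- Through the embedding, the projected `C`-coaction becomes the coaction of `Q` on the leading
-- factor; `hc` ensures that regrouping into `W` did not disturb that factor.
lemma idem_leftCoact_embed (l : ℕ) :
    (σ.idem.rTensor _ ∘ₗ leftCoact hex.quotBicomodule (p + 1 + l)) ∘ₗ σ.embed e l =
      TensorProduct.map σ.secₖ (σ.embed e l) ∘ₗ freeCoact k B Q (tpow k Q W l) := by
  rw [LinearMap.comp_assoc, σ.leftCoact_embed e hex.quotBicomodule hc l]
  refine TensorProduct.ext' fun m u => ?_
  have h1 : ∀ w : C ⊗[k] Q, σ.idem.rTensor _ ((σ.embed e l).lTensor C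
      (TensorProduct.assoc k C Q (tpow k Q W l) (w ⊗ₜ u))) =
      (σ.embed e l).lTensor C
        (TensorProduct.assoc k C Q (tpow k Q W l) (σ.idem.rTensor Q w ⊗ₜ u)) := by
    intro w
    induction w using TensorProduct.induction_on with
    | zero => simp
    | add x y hx hy => simp only [map_add, TensorProduct.add_tmul, hx, hy]
    | tmul a b => simp
  refine (h1 (hex.quotLeft m)).trans ?_
  rw [idem_rTensor_quotLeft]
  simp only [freeCoact, LinearMap.comp_apply, LinearMap.rTensor_tmul, LinearEquiv.coe_coe]
  induction ModuleCoalgebra.comul (k := k) B m using TensorProduct.induction_on with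
  | zero => simp
  | add x y hx hy => simp only [map_add, TensorProduct.add_tmul, hx, hy]
  | tmul a b => simp

variable (X : Type u) [AddCommGroup X] [Module k X]

lemma proj_embed_lTensor (l : ℕ) (z : X ⊗[k] (Q ⊗[k] tpow k Q W l)) :
    (σ.proj Q (p + 1) (p + 1 + l)).lTensor X ((σ.embed e l).lTensor X z) =
      (σ.embed e l).lTensor X z := by
  rw [← LinearMap.comp_apply, ← LinearMap.lTensor_comp, proj_succ_comp_embed]

include hc in
lemma proj_chCyclic_embed [LeftComodule k B X] (l : ℕ) (z : X ⊗[k] (Q ⊗[k] tpow k Q W l)) :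
    (σ.proj Q (p + 1) (p + 1 + l + 1)).lTensor X (chCyclic X hex.quotBicomodule (p + 1 + l)
      ((σ.embed e l).lTensor X z)) =
      (σ.embed e (l + 1)).lTensor X (freeCyclicT k B X Q W l z) := by
  have h1 := LinearMap.congr_fun (σ.proj_chCyclic X hex.quotBicomodule
    (show p + 1 ≤ p + 1 + l by omega)) ((σ.embed e l).lTensor X z)
  have h2 := congrArg (cyclicMap B X (σ.idem.rTensor _ ∘ₗ
    leftCoact hex.quotBicomodule (p + 1 + l))) (σ.proj_embed_lTensor e X l z)
  have h3 := LinearMap.congr_fun (cyclicMap_natural (X := X) (freeCoact k B Q (tpow k Q W l))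
    (σ.idem.rTensor _ ∘ₗ leftCoact hex.quotBicomodule (p + 1 + l)) σ.secₖ
    (fun b q => σ.secₖ_equivariant b q) (σ.embed e l) (σ.idem_leftCoact_embed hex e hc l)) z
  refine h1.trans (h2.trans (h3.trans ?_))
  have h4 : ∀ y : X ⊗[k] ((Q ⊗[k] tpow k Q W l) ⊗[k] Q),
      (TensorProduct.map (σ.embed e l) σ.secₖ).lTensor X y =
      (TensorProduct.map (σ.embed e l) σ.secₖ ∘ₗ
        (TensorProduct.assoc k Q (tpow k Q W l) Q).symm.toLinearMap).lTensor X
          ((TensorProduct.assoc k Q (tpow k Q W l) Q).toLinearMap.lTensor X y) := by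
    intro y
    rw [← LinearMap.comp_apply, ← LinearMap.lTensor_comp, LinearMap.comp_assoc,
      LinearEquiv.symm_comp, LinearMap.comp_id]
  exact h4 _

include hc in
-- Identifies the differential induced on a layer with `freeD`, whose exactness was obtained by
-- rotation.
lemma proj_chD_embed [LeftComodule k B X] (l : ℕ) (z : X ⊗[k] (Q ⊗[k] tpow k Q W l)) :
    (σ.proj Q (p + 1) (p + 1 + l + 1)).lTensor X (chD X hex.quotBicomodule (p + 1 + l)
      ((σ.embed e l).lTensor X z)) =
      (σ.embed e (l + 1)).lTensor X (freeD k B X Q W (p + 1) l z) := by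
  have h := LinearMap.congr_fun (congrArg (LinearMap.lTensor X)
    (σ.proj_barD_embed e hex.quotBicomodule l)) z
  simp only [LinearMap.lTensor_comp, LinearMap.comp_apply] at h
  rw [chD_eq, freeD, LinearMap.add_apply, LinearMap.smul_apply, map_add, map_smul,
    LinearMap.add_apply, LinearMap.smul_apply, map_add, map_smul, h,
    σ.proj_chCyclic_embed hex e hc]

end Splitting

/-! ### Exactness of the kernel by climbing the filtration. -/

namespace Splitting

variable {k B : Type u} [Field k] [Ring B] [HopfAlgebra k B] [BijectiveAntipode k B]
variable {K C Q W : Type u}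
  [AddCommGroup K] [Module k K] [Module B K] [IsScalarTower k B K] [ModuleCoalgebra k B K]
  [AddCommGroup C] [Module k C] [Module B C] [IsScalarTower k B C] [ModuleCoalgebra k B C]
  [AddCommGroup Q] [Module k Q] [Module B Q] [IsScalarTower k B Q] [ModuleCoalgebra k B Q]
  [AddCommGroup W] [Module k W]
variable {ι : ModuleCoalgebraHom k B K C} {π : ModuleCoalgebraHom k B C Q} (σ : Splitting ι π)
  (hex : IsShortExact ι π)
variable (X : Type u) [AddCommGroup X] [Module k X] [Module B X] [IsScalarTower k B X]
  [AYDModule k B X]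

omit [BijectiveAntipode k B] [AYDModule k B X] in
lemma proj_mem_coinvKer {M : Type u} [AddCommGroup M] [Module k M] [Module B M]
    [IsScalarTower k B M] (p n : ℕ) {z : X ⊗[k] tpow k C M n}
    (hz : z ∈ coinvKer (chAction k B C M X n)) :
    (σ.proj M p n).lTensor X z ∈ coinvKer (chAction k B C M X n) :=
  coinvKer_le_of_equivariant (twistedAction_comm _ (σ.proj_equivariant p n)) hz

variable {p : ℕ} {e : Q ⊗[k] W ≃ₗ[k] tpow k C Q p ⊗[k] K} {α : B →ₗ[k] W →ₗ[k] W}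
  (he : IsEquivariant (diagAction (actionMap k B Q) α)
      (diagAction (tpowAction k B C Q p) (actionMap k B K)) e.toLinearMap)
  (hc : ∀ z, TensorProduct.assoc k C (tpow k C Q p) K
      ((leftCoact hex.quotBicomodule p).rTensor K (e z)) =
    e.toLinearMap.lTensor C (TensorProduct.assoc k C Q W (hex.quotLeft.rTensor W z)))

omit [BijectiveAntipode k B] [AYDModule k B X] in
include he in
lemma embed_mem_coinvKer (l : ℕ) {z : X ⊗[k] (Q ⊗[k] tpow k Q W l)}
    (hz : z ∈ coinvKer (twistedAction (actionMap k B X)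
      (diagAction (actionMap k B Q) (tpowActionOf Q α l)))) :
    (σ.embed e l).lTensor X z ∈ coinvKer (chAction k B C Q X (p + 1 + l)) :=
  coinvKer_le_of_equivariant (twistedAction_comm _ (σ.embed_equivariant e he l)) hz

omit [BijectiveAntipode k B] [AYDModule k B X] in
include he in
-- The retraction `unembed` is equivariant, so embedding a layer creates no new coinvariance
-- relations.
lemma mem_coinvKer_of_embed (l : ℕ) {z : X ⊗[k] (Q ⊗[k] tpow k Q W l)}
    (hz : (σ.embed e l).lTensor X z ∈ coinvKer (chAction k B C Q X (p + 1 + l))) :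
    z ∈ coinvKer (twistedAction (actionMap k B X)
      (diagAction (actionMap k B Q) (tpowActionOf Q α l))) := by
  have h : (σ.unembed e l).lTensor X ((σ.embed e l).lTensor X z) = z := by
    rw [← LinearMap.comp_apply, ← LinearMap.lTensor_comp, unembed_comp_embed, LinearMap.lTensor_id,
      LinearMap.id_apply]
  rw [← h]
  exact coinvKer_le_of_equivariant (twistedAction_comm _ (σ.unembed_equivariant e he l)) hz

include he hc in
-- The layer component of `z` is `proj (p + 1) z - proj p z`. Its induced differential is the
-- projection of `d z` minus that of `d (proj p z)`, and both are relations.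
lemma freeD_unembed_mem (l : ℕ) {z : X ⊗[k] tpow k C Q (p + 1 + l)}
    (hz : chD X hex.quotBicomodule (p + 1 + l) z ∈
      coinvKer (chAction k B C Q X (p + 1 + l + 1)))
    (hp : (σ.proj Q p (p + 1 + l)).lTensor X z ∈ coinvKer (chAction k B C Q X (p + 1 + l))) :
    freeD k B X Q W (p + 1) l ((σ.unembed e l).lTensor X z) ∈
      coinvKer (twistedAction (actionMap k B X)
        (diagAction (actionMap k B Q) (tpowActionOf Q α (l + 1)))) := by
  apply σ.mem_coinvKer_of_embed X he (l + 1)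
  have h1 : (σ.embed e l).lTensor X ((σ.unembed e l).lTensor X z) =
      (σ.proj Q (p + 1) (p + 1 + l)).lTensor X z - (σ.proj Q p (p + 1 + l)).lTensor X z := by
    rw [← LinearMap.comp_apply, ← LinearMap.lTensor_comp, embed_comp_unembed, LinearMap.lTensor_sub,
      LinearMap.sub_apply]
  have h2 := LinearMap.congr_fun (σ.proj_chD_proj X hex.quotBicomodule (p + 1) (p + 1 + l)) z
  simp only [LinearMap.comp_apply] at h2
  rw [← σ.proj_chD_embed hex e hc, h1, map_sub, map_sub, h2]
  exact Submodule.sub_mem _ (σ.proj_mem_coinvKer X _ _ hz)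
    (σ.proj_mem_coinvKer X _ _ (chD_coinvKer X hex.quotBicomodule _ hp))

variable [Module.Projective B C] (hQ : HCounital k B Q) {d : ℕ}
  (hX : HasProjectiveDimensionLE (ModuleCat.of B X) d)

omit [BijectiveAntipode k B] in
include σ in
-- `K` is a `B`-direct summand of the projective module `C`. For `p = 0` the inert factor `W` is `K`
-- alone, so its own flatness is needed.
lemma projective_ker : Module.Projective B K :=
  Module.Projective.of_split ι.toFun σ.ret (LinearMap.ext σ.ret_map)

include hQ hX in
-- One step up the filtration: the component of the cycle in layer `p` is a cycle for `freeD`, hence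
-- a boundary there, and subtracting the boundary of the embedded element removes it.
lemma exists_proj_sub_chD_mem {p n : ℕ} (hpn : p ≤ n) {z : X ⊗[k] tpow k C Q (n + 1)}
    (hz : chD X hex.quotBicomodule (n + 1) z ∈ coinvKer (chAction k B C Q X (n + 2)))
    (hp : (σ.proj Q p (n + 1)).lTensor X z ∈ coinvKer (chAction k B C Q X (n + 1))) :
    ∃ y : X ⊗[k] tpow k C Q n, (σ.proj Q p n).lTensor X y = 0 ∧
      (σ.proj Q (p + 1) (n + 1)).lTensor X (z - chD X hex.quotBicomodule n y) ∈
        coinvKer (chAction k B C Q X (n + 1)) := by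
  have := σ.projective_ker
  obtain ⟨W, _, _, α, e, hα, hflat, he, hc⟩ := exists_tpow_tensor_equiv hex.quotBicomodule p K
    (actionMap k B K) (isAction_actionMap K) coinvFlat_of_projective
  have key : ∀ (l : ℕ) (z : X ⊗[k] tpow k C Q (p + 1 + l)),
      (σ.embed e l).lTensor X ((σ.unembed e l).lTensor X z) =
      (σ.proj Q (p + 1) (p + 1 + l)).lTensor X z - (σ.proj Q p (p + 1 + l)).lTensor X z := by
    intro l z
    rw [← LinearMap.comp_apply, ← LinearMap.lTensor_comp, embed_comp_unembed, LinearMap.lTensor_sub,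
      LinearMap.sub_apply]
  -- In degree `n + 1` the layer has `n - p` factors `Q` after `K`. With none, the layer component
  -- is already a relation and no correction is needed.
  obtain rfl | ⟨l, rfl⟩ : n = p ∨ ∃ l, n = p + 1 + l := by
    rcases hpn.eq_or_lt with h | h
    · exact Or.inl h.symm
    · exact Or.inr ⟨n - (p + 1), by omega⟩
  · refine ⟨0, map_zero _, ?_⟩
    rw [map_zero, sub_zero]
    have h1 := freeD_zero_exact hα hflat hQ hX (n + 1)
      (σ.freeD_unembed_mem hex X he hc 0 hz hp)
    have h2 := σ.embed_mem_coinvKer X he 0 h1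
    rw [key] at h2
    exact (Submodule.sub_mem_iff_left _ hp).1 h2
  · obtain ⟨y, hy⟩ := freeD_succ_exact hα hflat hQ hX (p + 1) l
      (σ.freeD_unembed_mem hex X he hc (l + 1) hz hp)
    refine ⟨(σ.embed e l).lTensor X y, ?_, ?_⟩
    · rw [← LinearMap.comp_apply, ← LinearMap.lTensor_comp, proj_comp_embed,
        LinearMap.lTensor_zero, LinearMap.zero_apply]
    · have h2 := σ.embed_mem_coinvKer X he (l + 1) hy
      rw [map_sub, key, ← σ.proj_chD_embed hex e hc, sub_right_comm] at h2
      rw [map_sub]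
      exact (Submodule.sub_mem_iff_left _ hp).1 h2

include hQ hX in
-- Iterates the filtration step from `p = 0` to `p = n + 1`; finitely many steps suffice since `proj
-- (n + 1)` is the identity in degree `n + 1`.
lemma exists_sub_chD_mem {n : ℕ} {z : X ⊗[k] tpow k C Q (n + 1)}
    (hz : chD X hex.quotBicomodule (n + 1) z ∈ coinvKer (chAction k B C Q X (n + 2)))
    (hp : (σ.proj Q 0 (n + 1)).lTensor X z ∈ coinvKer (chAction k B C Q X (n + 1))) :
    ∃ y : X ⊗[k] tpow k C Q n, (σ.proj Q 0 n).lTensor X y = 0 ∧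
      z - chD X hex.quotBicomodule n y ∈ coinvKer (chAction k B C Q X (n + 1)) := by
  have key : ∀ p, p ≤ n + 1 → ∃ y : X ⊗[k] tpow k C Q n, (σ.proj Q 0 n).lTensor X y = 0 ∧
      (σ.proj Q p (n + 1)).lTensor X (z - chD X hex.quotBicomodule n y) ∈
        coinvKer (chAction k B C Q X (n + 1)) := by
    intro p
    induction p with
    | zero => exact fun _ => ⟨0, map_zero _, by rwa [map_zero, sub_zero]⟩
    | succ p ih =>
      intro hpn
      obtain ⟨y, hy, hy'⟩ := ih (by omega)
      have hd : chD X hex.quotBicomodule (n + 1) (z - chD X hex.quotBicomodule n y) ∈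
          coinvKer (chAction k B C Q X (n + 2)) := by
        have := LinearMap.congr_fun (chD_comp_chD X hex.quotBicomodule n) y
        rw [LinearMap.comp_apply, LinearMap.zero_apply] at this
        rwa [map_sub, this, sub_zero]
      obtain ⟨y', h1, h2⟩ := σ.exists_proj_sub_chD_mem hex X hQ hX (by omega) hd hy'
      refine ⟨y + y', ?_, ?_⟩
      · have h3 := congrArg ((σ.proj Q 0 n).lTensor X) h1
        rw [← LinearMap.comp_apply, ← LinearMap.lTensor_comp, σ.proj_comp_proj (Nat.zero_le p),
          map_zero] at h3
        rw [map_add, hy, h3, add_zero]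
      · rwa [map_add, ← sub_sub]
  obtain ⟨y, hy, hy'⟩ := key (n + 1) le_rfl
  rw [σ.proj_of_le le_rfl, LinearMap.lTensor_id] at hy'
  exact ⟨y, hy, hy'⟩

/-- The section of `id_Q ⊗ π ⊗ ⋯ ⊗ π`. -/
def secPow : ∀ n : ℕ, tpow k Q Q n →ₗ[k] tpow k C Q n
  | 0 => LinearMap.id
  | n + 1 => TensorProduct.map (secPow n) σ.secₖ

omit [BijectiveAntipode k B] [Module.Projective B C] in
lemma secPow_equivariant (n : ℕ) :
    IsEquivariant (tpowAction k B Q Q n) (tpowAction k B C Q n) (σ.secPow n) := by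
  induction n with
  | zero => exact IsEquivariant.id _
  | succ n ih => exact ih.map σ.secₖ_equivariant

omit [BijectiveAntipode k B] [Module.Projective B C] in
lemma tpowMap_comp_secPow (n : ℕ) :
    tpowMap π (LinearMap.id : Q →ₗ[B] Q) n ∘ₗ σ.secPow n = LinearMap.id := by
  induction n with
  | zero => rfl
  | succ n ih =>
    have h := TensorProduct.map_comp (tpowMap π (LinearMap.id : Q →ₗ[B] Q) n)
      (π.toFun.restrictScalars k) (σ.secPow n) σ.secₖ
    rw [ih, show π.toFun.restrictScalars k ∘ₗ σ.secₖ = LinearMap.id from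
      LinearMap.ext σ.map_sec, TensorProduct.map_id] at h
    exact h.symm

omit [BijectiveAntipode k B] [Module.Projective B C] in
lemma secPow_comp_tpowMap (n : ℕ) :
    σ.secPow n ∘ₗ tpowMap π (LinearMap.id : Q →ₗ[B] Q) n = σ.proj Q 0 n := by
  induction n with
  | zero => rfl
  | succ n ih =>
    have h := TensorProduct.map_comp (σ.secPow n) σ.secₖ (tpowMap π (LinearMap.id : Q →ₗ[B] Q) n)
      (π.toFun.restrictScalars k)
    rw [ih] at h
    exact h.symm.trans (σ.proj_succ (Nat.zero_le n)).symm

end Splitting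

end

end HopfHochschild

/-- Let `B` be a Hopf algebra with invertible antipode over a field `k`, `X` an anti-Yetter-Drinfeld
module of finite projective dimension over `B`, and `0 → K → C → Q → 0` a short exact sequence of
`B`-module coalgebras with `C` and `Q` projective over `B` and `Q` H-counital. Then `C → Q` induces
a quasi-isomorphism `k ⊗_B CH^tw_*(C, Q; X) → k ⊗_B CH^tw_*(Q; X)`. -/
theorem mainTheorem4 {k B : Type u} [Field k] [Ring B] [HopfAlgebra k B]
    [HopfHochschild.BijectiveAntipode k B]
    {X : Type u} [AddCommGroup X] [Module k X] [Module B X] [IsScalarTower k B X]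
    [HopfHochschild.AYDModule k B X]
    {K C Q : Type u}
    [AddCommGroup K] [Module k K] [Module B K] [IsScalarTower k B K]
    [HopfHochschild.ModuleCoalgebra k B K]
    [AddCommGroup C] [Module k C] [Module B C] [IsScalarTower k B C]
    [HopfHochschild.ModuleCoalgebra k B C]
    [AddCommGroup Q] [Module k Q] [Module B Q] [IsScalarTower k B Q]
    [HopfHochschild.ModuleCoalgebra k B Q]
    (ι : HopfHochschild.ModuleCoalgebraHom k B K C)
    (π : HopfHochschild.ModuleCoalgebraHom k B C Q)
    (hex : HopfHochschild.IsShortExact ι π)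
    (hC : Module.Projective B C) (hQ : Module.Projective B Q)
    (hX : ∃ n : ℕ, HasProjectiveDimensionLE (ModuleCat.of B X) n)
    (hQ' : HopfHochschild.HCounital k B Q) :
    QuasiIso (hex.inducedMap X) := by
  obtain ⟨d, hX⟩ := hX
  obtain ⟨σ⟩ := hex.exists_splitting
  have hsec : ∀ n (w : X ⊗[k] HopfHochschild.tpow k Q Q n),
      (HopfHochschild.tpowMap π (LinearMap.id : Q →ₗ[B] Q) n).lTensor X
        ((σ.secPow n).lTensor X w) = w := fun n w => by
    rw [← LinearMap.comp_apply, ← LinearMap.lTensor_comp, σ.tpowMap_comp_secPow,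
      LinearMap.lTensor_id, LinearMap.id_apply]
  have hproj : ∀ n (z : X ⊗[k] HopfHochschild.tpow k C Q n), (σ.secPow n).lTensor X
      ((HopfHochschild.tpowMap π (LinearMap.id : Q →ₗ[B] Q) n).lTensor X z) =
        (σ.proj Q 0 n).lTensor X z := fun n z => by
    rw [← LinearMap.comp_apply, ← LinearMap.lTensor_comp, σ.secPow_comp_tpowMap]
  have hmem : ∀ n (z : X ⊗[k] HopfHochschild.tpow k C Q n),
      (HopfHochschild.tpowMap π (LinearMap.id : Q →ₗ[B] Q) n).lTensor X z ∈
        HopfHochschild.coinvKer (HopfHochschild.chAction k B Q Q X n) →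
      (σ.proj Q 0 n).lTensor X z ∈
        -- The section `secPow` need not be a chain map, but it is equivariant, which is all that is
        -- needed to turn vanishing in the target coinvariants into a statement about `proj 0`.
        HopfHochschild.coinvKer (HopfHochschild.chAction k B C Q X n) := fun n z hz => by
    rw [← hproj]
    exact HopfHochschild.coinvKer_le_of_equivariant
      (HopfHochschild.twistedAction_comm _ (σ.secPow_equivariant n)) hz
  refine HopfHochschild.quasiIso_of_surjective_of_kernel_exact _ (fun n w => ?_)
    (fun z _ hz => ?_) (fun n z hd hz => ?_)
  · obtain ⟨w, rfl⟩ := Submodule.Quotient.mk_surjective _ w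
    exact ⟨Submodule.Quotient.mk ((σ.secPow n).lTensor X w),
      congrArg Submodule.Quotient.mk (hsec n w)⟩
  · obtain ⟨z, rfl⟩ := Submodule.Quotient.mk_surjective _ z
    -- In degree `0` there are no factors `C` to project, so `proj 0` is the identity and the kernel
    -- is zero.
    have h := hmem 0 z ((Submodule.Quotient.mk_eq_zero _).1 hz)
    rw [σ.proj_of_le le_rfl, LinearMap.lTensor_id] at h
    exact (Submodule.Quotient.mk_eq_zero _).2 h
  · obtain ⟨z, rfl⟩ := Submodule.Quotient.mk_surjective _ z
    rw [HopfHochschild.coinvCH_d] at hd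
    obtain ⟨y, hy, hy'⟩ := σ.exists_sub_chD_mem hex X hQ' hX
      ((Submodule.Quotient.mk_eq_zero _).1 hd) (hmem _ z ((Submodule.Quotient.mk_eq_zero _).1 hz))
    refine ⟨Submodule.Quotient.mk y, (Submodule.Quotient.mk_eq_zero _).2 ?_, ?_⟩
    · have h := hsec n ((HopfHochschild.tpowMap π (LinearMap.id : Q →ₗ[B] Q) n).lTensor X y)
      rw [hproj, hy, map_zero] at h
      exact h ▸ Submodule.zero_mem _
    · rw [HopfHochschild.coinvCH_d]
      exact ((Submodule.Quotient.eq _).2 hy').symm
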